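/- Let $\mathfrak g$ be a finite-dimensional complex Lie algebra and $\mathfrak l\subset\mathfrak g$ a Lie subalgebra with basis $x_1,\dots,x_n$. Let $D$ be the formal neighbourhood of $0$ in $\mathfrak l^*$; for a vector space $V$, functions $D\to V$ are the elements of $V[[x_1,\dots,x_n]]$ (the $x_i$ being viewed as linear coordinates on $\mathfrak l^*$), and $\mathfrak l$ acts on $D$ by the coadjoint action. For a 1-form $\omega=\sum_i\omega_i\,dx_i$ with values in $V$ put $\overline\omega=\sum_i x_i\otimes\omega_i$. For $r\in\mathfrak g\otimes\mathfrak g$ let $CYB(r)=[r^{12},r^{13}]+[r^{12},r^{23}]+[r^{13},r^{23}]$, and for $x\in\mathfrak g^{\otimes3}$ let $\mathrm{Alt}(x)=x^{123}-x^{213}+x^{312}$. Let $\Omega\in(S^2\mathfrak g)^{\mathfrak g}$, and let $Dynr(\mathfrak g,\mathfrak l,\Omega)$ be the set of dynamical r-matrices, that is, of $\mathfrak l$-equivariant functions $r:D\to\mathfrak g\otimes\mathfrak g$ with $$\mathrm{Alt}(\overline{dr})+CYB(r)=0,\qquad r+r^{21}=\Omega .$$ Let $G$ be the simply connected complex Lie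 group with Lie algebra $\mathfrak g$, and let $\mathrm{Map}_0(D,G)^{\mathfrak l}$ be the group of $\mathfrak l$-equivariant formal maps $\gamma:D\to G$ with $\gamma(0)=1$ (equivalently, of the $\gamma=e^{\chi}$ with $\chi:D\to\mathfrak g$ an $\mathfrak l$-equivariant function and $\chi(0)=0$). It acts on functions $r:D\to\mathfrak g\otimes\mathfrak g$ by the gauge transformations $$r^{\gamma}=(\gamma\otimes \gamma)\bigl(r-\overline{\eta_\gamma}+\overline{\eta_\gamma}^{21}-\tau_\gamma\bigr)(\gamma^{-1}\otimes \gamma^{-1}),\qquad \eta_\gamma=\gamma^{-1}d\gamma=\sum_i\eta_i\,dx_i,\qquad \tau_\gamma(\lambda)=\sum_{i,j}\lambda([x_i,x_j])\,\eta_i(\lambda)\otimes\eta_j(\lambda).$$ Assume that i) $\mathfrak m$ is an $\mathfrak l$-invariant complement of $\mathfrak l$ in $\mathfrak g$, and ii) $\Omega\in(\mathfrak l\otimes\mathfrak l)\oplus(\mathfrak m\otimes\mathfrak m)$. Put $$\mathcal M_\Omega=\Bigl\{x\in\tfrac{\Omega}{2}+(\Lambda^2\mathfrak m)^{\mathfrak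 l}\;:\;CYB(x)=0\text{ in }\Lambda^3(\mathfrak g/\mathfrak l)\Bigr\}.$$ Then gauge transformations by $\mathrm{Map}_0(D,G)^{\mathfrak l}$ preserve $Dynr(\mathfrak g,\mathfrak l,\Omega)$, gauge equivalence ($s=r^\gamma$ for some $\gamma\in\mathrm{Map}_0(D,G)^{\mathfrak l}$) is an equivalence relation on it, and the moduli space $\mathcal M(\mathfrak g,\mathfrak l,\Omega)=Dynr(\mathfrak g,\mathfrak l,\Omega)/\mathrm{Map}_0(D,G)^{\mathfrak l}$ is isomorphic to the affine variety $\mathcal M_\Omega$. Precisely: every class $\mathcal C$ contains an $r$ with $r(0)\in\frac\Omega2+\Lambda^2\mathfrak m$; there is a map $\Phi:\mathcal M(\mathfrak g,\mathfrak l,\Omega)\to\mathcal M_\Omega$ that sends $\mathcal C$ to $r(0)$ for every such $r\in\mathcal C$; $\Phi$ is bijective; and a function $f:\mathcal M_\Omega\to\mathbb C$ is regular (the restriction of a polynomial function on $\mathfrak g\otimes\mathfrak g$) if and only if $f\circ\Phi$ is regular on the moduli space, in the sense that $r\mapsto f(\Phi([r]))$ is a polynomial in finitely many coordinates of the Taylor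 coefficients of $r\in Dynr(\mathfrak g,\mathfrak l,\Omega)$. -/

import Mathlib

open scoped TensorProduct

noncomputable section

namespace DynRMat

/-! ### Formal power series with coefficients in a vector space -/

/-- `V[[x₁, …, xₙ]]`, a formal series being given by its coefficients. These are the functions
from the formal neighbourhood `D` of `0` in `𝔩*` to `V`, where `x₁, …, xₙ` is a basis of `𝔩`,
regarded as a system of linear coordinates on `𝔩*`. The coefficient at `0` is the value at
`0 ∈ 𝔩*`. -/
abbrev FormalMap (n : ℕ) (V : Type*) : Type _ := (Fin n →₀ ℕ) → V

section Series

variable {n : ℕ} {V W U : Type*} [AddCommGroup V] [Module ℂ V] [AddCommGroup W] [Module ℂ W]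
  [AddCommGroup U] [Module ℂ U]

/-- The constant function with value `v`. -/
def constMap (n : ℕ) (v : V) : FormalMap n V := fun d => if d = 0 then v else 0

/-- Applying a linear map to the values. -/
def mapVal (L : V →ₗ[ℂ] W) (f : FormalMap n V) : FormalMap n W := fun d => L (f d)

/-- Applying a bilinear map to the values of two series (Cauchy product). -/
def bilin (B : V →ₗ[ℂ] W →ₗ[ℂ] U) (f : FormalMap n V) (h : FormalMap n W) : FormalMap n U :=
  fun d => ∑ p ∈ Finset.HasAntidiagonal.antidiagonal d, B (f p.1) (h p.2)

/-- The product of a scalar series and a vector valued series. -/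
def smulSeries (a : FormalMap n ℂ) (f : FormalMap n V) : FormalMap n V :=
  bilin (LinearMap.lsmul ℂ V) a f

/-- The partial derivative `∂f/∂xᵢ`. -/
def pderiv (i : Fin n) (f : FormalMap n V) : FormalMap n V :=
  fun d => ((d i + 1 : ℕ) : ℂ) • f (d + Finsupp.single i 1)

end Series

/-! ### Tensors -/

section Tensors

variable (g : Type*) [LieRing g] [LieAlgebra ℂ g]

/-- The bracket as a linear map `g ⊗ g → g`. -/
def bracketMap : g ⊗[ℂ] g →ₗ[ℂ] g :=
  TensorProduct.lift (LieModule.toEnd ℂ g g : g →ₗ[ℂ] Module.End ℂ g)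

/-- The flip `x ↦ x²¹` of `g ⊗ g`. -/
def flip21 : g ⊗[ℂ] g →ₗ[ℂ] g ⊗[ℂ] g := (TensorProduct.comm ℂ g g).toLinearMap

/-- `x ↦ x²¹³`, that is `a ⊗ b ⊗ c ↦ b ⊗ a ⊗ c`. -/
def perm213 : g ⊗[ℂ] (g ⊗[ℂ] g) →ₗ[ℂ] g ⊗[ℂ] (g ⊗[ℂ] g) :=
  (TensorProduct.leftComm ℂ g g g).toLinearMap

/-- `x ↦ x³¹²`, that is `a ⊗ b ⊗ c ↦ b ⊗ c ⊗ a` (the first factor goes to the third place, the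
second to the first, the third to the second). -/
def perm312 : g ⊗[ℂ] (g ⊗[ℂ] g) →ₗ[ℂ] g ⊗[ℂ] (g ⊗[ℂ] g) :=
  (TensorProduct.assoc ℂ g g g).toLinearMap ∘ₗ
    (TensorProduct.comm ℂ g (g ⊗[ℂ] g)).toLinearMap

/-- `Alt(x) = x¹²³ - x²¹³ + x³¹²`. -/
def alt : g ⊗[ℂ] (g ⊗[ℂ] g) →ₗ[ℂ] g ⊗[ℂ] (g ⊗[ℂ] g) :=
  LinearMap.id - perm213 g + perm312 g

/-- `r ⊗ s ↦ [r¹², s¹³]`. -/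
def br1213 : (g ⊗[ℂ] g) ⊗[ℂ] (g ⊗[ℂ] g) →ₗ[ℂ] g ⊗[ℂ] (g ⊗[ℂ] g) :=
  (bracketMap g).rTensor (g ⊗[ℂ] g) ∘ₗ
    (TensorProduct.tensorTensorTensorComm ℂ g g g g).toLinearMap

/-- `r ⊗ s ↦ [r¹², s²³]`. -/
def br1223 : (g ⊗[ℂ] g) ⊗[ℂ] (g ⊗[ℂ] g) →ₗ[ℂ] g ⊗[ℂ] (g ⊗[ℂ] g) :=
  ((bracketMap g).rTensor g ∘ₗ (TensorProduct.assoc ℂ g g g).symm.toLinearMap).lTensor g ∘ₗ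
    (TensorProduct.assoc ℂ g g (g ⊗[ℂ] g)).toLinearMap

/-- `r ⊗ s ↦ [r¹³, s²³]`. -/
def br1323 : (g ⊗[ℂ] g) ⊗[ℂ] (g ⊗[ℂ] g) →ₗ[ℂ] g ⊗[ℂ] (g ⊗[ℂ] g) :=
  (TensorProduct.assoc ℂ g g g).toLinearMap ∘ₗ (bracketMap g).lTensor (g ⊗[ℂ] g) ∘ₗ
    (TensorProduct.tensorTensorTensorComm ℂ g g g g).toLinearMap

/-- The bilinear map `(r, s) ↦ [r¹², s¹³] + [r¹², s²³] + [r¹³, s²³]`. -/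
def cybBilin : g ⊗[ℂ] g →ₗ[ℂ] g ⊗[ℂ] g →ₗ[ℂ] g ⊗[ℂ] (g ⊗[ℂ] g) :=
  TensorProduct.curry (br1213 g + br1223 g + br1323 g)

variable {g}

/-- The classical Yang-Baxter operator `CYB(r) = [r¹², r¹³] + [r¹², r²³] + [r¹³, r²³]`. -/
def CYB (r : g ⊗[ℂ] g) : g ⊗[ℂ] (g ⊗[ℂ] g) := cybBilin g r r

theorem flip21_tmul (a b : g) : flip21 g (a ⊗ₜ b) = b ⊗ₜ a := rfl

theorem alt_tmul (a b c : g) :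
    alt g (a ⊗ₜ (b ⊗ₜ c)) = a ⊗ₜ (b ⊗ₜ c) - b ⊗ₜ (a ⊗ₜ c) + b ⊗ₜ (c ⊗ₜ a) := rfl

theorem cybBilin_tmul (a b c d : g) :
    cybBilin g (a ⊗ₜ b) (c ⊗ₜ d) =
      ⁅a, c⁆ ⊗ₜ (b ⊗ₜ d) + a ⊗ₜ (⁅b, c⁆ ⊗ₜ d) + a ⊗ₜ (c ⊗ₜ ⁅b, d⁆) := rfl

/-- `p ⊗ p` as a subspace of `g ⊗ g`. -/
def tensorSquare (p : Submodule ℂ g) : Submodule ℂ (g ⊗[ℂ] g) :=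
  LinearMap.range (TensorProduct.map p.subtype p.subtype)

/-- `Λ²p` as the subspace of skew-symmetric tensors in `p ⊗ p ⊆ g ⊗ g`. -/
def wedgeSquare (p : Submodule ℂ g) : Submodule ℂ (g ⊗[ℂ] g) :=
  tensorSquare p ⊓ LinearMap.ker (flip21 g + LinearMap.id)

/-- The map `g ⊗ g ⊗ g → (g/𝔩) ⊗ (g/𝔩) ⊗ (g/𝔩)`; it sends `Λ³g` to `Λ³(g/𝔩)`, spaces of
skew-symmetric tensors being regarded as subspaces of the tensor powers. -/
def toQuot3 (l : LieSubalgebra ℂ g) : g ⊗[ℂ] (g ⊗[ℂ] g) →ₗ[ℂ]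
    (g ⧸ l.toSubmodule) ⊗[ℂ] ((g ⧸ l.toSubmodule) ⊗[ℂ] (g ⧸ l.toSubmodule)) :=
  TensorProduct.map l.toSubmodule.mkQ
    (TensorProduct.map l.toSubmodule.mkQ l.toSubmodule.mkQ)

/-- The variety `𝓜_Ω = {x ∈ Ω/2 + (Λ²𝔪)^𝔩 : CYB(x) = 0 in Λ³(g/𝔩)}`. -/
def varietyM (l : LieSubalgebra ℂ g) (m : Submodule ℂ g) (Ω : g ⊗[ℂ] g) : Set (g ⊗[ℂ] g) :=
  {x | x - (1 / 2 : ℂ) • Ω ∈ wedgeSquare m ∧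
    (∀ y : l, ⁅(y : g), x - (1 / 2 : ℂ) • Ω⁆ = 0) ∧ toQuot3 l (CYB x) = 0}

end Tensors

/-! ### Dynamical r-matrices -/

section Dynamical

variable {g : Type*} [LieRing g] [LieAlgebra ℂ g] {l : LieSubalgebra ℂ g} {n : ℕ}
  (b : Module.Basis (Fin n) ℂ l)

/-- The element `y` of `𝔩` as a linear function `λ ↦ λ(y)` on `𝔩*`. -/
def linForm (y : l) : FormalMap n ℂ :=
  fun d => ∑ i, if d = Finsupp.single i 1 then b.repr y i else 0

/-- `𝔩`-equivariance of a function `D → V` for a representation `V` of `g`, the action on `D`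
being the coadjoint one: the derivative of `f` along the vector field `λ ↦ ad*_y λ` on `𝔩*`, whose
`xᵢ`-component is `λ ↦ -λ([y, xᵢ])`, is `y · f`. -/
def IsEquivariant {V : Type*} [AddCommGroup V] [Module ℂ V] [LieRingModule g V]
    [LieModule ℂ g V] (f : FormalMap n V) : Prop :=
  ∀ y : l, mapVal (LieModule.toEnd ℂ g V (y : g)) f =
    -∑ i, smulSeries (linForm b ⁅y, b i⁆) (pderiv i f)

/-- The function `D → 𝔩 ⊗ V ⊆ g ⊗ V` associated to the `1`-form `∑ᵢ ωᵢ dxᵢ`, namely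
`∑ᵢ xᵢ ⊗ ωᵢ`. -/
def formBar {V : Type*} [AddCommGroup V] [Module ℂ V] (ω : Fin n → FormalMap n V) :
    FormalMap n (g ⊗[ℂ] V) :=
  fun d => ∑ i, (b i : g) ⊗ₜ[ℂ] ω i d

/-- The set `Dynr(g, 𝔩, Ω)` of dynamical r-matrices: `𝔩`-equivariant functions
`r : D → g ⊗ g` with `Alt(dr) + CYB(r) = 0` and `r + r²¹ = Ω`. -/
def Dynr (Ω : g ⊗[ℂ] g) : Set (FormalMap n (g ⊗[ℂ] g)) :=
  {r | IsEquivariant b r ∧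
    mapVal (alt g) (formBar b fun i => pderiv i r) + bilin (cybBilin g) r r = 0 ∧
    r + mapVal (flip21 g) r = constMap n Ω}

end Dynamical

/-! ### Gauge transformations

Since `exp` is a local isomorphism at `0`, the formal maps `γ : D → G` with `γ(0) = 1` are exactly
the `γ = exp χ` with `χ : D → g`, `χ(0) = 0`, and `exp χ` is `𝔩`-equivariant (for conjugation)
if and only if `χ` is `𝔩`-equivariant (for the adjoint action). A map `γ = exp χ` acts on a
representation by `exp (ad χ)`, and `γ⁻¹dγ = ((1 - exp(-ad χ)) / ad χ) (dχ)`. -/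

section Gauge

variable {g : Type*} [LieRing g] [LieAlgebra ℂ g] {l : LieSubalgebra ℂ g} {n : ℕ}
  (b : Module.Basis (Fin n) ℂ l)

/-- The (exponents `χ` of the) elements `exp χ` of the group `Map₀(D, G)^𝔩`. -/
def GaugeMaps : Set (FormalMap n g) := {χ | χ 0 = 0 ∧ IsEquivariant b χ}

/-- The action of `χ : D → g` on functions `D → V`, for a representation `V` of `g`. -/
def actBy {V : Type*} [AddCommGroup V] [Module ℂ V] [LieRingModule g V] [LieModule ℂ g V]
    (χ : FormalMap n g) (f : FormalMap n V) : FormalMap n V :=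
  bilin (LieModule.toEnd ℂ g V : g →ₗ[ℂ] Module.End ℂ V) χ f

/-- The series `∑ₖ cₖ (ad χ)ᵏ f`. As `χ(0) = 0`, the terms with `k > |d|` do not contribute to the
coefficient at the multi-index `d`. -/
def seriesAct {V : Type*} [AddCommGroup V] [Module ℂ V] [LieRingModule g V] [LieModule ℂ g V]
    (c : ℕ → ℂ) (χ : FormalMap n g) (f : FormalMap n V) : FormalMap n V :=
  fun d => ∑ k ∈ Finset.range (d.degree + 1), c k • (actBy χ)^[k] f d

/-- The action of `exp χ` on functions with values in a representation of `g`. -/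
def expAct {V : Type*} [AddCommGroup V] [Module ℂ V] [LieRingModule g V] [LieModule ℂ g V]
    (χ : FormalMap n g) (f : FormalMap n V) : FormalMap n V :=
  seriesAct (fun k => 1 / (k.factorial : ℂ)) χ f

/-- The components `ηᵢ` of the `1`-form `η = γ⁻¹dγ = ∑ᵢ ηᵢ dxᵢ` for `γ = exp χ`:
`ηᵢ = ((1 - exp(-ad χ)) / ad χ) (∂ᵢχ) = ∑ₖ (-1)ᵏ / (k+1)! (ad χ)ᵏ (∂ᵢχ)`. -/
def eta (χ : FormalMap n g) (i : Fin n) : FormalMap n g :=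
  seriesAct (fun k => (-1) ^ k / ((k + 1).factorial : ℂ)) χ (pderiv i χ)

/-- `τ(λ) = (λ ⊗ 1 ⊗ 1) [η¹², η¹³](λ) = ∑ᵢⱼ λ([xᵢ, xⱼ]) ηᵢ(λ) ⊗ ηⱼ(λ)`. -/
def tau (χ : FormalMap n g) : FormalMap n (g ⊗[ℂ] g) :=
  ∑ i, ∑ j, smulSeries (linForm b ⁅b i, b j⁆)
    (bilin (TensorProduct.mk ℂ g g) (eta χ i) (eta χ j))

/-- The gauge transform of `r` by `γ = exp χ`, namely
`r^γ = (γ ⊗ γ)(r - η + η²¹ - τ)(γ⁻¹ ⊗ γ⁻¹)`. The sign of `τ` is the one that goes with the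
coadjoint action of `𝔩` on `D`: it makes `r ↦ r^γ` a group action that preserves the classical
dynamical Yang-Baxter equation. -/
def gauge (χ : FormalMap n g) (r : FormalMap n (g ⊗[ℂ] g)) : FormalMap n (g ⊗[ℂ] g) :=
  expAct χ (r - formBar b (eta χ) + mapVal (flip21 g) (formBar b (eta χ)) - tau b χ)

/-- Gauge equivalence of dynamical r-matrices: `s = r^γ` for some `γ ∈ Map₀(D, G)^𝔩`. -/
def GaugeEquiv (Ω : g ⊗[ℂ] g) (r s : Dynr b Ω) : Prop :=
  ∃ χ ∈ GaugeMaps b, (s : FormalMap n (g ⊗[ℂ] g)) = gauge b χ r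

/-- The moduli space `𝓜(g, 𝔩, Ω) = Dynr(g, 𝔩, Ω) / Map₀(D, G)^𝔩`. -/
def Moduli (Ω : g ⊗[ℂ] g) : Type _ := Quot (GaugeEquiv b Ω)

/-- The class of a dynamical r-matrix in the moduli space. -/
def Moduli.mk (Ω : g ⊗[ℂ] g) (r : Dynr b Ω) : Moduli b Ω := Quot.mk _ r

end Gauge

/-! ### Regular functions -/

section Regular

/-- Regular functions on a subset of a vector space: restrictions of polynomial functions. -/
def IsRegularOn {V : Type*} [AddCommGroup V] [Module ℂ V] {S : Set V} (f : S → ℂ) : Prop :=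
  f ∈ Algebra.adjoin ℂ {h : S → ℂ | ∃ ψ : Module.Dual ℂ V, ∀ x : S, h x = ψ x}

/-- Regular functions on a set of formal series: polynomials in finitely many coordinates of the
Taylor coefficients. -/
def IsRegularSeries {n : ℕ} {V : Type*} [AddCommGroup V] [Module ℂ V] {S : Set (FormalMap n V)}
    (f : S → ℂ) : Prop :=
  f ∈ Algebra.adjoin ℂ {h : S → ℂ | ∃ (d : Fin n →₀ ℕ) (ψ : Module.Dual ℂ V),
    ∀ r : S, h r = ψ ((r : FormalMap n V) d)}

/-- A function on the moduli space is regular if it is induced by a gauge invariant regular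
function on the set of dynamical r-matrices. -/
def IsRegularModuli {g : Type*} [LieRing g] [LieAlgebra ℂ g] {l : LieSubalgebra ℂ g} {n : ℕ}
    (b : Module.Basis (Fin n) ℂ l) (Ω : g ⊗[ℂ] g) (F : Moduli b Ω → ℂ) : Prop :=
  IsRegularSeries fun r : Dynr b Ω => F (Moduli.mk b Ω r)

end Regular

end DynRMat

end

/-! Write `r = Ω/2 + ρ`. The condition `r + r²¹ = Ω` says that `ρ` is skew, and invariance of `Ω`
kills the mixed terms of CYB. The dynamical equation becomes `dρ + CYB(ρ) = φ`, where `φ =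
-CYB(Ω/2)` is a constant, `g`-invariant, skew tensor (`mem_Dynr_iff`) and `d = ∑ xᵢ ∧ ∂ᵢ` acts on
functions `D → Λg`. On equivariant functions `d` is compatible with the Schouten bracket
(`dTwo_actL`, `brTwoThree_dTwo`), so this is a Maurer-Cartan equation with constant invariant
curvature `φ`.

The gauge action is the standard one. Equivariance of `χ` gives `η - η²¹ + τ = ((1 - exp(-ad χ)) /
ad χ)(dχ)`, hence `r^γ = exp(ad χ) r - ((exp(ad χ) - 1) / ad χ)(dχ)` (`gauge_eq`). The curvature is
transported by `exp(ad χ)`, which fixes `φ`; therefore solutions go to solutions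
(`dynCYB_gaugeSkew`).

With `g = 𝔩 ⊕ 𝔪`, `d` is a Koszul differential in the `𝔩`-directions. Contraction `h` with the Euler
field satisfies `dh + hd = (polynomial degree) + (number of factors in 𝔩)` (`koszulH_add`), so the
cohomology is `Λ𝔪`, carried by the constant terms. Since `𝔪` is `𝔩`-invariant, the homotopy respects
equivariance. Two successive approximations in powers of the coordinates follow.

Uniqueness (`exists_gaugeSkew_eq`): if two solutions agree below order `p`, the leading part of
their difference is closed, hence exact, and is removed by changing `χ` in order `p + 1`. The only
obstruction is the class of the value at zero in `Λ²𝔪`.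

Existence (`solution_spec`): by the Bianchi identity the leading part of the error `dρ + CYB(ρ) - φ`
is closed, hence exact, and is removed by correcting `ρ`. The only obstruction is the error at zero
modulo `𝔩`, which is `CYB(x)` in `Λ³(g/𝔩)`.

Thus the projection of `r(0)` to `𝔪 ⊗ 𝔪` is a complete gauge invariant. It is affine in `r(0)`, and
the coefficients of the constructed solution are polynomial in its value at zero, so regular
functions correspond in both directions. -/

noncomputable section

set_option linter.unusedSectionVars false

namespace DynRMat

/-! ### Operations on formal series -/

section SeriesOps

variable {n : ℕ} {V W U V₁ V₂ V₃ : Type*} [AddCommGroup V] [Module ℂ V] [AddCommGroup W]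
  [Module ℂ W] [AddCommGroup U] [Module ℂ U] [AddCommGroup V₁] [Module ℂ V₁] [AddCommGroup V₂]
  [Module ℂ V₂] [AddCommGroup V₃] [Module ℂ V₃]

theorem constMap_zero_apply (v : V) : constMap n v 0 = v := by simp [constMap]

theorem mapVal_add (L : V →ₗ[ℂ] W) (f f' : FormalMap n V) :
    mapVal L (f + f') = mapVal L f + mapVal L f' := funext fun d => by simp [mapVal]

theorem mapVal_sub (L : V →ₗ[ℂ] W) (f f' : FormalMap n V) :
    mapVal L (f - f') = mapVal L f - mapVal L f' := funext fun d => by simp [mapVal]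

theorem mapVal_neg (L : V →ₗ[ℂ] W) (f : FormalMap n V) :
    mapVal L (-f) = -mapVal L f := funext fun d => by simp [mapVal]

theorem mapVal_smul (L : V →ₗ[ℂ] W) (c : ℂ) (f : FormalMap n V) :
    mapVal L (c • f) = c • mapVal L f := funext fun d => by simp [mapVal]

theorem mapVal_zero (L : V →ₗ[ℂ] W) : mapVal L (0 : FormalMap n V) = 0 :=
  funext fun d => by simp [mapVal]

theorem mapVal_sum {ι : Type*} (s : Finset ι) (L : V →ₗ[ℂ] W) (f : ι → FormalMap n V) :
    mapVal L (∑ i ∈ s, f i) = ∑ i ∈ s, mapVal L (f i) := funext fun d => by simp [mapVal]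

theorem mapVal_constMap (L : V →ₗ[ℂ] W) (v : V) :
    mapVal L (constMap n v) = constMap n (L v) := funext fun d => by
  simp only [mapVal, constMap]; split_ifs <;> simp

theorem mapVal_mapVal (L : V →ₗ[ℂ] W) (M : W →ₗ[ℂ] U) (f : FormalMap n V) :
    mapVal M (mapVal L f) = mapVal (M ∘ₗ L) f := rfl

/-- `bilin` as a bilinear map. -/
def bilinL (B : V →ₗ[ℂ] W →ₗ[ℂ] U) :
    FormalMap n V →ₗ[ℂ] FormalMap n W →ₗ[ℂ] FormalMap n U :=
  LinearMap.mk₂ ℂ (bilin B)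
    (fun f f' h => funext fun d => by simp [bilin, Finset.sum_add_distrib])
    (fun c f h => funext fun d => by simp [bilin, Finset.smul_sum])
    (fun f h h' => funext fun d => by simp [bilin, Finset.sum_add_distrib])
    (fun c f h => funext fun d => by simp [bilin, Finset.smul_sum])

theorem bilin_eq (B : V →ₗ[ℂ] W →ₗ[ℂ] U) (f : FormalMap n V) (h : FormalMap n W) :
    bilin B f h = bilinL B f h := rfl

theorem bilin_add_left (B : V →ₗ[ℂ] W →ₗ[ℂ] U) (f f' : FormalMap n V) (h : FormalMap n W) :
    bilin B (f + f') h = bilin B f h + bilin B f' h := by simp [bilin_eq]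

theorem bilin_add_right (B : V →ₗ[ℂ] W →ₗ[ℂ] U) (f : FormalMap n V) (h h' : FormalMap n W) :
    bilin B f (h + h') = bilin B f h + bilin B f h' := by simp [bilin_eq]

theorem bilin_sub_left (B : V →ₗ[ℂ] W →ₗ[ℂ] U) (f f' : FormalMap n V) (h : FormalMap n W) :
    bilin B (f - f') h = bilin B f h - bilin B f' h := by simp [bilin_eq]

theorem bilin_sub_right (B : V →ₗ[ℂ] W →ₗ[ℂ] U) (f : FormalMap n V) (h h' : FormalMap n W) :
    bilin B f (h - h') = bilin B f h - bilin B f h' := by simp [bilin_eq]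

theorem bilin_neg_left (B : V →ₗ[ℂ] W →ₗ[ℂ] U) (f : FormalMap n V) (h : FormalMap n W) :
    bilin B (-f) h = -bilin B f h := by simp [bilin_eq]

theorem bilin_neg_right (B : V →ₗ[ℂ] W →ₗ[ℂ] U) (f : FormalMap n V) (h : FormalMap n W) :
    bilin B f (-h) = -bilin B f h := by simp [bilin_eq]

theorem bilin_smul_left (B : V →ₗ[ℂ] W →ₗ[ℂ] U) (c : ℂ) (f : FormalMap n V)
    (h : FormalMap n W) : bilin B (c • f) h = c • bilin B f h := by simp [bilin_eq]

theorem bilin_smul_right (B : V →ₗ[ℂ] W →ₗ[ℂ] U) (c : ℂ) (f : FormalMap n V)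
    (h : FormalMap n W) : bilin B f (c • h) = c • bilin B f h := by simp [bilin_eq]

theorem bilin_zero_left (B : V →ₗ[ℂ] W →ₗ[ℂ] U) (h : FormalMap n W) :
    bilin B (0 : FormalMap n V) h = 0 := by simp [bilin_eq]

theorem bilin_zero_right (B : V →ₗ[ℂ] W →ₗ[ℂ] U) (f : FormalMap n V) :
    bilin B f (0 : FormalMap n W) = 0 := by simp [bilin_eq]

theorem bilin_sum_left {ι : Type*} (s : Finset ι) (B : V →ₗ[ℂ] W →ₗ[ℂ] U)
    (f : ι → FormalMap n V) (h : FormalMap n W) :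
    bilin B (∑ i ∈ s, f i) h = ∑ i ∈ s, bilin B (f i) h := by simp [bilin_eq]

theorem bilin_sum_right {ι : Type*} (s : Finset ι) (B : V →ₗ[ℂ] W →ₗ[ℂ] U)
    (f : FormalMap n V) (h : ι → FormalMap n W) :
    bilin B f (∑ i ∈ s, h i) = ∑ i ∈ s, bilin B f (h i) := by simp [bilin_eq]

theorem mapVal_bilin (L : U →ₗ[ℂ] V₁) (B : V →ₗ[ℂ] W →ₗ[ℂ] U) (f : FormalMap n V)
    (h : FormalMap n W) : mapVal L (bilin B f h) = bilin (B.compr₂ L) f h :=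
  funext fun d => by simp [mapVal, bilin]

theorem bilin_mapVal_left (L : V₁ →ₗ[ℂ] V) (B : V →ₗ[ℂ] W →ₗ[ℂ] U) (f : FormalMap n V₁)
    (h : FormalMap n W) : bilin B (mapVal L f) h = bilin (B ∘ₗ L) f h := rfl

theorem bilin_mapVal_right (L : V₁ →ₗ[ℂ] W) (B : V →ₗ[ℂ] W →ₗ[ℂ] U) (f : FormalMap n V)
    (h : FormalMap n V₁) : bilin B f (mapVal L h) = bilin (B.compl₂ L) f h := rfl

theorem bilin_constMap_left (B : V →ₗ[ℂ] W →ₗ[ℂ] U) (v : V) (h : FormalMap n W) :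
    bilin B (constMap n v) h = mapVal (B v) h := funext fun d => by
  classical
  simp only [bilin, mapVal]
  rw [Finset.sum_eq_single (0, d)]
  · simp [constMap]
  · rintro ⟨p, q⟩ hp hne
    have : p ≠ 0 := by
      rintro rfl
      simp at hp
      exact hne (by simp [hp])
    simp [constMap, this]
  · simp

theorem bilin_swap (B : V →ₗ[ℂ] W →ₗ[ℂ] U) (f : FormalMap n V) (h : FormalMap n W) :
    bilin B f h = bilin B.flip h f := funext fun d => by
  simpa [bilin] using Finsupp.sum_antidiagonal_swap d (fun p q => B (f p) (h q))

theorem bilin_constMap_right (B : V →ₗ[ℂ] W →ₗ[ℂ] U) (f : FormalMap n V) (w : W) :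
    bilin B f (constMap n w) = mapVal (B.flip w) f := by
  rw [bilin_swap, bilin_constMap_left]

theorem bilin_congr_of {B B' : V →ₗ[ℂ] W →ₗ[ℂ] U} {f : FormalMap n V} {h : FormalMap n W}
    (H : ∀ p q, B (f p) (h q) = B' (f p) (h q)) : bilin B f h = bilin B' f h :=
  funext fun d => by simp [bilin, H]

/-- Multiplication by the coordinate `xᵢ`. -/
def mulX (i : Fin n) (f : FormalMap n V) : FormalMap n V :=
  fun d => if d i = 0 then 0 else f (d - Finsupp.single i 1)

theorem mulX_of_eq_zero {i : Fin n} (f : FormalMap n V) {d : Fin n →₀ ℕ} (h : d i = 0) :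
    mulX i f d = 0 := by simp [mulX, h]

theorem mulX_add_single (i : Fin n) (f : FormalMap n V) (d : Fin n →₀ ℕ) :
    mulX i f (d + Finsupp.single i 1) = f d := by
  simp [mulX]

theorem eq_zero_or_eq_add_single (i : Fin n) (d : Fin n →₀ ℕ) :
    d i = 0 ∨ ∃ d', d = d' + Finsupp.single i 1 := by
  by_cases h : d i = 0
  · exact Or.inl h
  · refine Or.inr ⟨d - Finsupp.single i 1, ?_⟩
    rw [tsub_add_cancel_of_le]
    simpa [Finsupp.single_le_iff] using Nat.one_le_iff_ne_zero.2 h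

/-- Multiplication by `xᵢ` as a linear map. -/
def mulXL (i : Fin n) : FormalMap n V →ₗ[ℂ] FormalMap n V where
  toFun := mulX i
  map_add' f h := funext fun d => by simp only [mulX, Pi.add_apply]; split_ifs <;> simp
  map_smul' c f := funext fun d => by
    simp only [mulX, Pi.smul_apply, RingHom.id_apply]; split_ifs <;> simp

theorem mulX_eq (i : Fin n) (f : FormalMap n V) : mulX i f = mulXL i f := rfl

theorem mulX_add (i : Fin n) (f h : FormalMap n V) : mulX i (f + h) = mulX i f + mulX i h := by
  simp [mulX_eq]

theorem mulX_sub (i : Fin n) (f h : FormalMap n V) : mulX i (f - h) = mulX i f - mulX i h := by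
  simp [mulX_eq]

theorem mulX_neg (i : Fin n) (f : FormalMap n V) : mulX i (-f) = -mulX i f := by simp [mulX_eq]

theorem mulX_smul (i : Fin n) (c : ℂ) (f : FormalMap n V) : mulX i (c • f) = c • mulX i f := by
  simp [mulX_eq]

theorem mulX_zero (i : Fin n) : mulX i (0 : FormalMap n V) = 0 := by simp [mulX_eq]

theorem mulX_sum {ι : Type*} (s : Finset ι) (i : Fin n) (f : ι → FormalMap n V) :
    mulX i (∑ k ∈ s, f k) = ∑ k ∈ s, mulX i (f k) := by simp [mulX_eq]

theorem mulX_injective (i : Fin n) : Function.Injective (mulX i : FormalMap n V → _) :=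
  fun f h e => funext fun d => by
    have := congrFun e (d + Finsupp.single i 1)
    rwa [mulX_add_single, mulX_add_single] at this

theorem mapVal_mulX (L : V →ₗ[ℂ] W) (i : Fin n) (f : FormalMap n V) :
    mapVal L (mulX i f) = mulX i (mapVal L f) := funext fun d => by
  simp only [mapVal, mulX]; split_ifs <;> simp

theorem bilin_mulX_left (B : V →ₗ[ℂ] W →ₗ[ℂ] U) (i : Fin n) (f : FormalMap n V)
    (h : FormalMap n W) : bilin B (mulX i f) h = mulX i (bilin B f h) := funext fun d => by
  classical
  rcases eq_zero_or_eq_add_single i d with hd | ⟨d, rfl⟩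
  · rw [mulX_of_eq_zero _ hd]
    refine Finset.sum_eq_zero fun p hp => ?_
    rw [Finset.HasAntidiagonal.mem_antidiagonal] at hp
    have : p.1 i = 0 := by
      have := DFunLike.congr_fun hp i
      simp at this; omega
    simp [mulX_of_eq_zero _ this]
  · rw [mulX_add_single]
    symm
    refine Finset.sum_of_injOn (fun p => (p.1 + Finsupp.single i 1, p.2)) ?_ ?_ ?_ ?_
    · rintro ⟨a, b⟩ _ ⟨a', b'⟩ _ e
      simpa using e
    · rintro ⟨a, b⟩ hp
      simp only [Finset.mem_coe,
        Finset.HasAntidiagonal.mem_antidiagonal] at hp ⊢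
      rw [← hp]; abel
    · rintro ⟨a, b⟩ hp hn
      rcases eq_zero_or_eq_add_single i a with ha | ⟨a, rfl⟩
      · simp [mulX_of_eq_zero _ ha]
      · exfalso
        refine hn ⟨(a, b), ?_, rfl⟩
        simp only [Finset.mem_coe, Finset.HasAntidiagonal.mem_antidiagonal] at hp ⊢
        exact add_right_cancel (b := Finsupp.single i 1) (by rw [← hp]; abel)
    · rintro ⟨a, b⟩ _
      simp [mulX_add_single]

theorem bilin_mulX_right (B : V →ₗ[ℂ] W →ₗ[ℂ] U) (i : Fin n) (f : FormalMap n V)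
    (h : FormalMap n W) : bilin B f (mulX i h) = mulX i (bilin B f h) := by
  rw [bilin_swap, bilin_mulX_left, ← bilin_swap]

/-- With `f` written as the product `1 · f`, the two coordinates can be moved onto different factors
of the Cauchy product. -/
theorem mulX_comm (i j : Fin n) (f : FormalMap n V) :
    mulX i (mulX j f) = mulX j (mulX i f) := by
  have h : ∀ f : FormalMap n V, f = bilin (LinearMap.lsmul ℂ V) (constMap n 1) f := fun f => by
    rw [bilin_constMap_left]; exact funext fun d => by simp [mapVal]
  rw [h f, ← bilin_mulX_left, ← bilin_mulX_right, ← bilin_mulX_right, ← bilin_mulX_left]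

/-- The partial derivative as a linear map. -/
def pderivL (i : Fin n) : FormalMap n V →ₗ[ℂ] FormalMap n V where
  toFun := pderiv i
  map_add' f h := funext fun d => by simp [pderiv]
  map_smul' c f := funext fun d => by simp only [pderiv, Pi.smul_apply]; exact smul_comm _ _ _

theorem pderiv_eq (i : Fin n) (f : FormalMap n V) : pderiv i f = pderivL i f := rfl

theorem pderiv_add (i : Fin n) (f h : FormalMap n V) :
    pderiv i (f + h) = pderiv i f + pderiv i h := by simp [pderiv_eq]

theorem pderiv_neg (i : Fin n) (f : FormalMap n V) : pderiv i (-f) = -pderiv i f := by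
  simp [pderiv_eq]

theorem pderiv_smul (i : Fin n) (c : ℂ) (f : FormalMap n V) :
    pderiv i (c • f) = c • pderiv i f := by simp [pderiv_eq]

theorem pderiv_sum {ι : Type*} (s : Finset ι) (i : Fin n) (f : ι → FormalMap n V) :
    pderiv i (∑ k ∈ s, f k) = ∑ k ∈ s, pderiv i (f k) := by simp [pderiv_eq]

theorem mapVal_pderiv (L : V →ₗ[ℂ] W) (i : Fin n) (f : FormalMap n V) :
    mapVal L (pderiv i f) = pderiv i (mapVal L f) := funext fun d => by simp [mapVal, pderiv]

theorem pderiv_constMap (i : Fin n) (v : V) : pderiv i (constMap n v) = 0 := funext fun d => by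
  have : d + Finsupp.single i 1 ≠ 0 := fun h => by
    have := DFunLike.congr_fun h i
    simp at this
  simp [pderiv, constMap, this]

theorem mulX_pderiv_self (i : Fin n) (f : FormalMap n V) (d : Fin n →₀ ℕ) :
    mulX i (pderiv i f) d = ((d i : ℕ) : ℂ) • f d := by
  rcases eq_zero_or_eq_add_single i d with hd | ⟨d, rfl⟩
  · simp [mulX_of_eq_zero _ hd, hd]
  · rw [mulX_add_single]; simp [pderiv]

/-- Multiplication by `xᵢ` is injective, and `xᵢ∂ᵢ` scales the coefficient at `d` by `dᵢ`. The
Leibniz rule is then additivity of `dᵢ` over the antidiagonal. -/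
theorem pderiv_bilin (B : V →ₗ[ℂ] W →ₗ[ℂ] U) (i : Fin n) (f : FormalMap n V)
    (h : FormalMap n W) :
    pderiv i (bilin B f h) = bilin B (pderiv i f) h + bilin B f (pderiv i h) := by
  apply mulX_injective i
  rw [mulX_add, ← bilin_mulX_left, ← bilin_mulX_right]
  funext d
  rw [mulX_pderiv_self]
  simp only [bilin, Pi.add_apply, mulX_pderiv_self, ← Finset.sum_add_distrib, Finset.smul_sum]
  refine Finset.sum_congr rfl fun p hp => ?_
  have : d i = p.1 i + p.2 i := by
    rw [Finset.HasAntidiagonal.mem_antidiagonal] at hp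
    rw [← hp]; rfl
  simp [this, add_smul]

theorem pderiv_mulX (i j : Fin n) (f : FormalMap n V) :
    pderiv i (mulX j f) = (if i = j then f else 0) + mulX j (pderiv i f) := by
  have h : ∀ f : FormalMap n V, f = bilin (LinearMap.lsmul ℂ V) (constMap n 1) f := fun f => by
    rw [bilin_constMap_left]; exact funext fun d => by simp [mapVal]
  have key : pderiv i (mulX j (constMap n (1 : ℂ))) = if i = j then constMap n 1 else 0 := by
    funext d
    split_ifs with e
    · subst e
      simp only [pderiv, mulX_add_single, constMap]
      split_ifs with h0 <;> simp [h0]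
    · simp only [pderiv, mulX, constMap]
      have : d + Finsupp.single i 1 - Finsupp.single j 1 ≠ 0 := fun h => by
        have := DFunLike.congr_fun h i
        simp [Ne.symm e] at this
      simp [this]
  conv_lhs => rw [h f, ← bilin_mulX_left, pderiv_bilin, key]
  rw [bilin_mulX_left, ← h (pderiv i f)]
  split_ifs
  · rw [← h]
  · rw [bilin_zero_left]

theorem pderiv_comm (i j : Fin n) (f : FormalMap n V) :
    pderiv i (pderiv j f) = pderiv j (pderiv i f) := funext fun d => by
  simp only [pderiv]
  rw [smul_smul, smul_smul, add_right_comm]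
  congr 1
  by_cases h : i = j
  · subst h; rfl
  · simp [h, Ne.symm h, mul_comm]

/-- The Cauchy product of three series with respect to a function of three variables. -/
def trilin (T : V₁ → V₂ → V₃ → U) (f : FormalMap n V₁) (h : FormalMap n V₂)
    (k : FormalMap n V₃) : FormalMap n U :=
  fun d => ∑ p ∈ Finset.HasAntidiagonal.antidiagonal d, ∑ q ∈ Finset.HasAntidiagonal.antidiagonal p.2, T (f p.1) (h q.1) (k q.2)

/-- Both nestings of two Cauchy products are brought to one triple sum, so that identities between
composed operations on series reduce to identities between values. -/
theorem bilin_bilin_right (B : V₁ →ₗ[ℂ] W →ₗ[ℂ] U) (B' : V₂ →ₗ[ℂ] V₃ →ₗ[ℂ] W)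
    (f : FormalMap n V₁) (h : FormalMap n V₂) (k : FormalMap n V₃) :
    bilin B f (bilin B' h k) = trilin (fun x y z => B x (B' y z)) f h k :=
  funext fun d => by simp [bilin, trilin]

theorem bilin_bilin_left (B : W →ₗ[ℂ] V₃ →ₗ[ℂ] U) (B' : V₁ →ₗ[ℂ] V₂ →ₗ[ℂ] W)
    (f : FormalMap n V₁) (h : FormalMap n V₂) (k : FormalMap n V₃) :
    bilin B (bilin B' f h) k = trilin (fun x y z => B (B' x y) z) f h k :=
  funext fun d => by
    simp only [bilin, trilin, map_sum, LinearMap.sum_apply, Finset.sum_sigma']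
    refine Finset.sum_nbij' (fun x => ⟨(x.2.1, x.2.2 + x.1.2), (x.2.2, x.1.2)⟩)
      (fun x => ⟨(x.1.1 + x.2.1, x.2.2), (x.1.1, x.2.1)⟩) ?_ ?_ ?_ ?_ ?_
    all_goals
      simp only [Finset.mem_sigma, Finset.HasAntidiagonal.mem_antidiagonal, Sigma.forall, Prod.forall, and_imp]
    · rintro a b c e rfl rfl; simp [add_assoc]
    · rintro a b c e rfl rfl; simp [add_assoc]
    · rintro a b c e rfl rfl; simp
    · rintro a b c e rfl rfl; simp
    · simp

theorem trilin_swap_right (T : V₁ → V₂ → V₃ → U) (f : FormalMap n V₁) (h : FormalMap n V₂)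
    (k : FormalMap n V₃) : trilin T f h k = trilin (fun x z y => T x y z) f k h :=
  funext fun _ => Finset.sum_congr rfl fun p _ =>
    Finsupp.sum_antidiagonal_swap p.2 (fun x y => T (f p.1) (h x) (k y))

theorem trilin_swap_left (T : V₁ → V₂ → V₃ → U) (f : FormalMap n V₁) (h : FormalMap n V₂)
    (k : FormalMap n V₃) : trilin T f h k = trilin (fun y x z => T x y z) h f k :=
  funext fun d => by
    simp only [trilin, Finset.sum_sigma']
    refine Finset.sum_nbij' (fun x => ⟨(x.2.1, x.1.1 + x.2.2), (x.1.1, x.2.2)⟩)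
      (fun x => ⟨(x.2.1, x.1.1 + x.2.2), (x.1.1, x.2.2)⟩) ?_ ?_ ?_ ?_ ?_
    all_goals
      simp only [Finset.mem_sigma, Finset.HasAntidiagonal.mem_antidiagonal, Sigma.forall, Prod.forall, and_imp]
    · rintro a b c e rfl rfl; simp [add_left_comm]
    · rintro a b c e rfl rfl; simp [add_left_comm]
    · rintro a b c e rfl rfl; simp
    · rintro a b c e rfl rfl; simp
    · simp

theorem trilin_add (T T' : V₁ → V₂ → V₃ → U) (f : FormalMap n V₁) (h : FormalMap n V₂)
    (k : FormalMap n V₃) :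
    trilin T f h k + trilin T' f h k = trilin (fun x y z => T x y z + T' x y z) f h k :=
  funext fun d => by simp [trilin, Finset.sum_add_distrib]

theorem trilin_congr {T T' : V₁ → V₂ → V₃ → U} {f : FormalMap n V₁} {h : FormalMap n V₂}
    {k : FormalMap n V₃} (H : ∀ p q s, T (f p) (h q) (k s) = T' (f p) (h q) (k s)) :
    trilin T f h k = trilin T' f h k :=
  funext fun d => by simp [trilin, H]

/-! ### Order of vanishing -/

/-- The coefficients of `f` in degrees `< p` vanish. -/
def OrdGE (p : ℕ) (f : FormalMap n V) : Prop := ∀ d : Fin n →₀ ℕ, d.degree < p → f d = 0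

theorem OrdGE.mono {p q : ℕ} {f : FormalMap n V} (h : OrdGE p f) (hq : q ≤ p) : OrdGE q f :=
  fun d hd => h d (hd.trans_le hq)

theorem ordGE_zero (f : FormalMap n V) : OrdGE 0 f := fun _ hd => absurd hd (Nat.not_lt_zero _)

theorem OrdGE.add {p : ℕ} {f h : FormalMap n V} (hf : OrdGE p f) (hh : OrdGE p h) :
    OrdGE p (f + h) := fun d hd => by simp [hf d hd, hh d hd]

theorem OrdGE.sub {p : ℕ} {f h : FormalMap n V} (hf : OrdGE p f) (hh : OrdGE p h) :
    OrdGE p (f - h) := fun d hd => by simp [hf d hd, hh d hd]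

theorem OrdGE.neg {p : ℕ} {f : FormalMap n V} (hf : OrdGE p f) : OrdGE p (-f) :=
  fun d hd => by simp [hf d hd]

theorem OrdGE.smul {p : ℕ} {f : FormalMap n V} (hf : OrdGE p f) (c : ℂ) : OrdGE p (c • f) :=
  fun d hd => by simp [hf d hd]

theorem OrdGE.sum {ι : Type*} {s : Finset ι} {p : ℕ} {f : ι → FormalMap n V}
    (hf : ∀ i ∈ s, OrdGE p (f i)) : OrdGE p (∑ i ∈ s, f i) := fun d hd => by
  rw [Finset.sum_apply]; exact Finset.sum_eq_zero fun i hi => hf i hi d hd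

theorem OrdGE.mapVal {p : ℕ} {f : FormalMap n V} (hf : OrdGE p f) (L : V →ₗ[ℂ] W) :
    OrdGE p (mapVal L f) := fun d hd => by simp [DynRMat.mapVal, hf d hd]

theorem OrdGE.mulX {p : ℕ} {f : FormalMap n V} (hf : OrdGE p f) (i : Fin n) :
    OrdGE (p + 1) (mulX i f) := fun d hd => by
  rcases eq_zero_or_eq_add_single i d with h | ⟨d, rfl⟩
  · exact mulX_of_eq_zero _ h
  · rw [mulX_add_single]; apply hf; simpa using hd

theorem OrdGE.pderiv {p : ℕ} {f : FormalMap n V} (hf : OrdGE (p + 1) f) (i : Fin n) :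
    OrdGE p (pderiv i f) := fun d hd => by
  rw [DynRMat.pderiv, hf _ (by simpa using hd), smul_zero]

theorem OrdGE.bilin {p q : ℕ} {f : FormalMap n V} {h : FormalMap n W} (hf : OrdGE p f)
    (hh : OrdGE q h) (B : V →ₗ[ℂ] W →ₗ[ℂ] U) : OrdGE (p + q) (bilin B f h) := fun d hd => by
  refine Finset.sum_eq_zero fun x hx => ?_
  rw [Finset.HasAntidiagonal.mem_antidiagonal] at hx
  have : x.1.degree + x.2.degree = d.degree := by rw [← hx, map_add]
  by_cases h1 : x.1.degree < p
  · simp [hf _ h1]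
  · simp [hh x.2 (by omega)]

theorem ordGE_one_iff {f : FormalMap n V} : OrdGE 1 f ↔ f 0 = 0 := by
  refine ⟨fun h => h 0 (by simp), fun h d hd => ?_⟩
  have : d.degree = 0 := by omega
  rw [Finsupp.degree_eq_zero_iff] at this
  rw [this, h]

/-- Separatedness of the filtration by order: identities between infinite series are checked on
truncations. -/
theorem eq_of_forall_ordGE {f h : FormalMap n V} (H : ∀ p, OrdGE p (f - h)) : f = h :=
  funext fun d => by simpa [sub_eq_zero] using H (d.degree + 1) d (Nat.lt_succ_self _)

/-- The limit of a sequence of series `uₚ` with `uₚ₊₁ - uₚ` of order `> p`. -/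
def limSeries (u : ℕ → FormalMap n V) : FormalMap n V := fun d => u d.degree d

/-- Completeness of the filtration: the coefficient in degree `|d|` no longer changes from step
`|d|` on, which is why the limit reads it off there. -/
theorem ordGE_limSeries_sub {u : ℕ → FormalMap n V} (hu : ∀ p, OrdGE (p + 1) (u (p + 1) - u p))
    (p : ℕ) : OrdGE (p + 1) (limSeries u - u p) := fun d hd => by
  have key : ∀ k, u (d.degree + k) d = u d.degree d := fun k => by
    induction k with
    | zero => rfl
    | succ k ih =>
      rw [← ih, ← add_assoc]
      simpa [sub_eq_zero] using hu (d.degree + k) d (by omega)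
  have := key (p - d.degree)
  rw [Nat.add_sub_cancel' (by omega)] at this
  simp [limSeries, this]

end SeriesOps


/-! ### Equivariance -/

section Equivariance

variable {n : ℕ} {g : Type*} [LieRing g] [LieAlgebra ℂ g] {l : LieSubalgebra ℂ g}
  (b : Module.Basis (Fin n) ℂ l)
  {V W U : Type*} [AddCommGroup V] [Module ℂ V] [LieRingModule g V] [LieModule ℂ g V]
  [AddCommGroup W] [Module ℂ W] [LieRingModule g W] [LieModule ℂ g W]
  [AddCommGroup U] [Module ℂ U] [LieRingModule g U] [LieModule ℂ g U]

theorem smulSeries_linForm {V : Type*} [AddCommGroup V] [Module ℂ V] (y : l)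
    (f : FormalMap n V) :
    smulSeries (linForm b y) f = ∑ j, b.repr y j • mulX j f := by
  have h1 : linForm b y = ∑ j, b.repr y j • mulX j (constMap n (1 : ℂ)) := by
    funext d
    simp only [linForm, Finset.sum_apply, Pi.smul_apply]
    refine Finset.sum_congr rfl fun j _ => ?_
    rcases eq_zero_or_eq_add_single j d with h | ⟨d, rfl⟩
    · rw [mulX_of_eq_zero _ h, if_neg, smul_zero]
      rintro rfl; simp at h
    · rw [mulX_add_single, constMap]
      simp
  have h2 : bilin (LinearMap.lsmul ℂ V) (constMap n 1) f = f := by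
    rw [bilin_constMap_left]; exact funext fun d => by simp [mapVal]
  rw [smulSeries, h1, bilin_sum_left]
  refine Finset.sum_congr rfl fun j _ => ?_
  rw [bilin_smul_left, bilin_mulX_left, h2]

/-- The derivative of `f` along the coadjoint vector field of `y`. -/
def coadDer {V : Type*} [AddCommGroup V] [Module ℂ V] (y : l) (f : FormalMap n V) :
    FormalMap n V :=
  ∑ i, ∑ j, b.repr ⁅y, b i⁆ j • mulX j (pderiv i f)

/-- `coadDer` as a linear map. -/
def coadDerL {V : Type*} [AddCommGroup V] [Module ℂ V] (y : l) :
    FormalMap n V →ₗ[ℂ] FormalMap n V :=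
  ∑ i, ∑ j, b.repr ⁅y, b i⁆ j • (mulXL j ∘ₗ pderivL i)

theorem coadDer_eq {V : Type*} [AddCommGroup V] [Module ℂ V] (y : l) (f : FormalMap n V) :
    coadDer b y f = coadDerL b y f := by
  simp only [coadDer, coadDerL, LinearMap.sum_apply, LinearMap.smul_apply]
  rfl

theorem coadDer_sum {ι V : Type*} [AddCommGroup V] [Module ℂ V] (y : l) (s : Finset ι)
    (f : ι → FormalMap n V) : coadDer b y (∑ k ∈ s, f k) = ∑ k ∈ s, coadDer b y (f k) := by
  simp only [coadDer_eq, map_sum]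

/-- The failure of equivariance of `f` under `y`. -/
def lieDer (y : l) (f : FormalMap n V) : FormalMap n V :=
  mapVal (LieModule.toEnd ℂ g V (y : g)) f + coadDer b y f

theorem isEquivariant_iff {f : FormalMap n V} :
    IsEquivariant b f ↔ ∀ y : l, lieDer b y f = 0 := by
  refine forall_congr' fun y => ?_
  simp only [lieDer, coadDer, smulSeries_linForm]
  exact eq_neg_iff_add_eq_zero

/-- `lieDer` as a linear map. -/
def lieDerL (y : l) : FormalMap n V →ₗ[ℂ] FormalMap n V where
  toFun := lieDer b y
  map_add' f h := by
    simp only [lieDer, mapVal_add, coadDer_eq, map_add]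
    abel
  map_smul' c f := by
    simp only [lieDer, mapVal_smul, coadDer_eq, map_smul, smul_add, RingHom.id_apply]

theorem lieDer_eq (y : l) (f : FormalMap n V) : lieDer b y f = lieDerL b y f := rfl

variable {b}

theorem IsEquivariant.lieDer_eq_zero {f : FormalMap n V} (hf : IsEquivariant b f) (y : l) :
    lieDer b y f = 0 := (isEquivariant_iff b).1 hf y

theorem IsEquivariant.add {f h : FormalMap n V} (hf : IsEquivariant b f)
    (hh : IsEquivariant b h) : IsEquivariant b (f + h) := by
  rw [isEquivariant_iff] at *
  intro y
  rw [lieDer_eq, map_add, ← lieDer_eq, ← lieDer_eq, hf, hh, add_zero]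

theorem IsEquivariant.smul {f : FormalMap n V} (hf : IsEquivariant b f) (c : ℂ) :
    IsEquivariant b (c • f) := by
  rw [isEquivariant_iff] at *
  intro y
  rw [lieDer_eq, map_smul, ← lieDer_eq, hf, smul_zero]

theorem isEquivariant_zero : IsEquivariant b (0 : FormalMap n V) := by
  rw [isEquivariant_iff]
  intro y
  rw [lieDer_eq, map_zero]

theorem IsEquivariant.neg {f : FormalMap n V} (hf : IsEquivariant b f) :
    IsEquivariant b (-f) := by
  rw [← neg_one_smul ℂ f]; exact hf.smul _

theorem IsEquivariant.sub {f h : FormalMap n V} (hf : IsEquivariant b f)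
    (hh : IsEquivariant b h) : IsEquivariant b (f - h) := by
  rw [sub_eq_add_neg]; exact hf.add hh.neg

theorem IsEquivariant.sum {ι : Type*} {s : Finset ι} {f : ι → FormalMap n V}
    (hf : ∀ i ∈ s, IsEquivariant b (f i)) : IsEquivariant b (∑ i ∈ s, f i) :=
  Finset.sum_induction f _ (fun _ _ => IsEquivariant.add) isEquivariant_zero hf

theorem isEquivariant_constMap {v : V} (hv : ∀ y : l, ⁅(y : g), v⁆ = 0) :
    IsEquivariant b (constMap n v) := by
  rw [isEquivariant_iff]
  intro y
  simp only [lieDer, coadDer, pderiv_constMap, mulX_zero, smul_zero, Finset.sum_const_zero,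
    mapVal_constMap, LieModule.toEnd_apply_apply, hv]
  funext d
  simp [constMap]

/-- The coadjoint vector fields vanish at the origin, so equivariance at `0` is invariance. -/
theorem lie_eq_zero_of_isEquivariant {f : FormalMap n V} (hf : IsEquivariant b f) (y : l) :
    ⁅(y : g), f 0⁆ = 0 := by
  have := congrFun (hf.lieDer_eq_zero y) 0
  simpa [lieDer, coadDer, mapVal, mulX] using this

/-! ### Coadjoint vector fields, products and derivatives -/

variable (b)

theorem coadDer_bilin {V W U : Type*} [AddCommGroup V] [Module ℂ V] [AddCommGroup W] [Module ℂ W]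
    [AddCommGroup U] [Module ℂ U] (B : V →ₗ[ℂ] W →ₗ[ℂ] U) (y : l) (f : FormalMap n V)
    (h : FormalMap n W) :
    coadDer b y (bilin B f h) = bilin B (coadDer b y f) h + bilin B f (coadDer b y h) := by
  simp only [coadDer, bilin_sum_left, bilin_sum_right, bilin_smul_left, bilin_smul_right,
    bilin_mulX_left, bilin_mulX_right, pderiv_bilin, mulX_add, smul_add, Finset.sum_add_distrib]

theorem coadDer_mapVal {V W : Type*} [AddCommGroup V] [Module ℂ V] [AddCommGroup W] [Module ℂ W]
    (L : V →ₗ[ℂ] W) (y : l) (f : FormalMap n V) :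
    coadDer b y (mapVal L f) = mapVal L (coadDer b y f) := by
  simp only [coadDer, mapVal_sum, mapVal_smul, mapVal_mulX, mapVal_pderiv]

/-- The coadjoint field is linear, so its commutators with `xₖ`, and with `∂ₖ` in the next lemma,
have constant coefficients: the matrix entries of `ad y`. -/
theorem coadDer_mulX {V : Type*} [AddCommGroup V] [Module ℂ V] (y : l) (k : Fin n)
    (f : FormalMap n V) :
    coadDer b y (mulX k f) = mulX k (coadDer b y f) + ∑ j, b.repr ⁅y, b k⁆ j • mulX j f := by
  simp only [coadDer, mulX_sum, mulX_smul, pderiv_mulX, mulX_add, smul_add,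
    Finset.sum_add_distrib]
  rw [add_comm]
  congr 1
  · refine Finset.sum_congr rfl fun i _ => Finset.sum_congr rfl fun j _ => ?_
    rw [mulX_comm]
  · rw [Finset.sum_eq_single k]
    · simp
    · intro i _ h
      simp [h, mulX_zero]
    · simp

theorem coadDer_pderiv {V : Type*} [AddCommGroup V] [Module ℂ V] (y : l) (k : Fin n)
    (f : FormalMap n V) :
    coadDer b y (pderiv k f) =
      pderiv k (coadDer b y f) - ∑ i, b.repr ⁅y, b i⁆ k • pderiv i f := by
  simp only [coadDer, pderiv_sum, pderiv_smul, pderiv_mulX, smul_add, Finset.sum_add_distrib]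
  rw [eq_sub_iff_add_eq, add_comm]
  congr 1
  · refine Finset.sum_congr rfl fun i _ => ?_
    rw [Finset.sum_eq_single k]
    · simp
    · intro j _ h
      simp [Ne.symm h]
    · simp
  · refine Finset.sum_congr rfl fun i _ => Finset.sum_congr rfl fun j _ => ?_
    rw [pderiv_comm]

variable {b}

theorem IsEquivariant.coadDer {f : FormalMap n V} (hf : IsEquivariant b f) (y : l) :
    coadDer b y f = -mapVal (LieModule.toEnd ℂ g V (y : g)) f :=
  eq_neg_of_add_eq_zero_right (hf.lieDer_eq_zero y)

theorem IsEquivariant.bilin {B : V →ₗ[ℂ] W →ₗ[ℂ] U}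
    (hB : ∀ (y : l) (v : V) (w : W), ⁅(y : g), B v w⁆ = B ⁅(y : g), v⁆ w + B v ⁅(y : g), w⁆)
    {f : FormalMap n V} {h : FormalMap n W} (hf : IsEquivariant b f) (hh : IsEquivariant b h) :
    IsEquivariant b (bilin B f h) := by
  rw [isEquivariant_iff]
  intro y
  rw [lieDer, coadDer_bilin, hf.coadDer, hh.coadDer]
  funext d
  simp only [mapVal, DynRMat.bilin, Pi.add_apply, Pi.neg_apply, map_sum, LieModule.toEnd_apply_apply,
    map_neg, LinearMap.neg_apply, ← Finset.sum_add_distrib, hB]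
  exact Finset.sum_eq_zero fun p _ => by abel

theorem IsEquivariant.mapVal {L : V →ₗ[ℂ] W} (hL : ∀ (y : l) (v : V), L ⁅(y : g), v⁆ = ⁅(y : g), L v⁆)
    {f : FormalMap n V} (hf : IsEquivariant b f) : IsEquivariant b (mapVal L f) := by
  rw [isEquivariant_iff]
  intro y
  rw [lieDer, coadDer_mapVal, hf.coadDer]
  funext d
  simp [DynRMat.mapVal, hL]

/-- The series `∑ᵢ xᵢ ⊗ ∂ᵢf`. -/
def gradBar (b : Module.Basis (Fin n) ℂ l) {V : Type*} [AddCommGroup V] [Module ℂ V]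
    (f : FormalMap n V) : FormalMap n (g ⊗[ℂ] V) := formBar b fun i => pderiv i f

theorem formBar_eq (b : Module.Basis (Fin n) ℂ l) {V : Type*} [AddCommGroup V] [Module ℂ V]
    (ω : Fin n → FormalMap n V) :
    formBar b ω = ∑ i, mapVal (TensorProduct.mk ℂ g V (b i : g)) (ω i) :=
  funext fun d => by simp [formBar, mapVal]

theorem gradBar_eq (b : Module.Basis (Fin n) ℂ l) {V : Type*} [AddCommGroup V] [Module ℂ V]
    (f : FormalMap n V) :
    gradBar b f = ∑ i, mapVal (TensorProduct.mk ℂ g V (b i : g)) (pderiv i f) := formBar_eq _ _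

/-- `gradBar` as a linear map. -/
def gradBarL (b : Module.Basis (Fin n) ℂ l) {V : Type*} [AddCommGroup V] [Module ℂ V] :
    FormalMap n V →ₗ[ℂ] FormalMap n (g ⊗[ℂ] V) where
  toFun := gradBar b
  map_add' f h := by simp [gradBar_eq, pderiv_add, mapVal_add, Finset.sum_add_distrib]
  map_smul' c f := by simp [gradBar_eq, pderiv_smul, mapVal_smul, Finset.smul_sum]

theorem gradBar_add (b : Module.Basis (Fin n) ℂ l) {V : Type*} [AddCommGroup V] [Module ℂ V]
    (f h : FormalMap n V) : gradBar b (f + h) = gradBar b f + gradBar b h :=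
  map_add (gradBarL b) f h

theorem gradBar_sub (b : Module.Basis (Fin n) ℂ l) {V : Type*} [AddCommGroup V] [Module ℂ V]
    (f h : FormalMap n V) : gradBar b (f - h) = gradBar b f - gradBar b h :=
  map_sub (gradBarL b) f h

theorem gradBar_constMap (b : Module.Basis (Fin n) ℂ l) {V : Type*} [AddCommGroup V] [Module ℂ V]
    (v : V) : gradBar b (constMap n v) = 0 := by
  simp [gradBar_eq, pderiv_constMap, mapVal_zero]

theorem OrdGE.gradBar (b : Module.Basis (Fin n) ℂ l) {V : Type*} [AddCommGroup V] [Module ℂ V]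
    {p : ℕ} {f : FormalMap n V} (hf : OrdGE (p + 1) f) : OrdGE p (gradBar b f) := by
  rw [gradBar_eq]; exact OrdGE.sum fun i _ => (hf.pderiv i).mapVal _

theorem sum_repr_smul_coe (b : Module.Basis (Fin n) ℂ l) (z : l) :
    ∑ k, b.repr z k • (b k : g) = z := by
  have h := congrArg l.toSubmodule.subtype (b.sum_repr z)
  rw [map_sum] at h
  exact h

/-- The operator `∑ xᵢ ⊗ ∂ᵢ` comes from the canonical invariant element of `𝔩 ⊗ 𝔩*`: the commutator
of the coadjoint field with `∂ₖ` cancels the action of `y` on the first tensor factor. -/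
theorem IsEquivariant.gradBar {f : FormalMap n V} (hf : IsEquivariant b f) :
    IsEquivariant b (gradBar b f) := by
  rw [isEquivariant_iff]
  intro y
  have h1 : ∀ k, DynRMat.coadDer b y (pderiv k f) =
      -DynRMat.mapVal (LieModule.toEnd ℂ g V (y : g)) (pderiv k f)
        - ∑ i, b.repr ⁅y, b i⁆ k • pderiv i f := fun k => by
    rw [coadDer_pderiv, hf.coadDer, pderiv_neg, mapVal_pderiv]
  have h2 : DynRMat.coadDer b y (DynRMat.gradBar b f) = ∑ k,
      DynRMat.mapVal (TensorProduct.mk ℂ g V (b k : g)) (DynRMat.coadDer b y (pderiv k f)) := by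
    simp only [gradBar_eq, coadDer_sum, coadDer_mapVal]
  rw [lieDer, h2]
  funext d
  simp only [h1, gradBar_eq, DynRMat.mapVal, Pi.add_apply, Finset.sum_apply, Pi.sub_apply,
    Pi.neg_apply, Pi.smul_apply, TensorProduct.mk_apply, LieModule.toEnd_apply_apply, map_sum,
    TensorProduct.LieModule.lie_tmul_right, TensorProduct.tmul_sub, TensorProduct.tmul_neg,
    TensorProduct.tmul_sum, TensorProduct.tmul_smul, Finset.sum_add_distrib,
    Finset.sum_sub_distrib, Finset.sum_neg_distrib, Pi.zero_apply]
  have : ∑ k, ∑ i, b.repr ⁅y, b i⁆ k • ((b k : g) ⊗ₜ[ℂ] pderiv i f d) =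
      ∑ i, ⁅(y : g), (b i : g)⁆ ⊗ₜ[ℂ] pderiv i f d := by
    rw [Finset.sum_comm]
    refine Finset.sum_congr rfl fun i _ => ?_
    simp only [TensorProduct.smul_tmul', ← TensorProduct.sum_tmul]
    rw [sum_repr_smul_coe]; rfl
  rw [this]
  abel

/-- Equivariance is a closed condition, so it passes to limits of equivariant approximations. -/
theorem isEquivariant_of_degree {f : FormalMap n V}
    (H : ∀ p, ∃ f', IsEquivariant b f' ∧ OrdGE p (f - f')) : IsEquivariant b f := by
  rw [isEquivariant_iff]
  intro y
  apply eq_of_forall_ordGE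
  intro p
  obtain ⟨f', hf', h⟩ := H (p + 1)
  have : lieDer b y f - 0 = lieDer b y (f - f') := by
    rw [lieDer_eq b y (f - f'), map_sub, ← lieDer_eq, ← lieDer_eq, hf'.lieDer_eq_zero]
  rw [this, lieDer, DynRMat.coadDer]
  refine OrdGE.add ((h.mapVal _).mono (Nat.le_succ _)) (OrdGE.sum fun i _ => OrdGE.sum fun j _ =>
    OrdGE.smul (OrdGE.mono ((h.pderiv i).mulX j) (Nat.le_succ _)) _)

end Equivariance


/-! ### Skew tensors -/

section SkewTensors

variable {g : Type*} [LieRing g] [LieAlgebra ℂ g]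

open TensorProduct TensorProduct.LieModule

/-- The skew-symmetrization step `a ⊗ b ⊗ w ↦ a ⊗ b ⊗ w - b ⊗ A (a ⊗ w)`. -/
def altStep {W : Type*} [AddCommGroup W] [Module ℂ W] (A : g ⊗[ℂ] W →ₗ[ℂ] g ⊗[ℂ] W) :
    g ⊗[ℂ] (g ⊗[ℂ] W) →ₗ[ℂ] g ⊗[ℂ] (g ⊗[ℂ] W) :=
  LinearMap.id - A.lTensor g ∘ₗ (TensorProduct.leftComm ℂ g g W).toLinearMap

theorem altStep_tmul {W : Type*} [AddCommGroup W] [Module ℂ W] (A : g ⊗[ℂ] W →ₗ[ℂ] g ⊗[ℂ] W)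
    (x y : g) (w : W) : altStep A (x ⊗ₜ (y ⊗ₜ w)) = x ⊗ₜ (y ⊗ₜ w) - y ⊗ₜ A (x ⊗ₜ w) := rfl

variable (g) in
/-- `a ⊗ b ↦ a ⊗ b - b ⊗ a`. -/
def alt2 : g ⊗[ℂ] g →ₗ[ℂ] g ⊗[ℂ] g := LinearMap.id - flip21 g

theorem alt2_tmul (x y : g) : alt2 g (x ⊗ₜ y) = x ⊗ₜ y - y ⊗ₜ x := rfl

theorem alt_eq_altStep : alt g = altStep (alt2 g) := by
  ext x y z
  change alt g (x ⊗ₜ (y ⊗ₜ z)) = altStep (alt2 g) (x ⊗ₜ (y ⊗ₜ z))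
  rw [alt_tmul, altStep_tmul, alt2_tmul, tmul_sub]
  abel

variable (g) in
/-- The map `g ⊗ Λ³g → Λ⁴g`, on tensors. -/
def alt4 : g ⊗[ℂ] (g ⊗[ℂ] (g ⊗[ℂ] g)) →ₗ[ℂ] g ⊗[ℂ] (g ⊗[ℂ] (g ⊗[ℂ] g)) := altStep (alt g)

theorem alt4_tmul (x y z w : g) : alt4 g (x ⊗ₜ (y ⊗ₜ (z ⊗ₜ w))) =
    x ⊗ₜ (y ⊗ₜ (z ⊗ₜ w)) - y ⊗ₜ (x ⊗ₜ (z ⊗ₜ w)) + y ⊗ₜ (z ⊗ₜ (x ⊗ₜ w)) -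
      y ⊗ₜ (z ⊗ₜ (w ⊗ₜ x)) := by
  rw [alt4, altStep_tmul, alt_tmul, tmul_add, tmul_sub]
  abel

theorem lie_flip21 (x : g) (r : g ⊗[ℂ] g) : flip21 g ⁅x, r⁆ = ⁅x, flip21 g r⁆ := by
  induction r with
  | zero => simp
  | add r s hr hs => simp only [lie_add, map_add, hr, hs]
  | tmul y z => simp only [lie_tmul_right, flip21_tmul, map_add]; abel

theorem lie_alt2 (x : g) (r : g ⊗[ℂ] g) : alt2 g ⁅x, r⁆ = ⁅x, alt2 g r⁆ := by
  simp [alt2, lie_flip21]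

@[elab_as_elim]
theorem tensor3_induction {p : g ⊗[ℂ] (g ⊗[ℂ] g) → Prop} (Z : g ⊗[ℂ] (g ⊗[ℂ] g))
    (add : ∀ Z Z', p Z → p Z' → p (Z + Z')) (tmul : ∀ x y z, p (x ⊗ₜ (y ⊗ₜ z))) : p Z := by
  induction Z with
  | zero => simpa using tmul 0 0 0
  | add Z Z' h h' => exact add _ _ h h'
  | tmul x r =>
    induction r with
    | zero => simpa using tmul 0 0 0
    | add r s hr hs => rw [tmul_add]; exact add _ _ hr hs
    | tmul y z => exact tmul x y z

theorem lie_alt (x : g) (Z : g ⊗[ℂ] (g ⊗[ℂ] g)) : alt g ⁅x, Z⁆ = ⁅x, alt g Z⁆ := by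
  refine tensor3_induction Z (fun Z Z' h h' => ?_) fun u v w => ?_
  · simp only [lie_add, map_add, h, h']
  · simp only [lie_tmul_right, alt_tmul, map_add, tmul_add, lie_add, lie_sub]; abel

theorem lie_cybBilin (x : g) (r s : g ⊗[ℂ] g) :
    ⁅x, cybBilin g r s⁆ = cybBilin g ⁅x, r⁆ s + cybBilin g r ⁅x, s⁆ := by
  induction r with
  | zero => simp
  | add r r' hr hr' => simp only [lie_add, map_add, LinearMap.add_apply, hr, hr']; abel
  | tmul y z =>
    induction s with
    | zero => simp
    | add s s' hs hs' => simp only [lie_add, map_add, hs, hs']; abel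
    | tmul u v =>
      simp only [lie_tmul_right, cybBilin_tmul, map_add, tmul_add, add_tmul, LinearMap.add_apply,
        lie_add, leibniz_lie x]
      abel

@[elab_as_elim]
-- A skew tensor is half of its own alternation, hence a sum of bivectors `x ∧ y`; the scalar is
-- absorbed into `x`.
theorem skew_induction {p : g ⊗[ℂ] g → Prop} {r : g ⊗[ℂ] g} (hr : flip21 g r = -r)
    (add : ∀ r s, p r → p s → p (r + s)) (tmul : ∀ x y : g, p (alt2 g (x ⊗ₜ y))) : p r := by
  have h : ∀ r, p ((1 / 2 : ℂ) • alt2 g r) := fun r => by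
    induction r with
    | zero => simpa using tmul 0 0
    | add r s hr hs => rw [map_add, smul_add]; exact add _ _ hr hs
    | tmul x y => rw [← map_smul, smul_tmul']; exact tmul _ _
  have e : (1 / 2 : ℂ) • alt2 g r = r := by
    rw [alt2, LinearMap.sub_apply, LinearMap.id_apply, hr, sub_neg_eq_add, ← two_smul ℂ, smul_smul]
    norm_num
  exact e ▸ h r

theorem flip21_alt2 (r : g ⊗[ℂ] g) : flip21 g (alt2 g r) = -alt2 g r := by
  induction r with
  | zero => simp
  | add r s hr hs => simp only [map_add, hr, hs, neg_add]
  | tmul x y => simp only [alt2_tmul, map_sub, flip21_tmul, neg_sub]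

/-- Total skew-symmetry of a tensor of degree three. -/
def IsSkew3 (Z : g ⊗[ℂ] (g ⊗[ℂ] g)) : Prop := perm213 g Z = -Z ∧ perm312 g Z = Z

theorem IsSkew3.add {Z Z' : g ⊗[ℂ] (g ⊗[ℂ] g)} (h : IsSkew3 Z) (h' : IsSkew3 Z') :
    IsSkew3 (Z + Z') := by
  constructor
  · rw [map_add, h.1, h'.1, neg_add]
  · rw [map_add, h.2, h'.2]

theorem IsSkew3.smul {Z : g ⊗[ℂ] (g ⊗[ℂ] g)} (h : IsSkew3 Z) (c : ℂ) : IsSkew3 (c • Z) := by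
  constructor
  · rw [map_smul, h.1, smul_neg]
  · rw [map_smul, h.2]

theorem isSkew3_zero : IsSkew3 (0 : g ⊗[ℂ] (g ⊗[ℂ] g)) := by simp [IsSkew3]

theorem perm213_tmul (x y z : g) : perm213 g (x ⊗ₜ (y ⊗ₜ z)) = y ⊗ₜ (x ⊗ₜ z) := rfl

theorem perm312_tmul (x y z : g) : perm312 g (x ⊗ₜ (y ⊗ₜ z)) = y ⊗ₜ (z ⊗ₜ x) := rfl

theorem isSkew3_alt_tmul (x : g) {r : g ⊗[ℂ] g} (hr : flip21 g r = -r) :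
    IsSkew3 (alt g (x ⊗ₜ r)) := by
  refine skew_induction hr (fun r s h h' => ?_) fun y z => ?_
  · rw [tmul_add, map_add]; exact h.add h'
  · constructor <;>
    · simp only [alt2_tmul, tmul_sub, map_sub, alt_tmul, map_add, perm213_tmul, perm312_tmul]
      abel

theorem alt_alt2_swap (x y z : g) :
    alt g (x ⊗ₜ alt2 g (y ⊗ₜ z)) = -alt g (y ⊗ₜ alt2 g (x ⊗ₜ z)) := by
  simp only [alt2_tmul, tmul_sub, map_sub, alt_tmul]
  abel

/-- The polarized Yang-Baxter operator on a decomposable skew tensor is given by the action. -/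
theorem cybBilin_symm_alt2 (x y : g) {r : g ⊗[ℂ] g} (hr : flip21 g r = -r) :
    cybBilin g (alt2 g (x ⊗ₜ y)) r + cybBilin g r (alt2 g (x ⊗ₜ y)) =
      alt g (x ⊗ₜ ⁅y, r⁆ - y ⊗ₜ ⁅x, r⁆) := by
  refine skew_induction hr (fun r s h h' => ?_) fun u v => ?_
  · simp only [map_add, LinearMap.add_apply, lie_add, tmul_add, map_sub] at h h' ⊢
    rw [add_add_add_comm, h, h']
    abel
  · have h1 : ⁅u, x⁆ = -⁅x, u⁆ := (lie_skew _ _).symm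
    have h2 : ⁅u, y⁆ = -⁅y, u⁆ := (lie_skew _ _).symm
    have h3 : ⁅v, x⁆ = -⁅x, v⁆ := (lie_skew _ _).symm
    have h4 : ⁅v, y⁆ = -⁅y, v⁆ := (lie_skew _ _).symm
    simp only [alt2_tmul, map_sub, LinearMap.sub_apply, cybBilin_tmul, lie_sub, lie_tmul_right,
      tmul_sub, tmul_add, map_add, alt_tmul, h1, h2, h3, h4, neg_tmul, tmul_neg]
    abel

/-- For `r = x ∧ y` the polarized operator is a difference of alternations of `x ⊗ ⁅y, s⁆` and `y ⊗
⁅x, s⁆`, whose second parts are skew. -/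
theorem isSkew3_cybBilin {r s : g ⊗[ℂ] g} (hr : flip21 g r = -r) (hs : flip21 g s = -s) :
    IsSkew3 (cybBilin g r s + cybBilin g s r) := by
  refine skew_induction hr (fun r r' h h' => ?_) fun x y => ?_
  · rw [map_add, map_add, LinearMap.add_apply, add_add_add_comm]
    exact h.add h'
  · rw [cybBilin_symm_alt2 x y hs, map_sub, sub_eq_add_neg, ← neg_one_smul ℂ (alt g _)]
    have H : ∀ x : g, flip21 g ⁅x, s⁆ = -⁅x, s⁆ := fun x => by rw [lie_flip21, hs, lie_neg]
    exact (isSkew3_alt_tmul _ (H _)).add ((isSkew3_alt_tmul _ (H _)).smul _)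

/-! #### The Jacobi identity for skew tensors -/

/-- `a ∧ b ∧ c`. -/
def wedge3 (x y z : g) : g ⊗[ℂ] (g ⊗[ℂ] g) := alt g (x ⊗ₜ alt2 g (y ⊗ₜ z))

/-- `a ∧ b ∧ c ∧ d`. -/
def wedge4 (x y z w : g) : g ⊗[ℂ] (g ⊗[ℂ] (g ⊗[ℂ] g)) := alt4 g (x ⊗ₜ wedge3 y z w)

theorem wedge4_eq (x y z w : g) : wedge4 x y z w =
    alt4 g (x ⊗ₜ alt g (y ⊗ₜ alt2 g (z ⊗ₜ w))) := rfl

theorem wedge4_swap₁ (x y z w : g) : wedge4 y x z w = -wedge4 x y z w := by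
  simp only [wedge4_eq, alt2_tmul, tmul_sub, tmul_add, map_sub, map_add, alt_tmul, alt4_tmul]
  abel

theorem wedge4_swap₂ (x y z w : g) : wedge4 x z y w = -wedge4 x y z w := by
  simp only [wedge4_eq, alt2_tmul, tmul_sub, tmul_add, map_sub, map_add, alt_tmul, alt4_tmul]
  abel

theorem wedge4_swap₃ (x y z w : g) : wedge4 x y w z = -wedge4 x y z w := by
  simp only [wedge4_eq, alt2_tmul, tmul_sub, tmul_add, map_sub, map_add, alt_tmul, alt4_tmul]
  abel

/-- The tensor `a ∧ b ∧ c ∧ d` multiplied by `s - t`. Exchanging `s` and `t` absorbs the signs of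
the transpositions, which turns the antisymmetry into rewriting rules that sort the factors. -/
def signedWedge4 (x y z w : g) (s t : ℂ) : g ⊗[ℂ] (g ⊗[ℂ] (g ⊗[ℂ] g)) := (s - t) • wedge4 x y z w

theorem signedWedge4_swap₁ (x y z w : g) (s t : ℂ) :
    signedWedge4 x y z w s t = signedWedge4 y x z w t s := by
  rw [signedWedge4, signedWedge4, wedge4_swap₁ x y, smul_neg, ← neg_smul, neg_sub]

theorem signedWedge4_swap₂ (x y z w : g) (s t : ℂ) :
    signedWedge4 x y z w s t = signedWedge4 x z y w t s := by
  rw [signedWedge4, signedWedge4, wedge4_swap₂ x y, smul_neg, ← neg_smul, neg_sub]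

theorem signedWedge4_swap₃ (x y z w : g) (s t : ℂ) :
    signedWedge4 x y z w s t = signedWedge4 x y w z t s := by
  rw [signedWedge4, signedWedge4, wedge4_swap₃ x y, smul_neg, ← neg_smul, neg_sub]

theorem wedge4_eq_signed (x y z w : g) : wedge4 x y z w = signedWedge4 x y z w 1 0 := by
  simp [signedWedge4]

theorem signedWedge4_flip (x y z w : g) : signedWedge4 x y z w 0 1 = -wedge4 x y z w := by
  simp [signedWedge4]

theorem wedge4_neg₂ (x y z w : g) : wedge4 x (-y) z w = -wedge4 x y z w := by
  simp [wedge4, wedge3, neg_tmul, tmul_neg]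

theorem wedge4_neg₃ (x y z w : g) : wedge4 x y (-z) w = -wedge4 x y z w := by
  simp [wedge4, wedge3, neg_tmul, tmul_neg]

theorem wedge4_neg₄ (x y z w : g) : wedge4 x y z (-w) = -wedge4 x y z w := by
  simp [wedge4, wedge3, tmul_neg]

theorem wedge4_add₃ (x y z z' w : g) :
    wedge4 x y (z + z') w = wedge4 x y z w + wedge4 x y z' w := by
  simp [wedge4, wedge3, add_tmul, tmul_add]

theorem wedge4_add₄ (x y z w w' : g) :
    wedge4 x y z (w + w') = wedge4 x y z w + wedge4 x y z w' := by
  simp [wedge4, wedge3, tmul_add]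

theorem lie_wedge3 (u x y z : g) : ⁅u, wedge3 x y z⁆ =
    wedge3 ⁅u, x⁆ y z + wedge3 x ⁅u, y⁆ z + wedge3 x y ⁅u, z⁆ := by
  simp only [wedge3, ← lie_alt, ← lie_alt2, lie_tmul_right, tmul_add, map_add]
  abel

variable (g) in
/-- The bilinear map `(a ⊗ b, Z) ↦ a ∧ [b, Z]`, the bracket of bivectors and trivectors. -/
def brTwoThree : g ⊗[ℂ] g →ₗ[ℂ] g ⊗[ℂ] (g ⊗[ℂ] g) →ₗ[ℂ] g ⊗[ℂ] (g ⊗[ℂ] (g ⊗[ℂ] g)) :=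
  TensorProduct.lift <| LinearMap.mk₂ ℂ
    (fun x y => alt4 g ∘ₗ TensorProduct.mk ℂ g (g ⊗[ℂ] (g ⊗[ℂ] g)) x ∘ₗ
      LieModule.toEnd ℂ g (g ⊗[ℂ] (g ⊗[ℂ] g)) y)
    (fun x x' y => LinearMap.ext fun Z => by simp)
    (fun c x y => LinearMap.ext fun Z => by simp)
    (fun x y y' => LinearMap.ext fun Z => by simp [tmul_add])
    (fun c x y => LinearMap.ext fun Z => by simp)

theorem brTwoThree_tmul (x y : g) (Z : g ⊗[ℂ] (g ⊗[ℂ] g)) :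
    brTwoThree g (x ⊗ₜ y) Z = alt4 g (x ⊗ₜ ⁅y, Z⁆) := rfl

theorem brTwoThree_wedge (x y u v w : g) :
    brTwoThree g (alt2 g (x ⊗ₜ y)) (wedge3 u v w) =
      wedge4 x ⁅y, u⁆ v w + wedge4 x u ⁅y, v⁆ w + wedge4 x u v ⁅y, w⁆ -
      (wedge4 y ⁅x, u⁆ v w + wedge4 y u ⁅x, v⁆ w + wedge4 y u v ⁅x, w⁆) := by
  simp only [alt2_tmul, map_sub, LinearMap.sub_apply, brTwoThree_tmul, lie_wedge3, tmul_add,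
    map_add, wedge4]

theorem cybBilin_wedge (x y u v : g) :
    cybBilin g (alt2 g (x ⊗ₜ y)) (alt2 g (u ⊗ₜ v)) +
      cybBilin g (alt2 g (u ⊗ₜ v)) (alt2 g (x ⊗ₜ y)) =
    wedge3 x ⁅y, u⁆ v + wedge3 x u ⁅y, v⁆ - (wedge3 y ⁅x, u⁆ v + wedge3 y u ⁅x, v⁆) := by
  rw [cybBilin_symm_alt2 _ _ (flip21_alt2 _)]
  simp only [wedge3, ← lie_alt2, lie_tmul_right, tmul_add, map_add, map_sub]

/-- The Jacobi identity of the Schouten bracket for three bivectors. By multilinearity it is enough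
to treat decomposable ones, where it reduces to the Jacobi identity in `g`. -/
theorem brTwoThree_jacobi {r s t : g ⊗[ℂ] g} (hr : flip21 g r = -r) (hs : flip21 g s = -s)
    (ht : flip21 g t = -t) :
    brTwoThree g r (cybBilin g s t + cybBilin g t s) +
      brTwoThree g s (cybBilin g t r + cybBilin g r t) +
      brTwoThree g t (cybBilin g r s + cybBilin g s r) = 0 := by
  refine skew_induction hr (fun r r' h h' => ?_) fun x x' => ?_
  · have := congrArg₂ (· + ·) h h'
    simp only [map_add, LinearMap.add_apply, add_zero] at this ⊢
    rw [← this]; abel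
  refine skew_induction hs (fun r r' h h' => ?_) fun y y' => ?_
  · have := congrArg₂ (· + ·) h h'
    simp only [map_add, LinearMap.add_apply, add_zero] at this ⊢
    rw [← this]; abel
  refine skew_induction ht (fun r r' h h' => ?_) fun z z' => ?_
  · have := congrArg₂ (· + ·) h h'
    simp only [map_add, LinearMap.add_apply, add_zero] at this ⊢
    rw [← this]; abel
  have jac : ∀ p q r : g, ⁅p, ⁅q, r⁆⁆ = -(⁅q, ⁅r, p⁆⁆ + ⁅r, ⁅p, q⁆⁆) := fun p q r => by
    rw [eq_neg_iff_add_eq_zero, ← add_assoc]; exact lie_jacobi p q r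
  have sk : ∀ p q : g, ⁅p, q⁆ = -⁅q, p⁆ := fun p q => (lie_skew p q).symm
  simp only [cybBilin_wedge, map_add, map_sub, brTwoThree_wedge]
  -- Double brackets with an outer `x` or `x'` are eliminated by Jacobi, and the remaining inner
  -- brackets are oriented cyclically as `⁅x, y⁆`, `⁅y, z⁆`, `⁅z, x⁆`.
  simp only [jac x y z, jac x y z', jac x y' z, jac x y' z', jac x' y z, jac x' y z', jac x' y' z,
    jac x' y' z', sk x z, sk x z', sk x' z, sk x' z', sk y x, sk y x', sk y' x, sk y' x',
    sk z y, sk z y', sk z' y, sk z' y', wedge4_neg₃, wedge4_neg₄, wedge4_add₃,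
    wedge4_add₄]
  simp only [wedge4_eq_signed]
  -- These are permutation rules, which `simp` applies only when the term order decreases: the four
  -- factors get sorted, and the sign is recorded in the last two arguments.
  simp only [signedWedge4_swap₁, signedWedge4_swap₂, signedWedge4_swap₃]
  simp only [signedWedge4_flip, ← wedge4_eq_signed]
  abel

variable (g) in
/-- The bilinear map `(a ⊗ b, s) ↦ a ∧ b ∧ s`. -/
def wedgeTwoTwo : g ⊗[ℂ] g →ₗ[ℂ] g ⊗[ℂ] g →ₗ[ℂ] g ⊗[ℂ] (g ⊗[ℂ] (g ⊗[ℂ] g)) :=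
  TensorProduct.curry (alt4 g ∘ₗ (alt g).lTensor g ∘ₗ (TensorProduct.assoc ℂ g g _).toLinearMap)

theorem wedgeTwoTwo_tmul (x y : g) (s : g ⊗[ℂ] g) :
    wedgeTwoTwo g (x ⊗ₜ y) s = alt4 g (x ⊗ₜ alt g (y ⊗ₜ s)) := rfl

/-- Both terms of `x ⊗ y - y ⊗ x` contribute equally; this `2` is compensated by the factor `1 / 2`
in `brTwoThree_alt`. -/
theorem wedgeTwoTwo_wedge (x y u v : g) :
    wedgeTwoTwo g (alt2 g (x ⊗ₜ y)) (alt2 g (u ⊗ₜ v)) = (2 : ℂ) • wedge4 x y u v := by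
  rw [alt2_tmul x y, map_sub, LinearMap.sub_apply, wedgeTwoTwo_tmul, wedgeTwoTwo_tmul,
    ← wedge4_eq, ← wedge4_eq, wedge4_swap₁ x y, sub_neg_eq_add, two_smul]

theorem wedgeTwoTwo_comm {r s : g ⊗[ℂ] g} (hr : flip21 g r = -r) (hs : flip21 g s = -s) :
    wedgeTwoTwo g r s = wedgeTwoTwo g s r := by
  refine skew_induction hr (fun r r' h h' => ?_) fun x x' => ?_
  · simp only [map_add, LinearMap.add_apply, h, h']
  refine skew_induction hs (fun r r' h h' => ?_) fun y y' => ?_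
  · simp only [map_add, LinearMap.add_apply, h, h']
  rw [wedgeTwoTwo_wedge, wedgeTwoTwo_wedge, wedge4_swap₂, wedge4_swap₁, wedge4_swap₃, wedge4_swap₂]
  simp

/-- The pointwise form of the compatibility of `d` with the bracket, for `x = xᵢ` and `s = ∂ᵢρ`. The
defect `⁅x, r⁆ ∧ s` does not vanish by itself; its sum over `i` does when `ρ` is equivariant
(`sum_wedgeTwoTwo_lie`). -/
theorem brTwoThree_alt (x : g) {r s : g ⊗[ℂ] g} (hr : flip21 g r = -r) (hs : flip21 g s = -s) :
    brTwoThree g r (alt g (x ⊗ₜ s)) + alt4 g (x ⊗ₜ (cybBilin g r s + cybBilin g s r)) +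
      (1 / 2 : ℂ) • wedgeTwoTwo g ⁅x, r⁆ s = 0 := by
  refine skew_induction hr (fun r r' h h' => ?_) fun y y' => ?_
  · have := congrArg₂ (· + ·) h h'
    simp only [map_add, LinearMap.add_apply, add_zero, tmul_add, lie_add, smul_add] at this ⊢
    rw [← this]; abel
  refine skew_induction hs (fun r r' h h' => ?_) fun z z' => ?_
  · have := congrArg₂ (· + ·) h h'
    simp only [map_add, LinearMap.add_apply, add_zero, tmul_add, smul_add] at this ⊢
    rw [← this]; abel
  have sk : ∀ p q : g, ⁅p, q⁆ = -⁅q, p⁆ := fun p q => (lie_skew p q).symm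
  change brTwoThree g _ (wedge3 x z z') + _ + _ = 0
  rw [brTwoThree_wedge, cybBilin_wedge, ← lie_alt2, lie_tmul_right, map_add, map_add,
    LinearMap.add_apply, wedgeTwoTwo_wedge, wedgeTwoTwo_wedge, ← smul_add, smul_smul]
  norm_num only [one_smul, tmul_add, tmul_sub, map_add, map_sub, ← wedge4.eq_1]
  simp only [sk y x, sk y' x, wedge4_neg₂]
  simp only [wedge4_eq_signed]
  simp only [signedWedge4_swap₁, signedWedge4_swap₂, signedWedge4_swap₃]
  simp only [signedWedge4_flip, ← wedge4_eq_signed]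
  abel

theorem brTwoThree_invariant (r : g ⊗[ℂ] g) {Z : g ⊗[ℂ] (g ⊗[ℂ] g)} (hZ : ∀ y : g, ⁅y, Z⁆ = 0) :
    brTwoThree g r Z = 0 := by
  induction r with
  | zero => simp
  | add r s hr hs => simp [hr, hs]
  | tmul x y => simp [brTwoThree_tmul, hZ]

/-! #### Invariant symmetric tensors -/

section Invariant

variable {Ω : g ⊗[ℂ] g}

/-- For `s = u ⊗ v` the sum is `[Ω¹², u¹ + u²]` with `v` in the third place, that is, minus the
action of `u` on `Ω`. -/
theorem br_invariant_left (hinv : ∀ y : g, ⁅y, Ω⁆ = 0) (s : g ⊗[ℂ] g) :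
    br1213 g (Ω ⊗ₜ s) + br1223 g (Ω ⊗ₜ s) = 0 := by
  induction s with
  | zero => simp
  | add s s' h h' =>
    simp only [tmul_add, map_add]
    rw [add_add_add_comm, h, h', add_zero]
  | tmul u v =>
    have key : ∀ r : g ⊗[ℂ] g, br1213 g (r ⊗ₜ (u ⊗ₜ v)) + br1223 g (r ⊗ₜ (u ⊗ₜ v)) =
        -TensorProduct.assoc ℂ g g g (⁅u, r⁆ ⊗ₜ v) := fun r => by
      induction r with
      | zero => simp
      | add s s' h h' =>
        simp only [add_tmul, map_add, lie_add]
        rw [add_add_add_comm, h, h', neg_add]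
      | tmul x y =>
        change ⁅x, u⁆ ⊗ₜ (y ⊗ₜ v) + x ⊗ₜ (⁅y, u⁆ ⊗ₜ v) = _
        rw [lie_tmul_right, add_tmul, map_add, assoc_tmul, assoc_tmul, ← lie_skew x, ← lie_skew y,
          neg_tmul, neg_tmul, tmul_neg]
        abel
    rw [key, hinv, zero_tmul, map_zero, neg_zero]

theorem br_invariant_right (hinv : ∀ y : g, ⁅y, Ω⁆ = 0) (s : g ⊗[ℂ] g) :
    br1223 g (s ⊗ₜ Ω) + br1323 g (s ⊗ₜ Ω) = 0 := by
  induction s with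
  | zero => simp
  | add s s' h h' =>
    simp only [add_tmul, map_add]
    rw [add_add_add_comm, h, h', add_zero]
  | tmul x y =>
    have key : ∀ r : g ⊗[ℂ] g, br1223 g ((x ⊗ₜ y) ⊗ₜ r) + br1323 g ((x ⊗ₜ y) ⊗ₜ r) =
        x ⊗ₜ ⁅y, r⁆ := fun r => by
      induction r with
      | zero => simp
      | add s s' h h' =>
        simp only [tmul_add, map_add, lie_add]
        rw [add_add_add_comm, h, h']
      | tmul u v =>
        rw [lie_tmul_right, tmul_add]
        rfl
    rw [key, hinv, tmul_zero]

/-- Skewness gives `[s¹², Ω¹³] = [Ω¹³, s²¹]`; the sum is then `[Ω¹³, s²¹ + s²³]`, where the factor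
in the second place is a spectator and invariance applies to places one and three. -/
theorem br_invariant_outer (hinv : ∀ y : g, ⁅y, Ω⁆ = 0) {s : g ⊗[ℂ] g} (hs : flip21 g s = -s) :
    br1323 g (Ω ⊗ₜ s) + br1213 g (s ⊗ₜ Ω) = 0 := by
  refine skew_induction hs (fun s s' h h' => ?_) fun u v => ?_
  · simp only [tmul_add, add_tmul, map_add]
    rw [add_add_add_comm, h, h', add_zero]
  · have key : ∀ r : g ⊗[ℂ] g, br1323 g (r ⊗ₜ alt2 g (u ⊗ₜ v)) + br1213 g (alt2 g (u ⊗ₜ v) ⊗ₜ r) =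
        TensorProduct.leftComm ℂ g g g (v ⊗ₜ ⁅u, r⁆) -
          TensorProduct.leftComm ℂ g g g (u ⊗ₜ ⁅v, r⁆) := fun r => by
      induction r with
      | zero => simp
      | add s s' h h' =>
        simp only [tmul_add, add_tmul, map_add, lie_add] at h h' ⊢
        rw [add_add_add_comm, h, h']
        abel
      | tmul x y =>
        rw [alt2_tmul, tmul_sub, sub_tmul, map_sub, map_sub]
        change x ⊗ₜ (u ⊗ₜ ⁅y, v⁆) - x ⊗ₜ (v ⊗ₜ ⁅y, u⁆) +
          (⁅u, x⁆ ⊗ₜ (v ⊗ₜ y) - ⁅v, x⁆ ⊗ₜ (u ⊗ₜ y)) = _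
        simp only [lie_tmul_right, tmul_add, map_add, leftComm_tmul]
        rw [← lie_skew y u, ← lie_skew y v]
        simp only [tmul_neg]
        abel
    rw [key, hinv, hinv, tmul_zero, tmul_zero, map_zero, sub_zero]

/-- The six mixed brackets cancel in three pairs. This is what decouples the symmetric part `Ω/2`
from the equation. -/
theorem cybBilin_invariant (hinv : ∀ y : g, ⁅y, Ω⁆ = 0) {s : g ⊗[ℂ] g} (hs : flip21 g s = -s) :
    cybBilin g Ω s + cybBilin g s Ω = 0 := by
  change br1213 g (Ω ⊗ₜ s) + br1223 g (Ω ⊗ₜ s) + br1323 g (Ω ⊗ₜ s) +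
    (br1213 g (s ⊗ₜ Ω) + br1223 g (s ⊗ₜ Ω) + br1323 g (s ⊗ₜ Ω)) = 0
  rw [br_invariant_left hinv, zero_add, add_assoc (br1213 g _), br_invariant_right hinv, add_zero,
    br_invariant_outer hinv hs]

theorem perm213_br1323 (r s : g ⊗[ℂ] g) :
    perm213 g (br1323 g (r ⊗ₜ s)) = -br1323 g (s ⊗ₜ r) := by
  induction r with
  | zero => simp
  | add r r' h h' => simp only [add_tmul, tmul_add, map_add, h, h', neg_add]
  | tmul x y =>
    induction s with
    | zero => simp
    | add r r' h h' => simp only [add_tmul, tmul_add, map_add, h, h', neg_add]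
    | tmul u v =>
      change u ⊗ₜ (x ⊗ₜ ⁅y, v⁆) = -(u ⊗ₜ (x ⊗ₜ ⁅v, y⁆))
      rw [← lie_skew y v, tmul_neg, tmul_neg]

theorem perm312_br1323 (r s : g ⊗[ℂ] g) :
    perm312 g (br1323 g (r ⊗ₜ s)) = -br1223 g (s ⊗ₜ flip21 g r) := by
  induction r with
  | zero => simp
  | add r r' h h' => simp only [add_tmul, tmul_add, map_add, h, h', neg_add]
  | tmul x y =>
    induction s with
    | zero => simp
    | add r r' h h' => simp only [add_tmul, tmul_add, map_add, h, h', neg_add]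
    | tmul u v =>
      change u ⊗ₜ (⁅y, v⁆ ⊗ₜ x) = -(u ⊗ₜ (⁅v, y⁆ ⊗ₜ x))
      rw [← lie_skew y v, neg_tmul, tmul_neg]

/-- Invariance leaves the single term `[Ω¹³, Ω²³]`, whose behaviour under the two generating
permutations is visible. -/
theorem isSkew3_CYB_invariant (hinv : ∀ y : g, ⁅y, Ω⁆ = 0) (hsymm : flip21 g Ω = Ω) :
    IsSkew3 (CYB Ω) := by
  have e : CYB Ω = br1323 g (Ω ⊗ₜ Ω) := by
    change br1213 g (Ω ⊗ₜ Ω) + br1223 g (Ω ⊗ₜ Ω) + br1323 g (Ω ⊗ₜ Ω) = _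
    rw [br_invariant_left hinv, zero_add]
  refine ⟨by rw [e, perm213_br1323], ?_⟩
  rw [e, perm312_br1323, hsymm, neg_eq_iff_add_eq_zero, br_invariant_right hinv]

theorem lie_CYB_invariant (hinv : ∀ y : g, ⁅y, Ω⁆ = 0) (x : g) : ⁅x, CYB Ω⁆ = 0 := by
  rw [CYB, lie_cybBilin, hinv]
  simp

theorem CYB_invariant_add (hinv : ∀ y : g, ⁅y, Ω⁆ = 0) {s : g ⊗[ℂ] g} (hs : flip21 g s = -s) :
    CYB (Ω + s) = CYB Ω + CYB s := by
  have := cybBilin_invariant hinv hs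
  simp only [CYB, map_add, LinearMap.add_apply]
  rw [← add_zero (cybBilin g Ω Ω + cybBilin g s s), ← this]
  abel

end Invariant

end SkewTensors


/-! ### The action of a formal map to `g` and its exponential -/

section Action

variable {n : ℕ} {g : Type*} [LieRing g] [LieAlgebra ℂ g] {l : LieSubalgebra ℂ g}
  {b : Module.Basis (Fin n) ℂ l}
  {V W U : Type*} [AddCommGroup V] [Module ℂ V] [LieRingModule g V] [LieModule ℂ g V]
  [AddCommGroup W] [Module ℂ W] [LieRingModule g W] [LieModule ℂ g W]
  [AddCommGroup U] [Module ℂ U] [LieRingModule g U] [LieModule ℂ g U]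

/-- `actBy χ` as a linear map. -/
def actL (χ : FormalMap n g) : Module.End ℂ (FormalMap n V) :=
  bilinL (LieModule.toEnd ℂ g V : g →ₗ[ℂ] Module.End ℂ V) χ

theorem actBy_eq (χ : FormalMap n g) (f : FormalMap n V) : actBy χ f = actL χ f := rfl

theorem iterate_actBy (χ : FormalMap n g) (k : ℕ) (f : FormalMap n V) :
    (actBy χ)^[k] f = (actL χ ^ k) f := (Module.End.pow_apply (actL χ) k f).symm

theorem actL_bilin {B : V →ₗ[ℂ] W →ₗ[ℂ] U}
    (hB : ∀ (y : g) (v : V) (w : W), ⁅y, B v w⁆ = B ⁅y, v⁆ w + B v ⁅y, w⁆)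
    (χ : FormalMap n g) (f : FormalMap n V) (h : FormalMap n W) :
    actL χ (bilin B f h) = bilin B (actL χ f) h + bilin B f (actL χ h) := by
  simp only [← actBy_eq, actBy]
  rw [bilin_bilin_right, bilin_bilin_left, bilin_bilin_right, trilin_swap_left _ f χ h, trilin_add]
  exact trilin_congr fun p q s => hB _ _ _

theorem actL_mapVal {L : V →ₗ[ℂ] W} (hL : ∀ (y : g) (v : V), L ⁅y, v⁆ = ⁅y, L v⁆)
    (χ : FormalMap n g) (f : FormalMap n V) :
    actL χ (mapVal L f) = mapVal L (actL χ f) := by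
  simp only [← actBy_eq, actBy]
  rw [mapVal_bilin, bilin_mapVal_right]
  exact bilin_congr_of fun p q => (hL _ _).symm

theorem actL_mulX (χ : FormalMap n g) (i : Fin n) (f : FormalMap n V) :
    actL χ (mulX i f) = mulX i (actL χ f) := bilin_mulX_right _ _ _ _

theorem actL_smulSeries (χ : FormalMap n g) (y : l) (f : FormalMap n V) :
    actL χ (smulSeries (linForm b y) f) = smulSeries (linForm b y) (actL χ f) := by
  simp only [smulSeries_linForm, map_sum, map_smul, actL_mulX]

theorem actL_constMap {v : V} (hv : ∀ y : g, ⁅y, v⁆ = 0) (χ : FormalMap n g) :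
    actL χ (constMap n v) = 0 := by
  rw [← actBy_eq, actBy, bilin_constMap_right]
  funext d
  exact hv _

theorem pderiv_actL (i : Fin n) (χ : FormalMap n g) (f : FormalMap n V) :
    pderiv i (actL χ f) = actL (pderiv i χ) f + actL χ (pderiv i f) := pderiv_bilin _ _ _ _

/-- Equivariance of `χ` turns its bracket with the constants `xᵢ` into derivatives with coefficients
`λ([xᵢ, xⱼ])`. This is the origin of `τ`. -/
theorem actL_basis {χ : FormalMap n g} (hχ : IsEquivariant b χ) (i : Fin n) :
    actL χ (constMap n (b i : g)) = ∑ j, smulSeries (linForm b ⁅b i, b j⁆) (pderiv j χ) := by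
  have h := hχ (b i)
  rw [← actBy_eq, actBy, bilin_constMap_right, ← neg_eq_iff_eq_neg.2 h]
  funext d
  exact (lie_skew _ _).symm

theorem OrdGE.actL {p q : ℕ} {χ : FormalMap n g} (hχ : OrdGE q χ) {f : FormalMap n V}
    (hf : OrdGE p f) : OrdGE (q + p) (actL χ f) := hχ.bilin hf _

/-- Because `χ(0) = 0`, each application of `ad χ` raises the order, so every power series in `ad χ`
converges. -/
theorem OrdGE.actL_pow {p : ℕ} {χ : FormalMap n g} (hχ : OrdGE 1 χ) {f : FormalMap n V}
    (hf : OrdGE p f) (k : ℕ) : OrdGE (k + p) ((DynRMat.actL χ ^ k) f) := by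
  induction k with
  | zero => simpa using hf
  | succ k ih =>
    rw [pow_succ', Module.End.mul_apply]
    exact (hχ.actL ih).mono (by omega)

theorem IsEquivariant.actL {χ : FormalMap n g} (hχ : IsEquivariant b χ) {f : FormalMap n V}
    (hf : IsEquivariant b f) : IsEquivariant b (actL χ f) :=
  IsEquivariant.bilin (fun y v w => leibniz_lie (y : g) v w) hχ hf

theorem IsEquivariant.actL_pow {χ : FormalMap n g} (hχ : IsEquivariant b χ) {f : FormalMap n V}
    (hf : IsEquivariant b f) (k : ℕ) : IsEquivariant b ((DynRMat.actL χ ^ k) f) := by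
  induction k with
  | zero => simpa using hf
  | succ k ih => rw [pow_succ', Module.End.mul_apply]; exact hχ.actL ih

theorem seriesAct_apply (c : ℕ → ℂ) {χ : FormalMap n g} (hχ : OrdGE 1 χ) (f : FormalMap n V)
    {d : Fin n →₀ ℕ} {N : ℕ} (hN : d.degree < N) :
    seriesAct c χ f d = ∑ k ∈ Finset.range N, c k • (actL χ ^ k) f d := by
  simp only [seriesAct, iterate_actBy]
  refine Finset.sum_subset (fun k hk => ?_) fun k _ hk => ?_
  · simp at hk ⊢; omega
  · rw [hχ.actL_pow (ordGE_zero f) k d (by simp at hk; omega), smul_zero]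

theorem ordGE_seriesAct_sub (c : ℕ → ℂ) {χ : FormalMap n g} (hχ : OrdGE 1 χ)
    (f : FormalMap n V) (N : ℕ) :
    OrdGE N (seriesAct c χ f - ∑ k ∈ Finset.range N, c k • (actL χ ^ k) f) := fun d hd => by
  rw [Pi.sub_apply, seriesAct_apply c hχ f hd]
  simp [Finset.sum_apply]

theorem seriesAct_add (c : ℕ → ℂ) (χ : FormalMap n g) (f h : FormalMap n V) :
    seriesAct c χ (f + h) = seriesAct c χ f + seriesAct c χ h := funext fun d => by
  simp [seriesAct, iterate_actBy, Finset.sum_add_distrib]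

theorem seriesAct_neg (c : ℕ → ℂ) (χ : FormalMap n g) (f : FormalMap n V) :
    seriesAct c χ (-f) = -seriesAct c χ f := funext fun d => by
  simp [seriesAct, iterate_actBy]

theorem seriesAct_sub (c : ℕ → ℂ) (χ : FormalMap n g) (f h : FormalMap n V) :
    seriesAct c χ (f - h) = seriesAct c χ f - seriesAct c χ h := by
  rw [sub_eq_add_neg, seriesAct_add, seriesAct_neg, sub_eq_add_neg]

theorem expAct_constMap {v : V} (hv : ∀ y : g, ⁅y, v⁆ = 0) (χ : FormalMap n g) :
    expAct χ (constMap n v) = constMap n v := funext fun d => by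
  simp only [expAct, seriesAct, iterate_actBy]
  rw [Finset.sum_range_succ', Finset.sum_eq_zero]
  · simp
  · intro k _
    rw [pow_succ, Module.End.mul_apply, actL_constMap hv, map_zero]
    simp

theorem IsEquivariant.seriesAct (c : ℕ → ℂ) {χ : FormalMap n g} (h1 : OrdGE 1 χ)
    (hχ : IsEquivariant b χ) {f : FormalMap n V} (hf : IsEquivariant b f) :
    IsEquivariant b (seriesAct c χ f) :=
  isEquivariant_of_degree fun p =>
    ⟨_, IsEquivariant.sum fun k _ => (hχ.actL_pow hf k).smul (c k), ordGE_seriesAct_sub c h1 f p⟩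

/-- The square of indices and the triangle `p + q < N` differ only by terms that vanish. -/
theorem sum_range_sum_range_eq_antidiagonal {M : Type*} [AddCommMonoid M] (F : ℕ → ℕ → M) (N : ℕ)
    (hF : ∀ p q, N ≤ p + q → F p q = 0) :
    ∑ p ∈ Finset.range N, ∑ q ∈ Finset.range N, F p q =
      ∑ k ∈ Finset.range N, ∑ x ∈ Finset.HasAntidiagonal.antidiagonal k, F x.1 x.2 := by
  rw [← Finset.sum_product', Finset.sum_sigma']
  symm
  refine Finset.sum_of_injOn (fun x => x.2) ?_ ?_ ?_ ?_
  · rintro ⟨k, p, q⟩ h ⟨k', p', q'⟩ h' e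
    simp only [Finset.coe_sigma, Set.mem_sigma_iff, Finset.mem_coe,
      Finset.HasAntidiagonal.mem_antidiagonal, Prod.mk.injEq] at h h' e
    obtain ⟨rfl, rfl⟩ := e
    obtain rfl := h.2
    obtain rfl := h'.2
    rfl
  · rintro ⟨k, p, q⟩ h
    simp at h ⊢
    omega
  · rintro ⟨p, q⟩ h hn
    refine hF p q (not_lt.1 fun hlt => hn ⟨⟨p + q, p, q⟩, ?_, rfl⟩)
    simpa using hlt
  · intro x _; rfl

theorem ordGE_sum_sub_antidiagonal {V : Type*} [AddCommGroup V] [Module ℂ V]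
    (F : ℕ → ℕ → FormalMap n V) (M N : ℕ)
    (hF : ∀ p q, M ≤ p + q → OrdGE N (F p q)) :
    OrdGE N (∑ p ∈ Finset.range M, ∑ q ∈ Finset.range M, F p q -
      ∑ k ∈ Finset.range M, ∑ x ∈ Finset.HasAntidiagonal.antidiagonal k, F x.1 x.2) :=
  fun d hd => by
    rw [Pi.sub_apply, sub_eq_zero]
    simp only [Finset.sum_apply]
    exact sum_range_sum_range_eq_antidiagonal (fun p q => F p q d) M fun p q h => hF p q h d hd

/-- Composition multiplies the generating functions. Truncation at `N` suffices, since the neglected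
powers have order at least `N`. -/
theorem seriesAct_seriesAct (c c' : ℕ → ℂ) {χ : FormalMap n g} (hχ : OrdGE 1 χ)
    (f : FormalMap n V) : seriesAct c χ (seriesAct c' χ f) =
      seriesAct (fun k => ∑ x ∈ Finset.HasAntidiagonal.antidiagonal k, c x.1 * c' x.2) χ f := by
  apply eq_of_forall_ordGE
  intro N
  have h1 := ordGE_seriesAct_sub c hχ (seriesAct c' χ f) N
  have h2 : OrdGE N (∑ k ∈ Finset.range N, c k • (actL χ ^ k)
      (seriesAct c' χ f - ∑ k ∈ Finset.range N, c' k • (actL χ ^ k) f)) :=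
    OrdGE.sum fun k _ => ((hχ.actL_pow (ordGE_seriesAct_sub c' hχ f N) k).mono
      (Nat.le_add_left _ _)).smul _
  have h3 := ordGE_sum_sub_antidiagonal
    (fun p q => (c p * c' q) • (actL χ ^ (p + q)) f) N N fun p q h =>
      OrdGE.smul ((hχ.actL_pow (ordGE_zero f) _).mono h) _
  have h4 := ordGE_seriesAct_sub
    (fun k => ∑ x ∈ Finset.HasAntidiagonal.antidiagonal k, c x.1 * c' x.2) hχ f N
  convert ((h1.add h2).add h3).sub h4 using 1
  have e1 : ∑ p ∈ Finset.range N, ∑ q ∈ Finset.range N, (c p * c' q) • (actL χ ^ (p + q)) f =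
      ∑ k ∈ Finset.range N, c k • (actL χ ^ k) (∑ k ∈ Finset.range N, c' k • (actL χ ^ k) f) := by
    refine Finset.sum_congr rfl fun p _ => ?_
    simp only [map_sum, map_smul, Finset.smul_sum, smul_smul, pow_add, Module.End.mul_apply]
  have e2 : ∑ k ∈ Finset.range N, ∑ x ∈ Finset.HasAntidiagonal.antidiagonal k,
      (c x.1 * c' x.2) • (actL χ ^ (x.1 + x.2)) f = ∑ k ∈ Finset.range N,
        (∑ x ∈ Finset.HasAntidiagonal.antidiagonal k, c x.1 * c' x.2) • (actL χ ^ k) f := by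
    refine Finset.sum_congr rfl fun k _ => ?_
    rw [Finset.sum_smul]
    refine Finset.sum_congr rfl fun x hx => ?_
    rw [Finset.HasAntidiagonal.mem_antidiagonal.1 hx]
  rw [e1, e2]
  simp only [map_sub, smul_sub, Finset.sum_sub_distrib]
  abel

/-- Coefficientwise form of `eᵗ · (1 - e⁻ᵗ)/t = (eᵗ - 1)/t`, reduced to the vanishing of the
alternating sum of binomial coefficients. -/
theorem sum_antidiagonal_inv_factorial (k : ℕ) :
    ∑ x ∈ Finset.HasAntidiagonal.antidiagonal k,
      1 / (x.1.factorial : ℂ) * ((-1) ^ x.2 / ((x.2 + 1).factorial : ℂ)) =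
        1 / ((k + 1).factorial : ℂ) := by
  have h := Int.alternating_sum_range_choose_of_ne (Nat.succ_ne_zero k)
  rw [Finset.sum_range_succ'] at h
  have h' : ∑ q ∈ Finset.range (k + 1), (-1 : ℂ) ^ q * ((k + 1).choose (q + 1) : ℂ) = 1 := by
    have := congrArg (fun z : ℤ => (z : ℂ)) h
    push_cast at this
    simp only [pow_succ, mul_neg, mul_one, neg_mul, Finset.sum_neg_distrib,
      Nat.choose_zero_right, Nat.cast_one] at this
    linear_combination -this
  rw [Finset.Nat.sum_antidiagonal_eq_sum_range_succ
    (fun p q => 1 / (p.factorial : ℂ) * ((-1) ^ q / ((q + 1).factorial : ℂ))),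
    ← Finset.sum_range_reflect]
  rw [show (1 : ℂ) / ((k + 1).factorial : ℂ) = (∑ q ∈ Finset.range (k + 1),
    (-1 : ℂ) ^ q * ((k + 1).choose (q + 1) : ℂ)) / ((k + 1).factorial : ℂ) by rw [h'],
    Finset.sum_div]
  refine Finset.sum_congr rfl fun q hq => ?_
  have hq' : q ≤ k := by simp at hq; omega
  have e : k + 1 - 1 - q = k - q := by omega
  have e2 : k - (k - q) = q := by omega
  rw [e, e2]
  have hc := Nat.choose_mul_factorial_mul_factorial (Nat.succ_le_succ hq')
  rw [Nat.succ_sub_succ] at hc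
  have hc' : ((k + 1).choose (q + 1) : ℂ) * ((q + 1).factorial : ℂ) * ((k - q).factorial : ℂ) =
    ((k + 1).factorial : ℂ) := by exact_mod_cast hc
  have n1 : ((q + 1).factorial : ℂ) ≠ 0 := by exact_mod_cast Nat.factorial_ne_zero _
  have n2 : ((k - q).factorial : ℂ) ≠ 0 := by exact_mod_cast Nat.factorial_ne_zero _
  have n3 : ((k + 1).factorial : ℂ) ≠ 0 := by exact_mod_cast Nat.factorial_ne_zero _
  field_simp
  rw [← hc']
  ring

end Action


/-! ### Gauge transformations and the Maurer-Cartan form of the dynamical Yang-Baxter equation -/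

section GaugeMC

variable {n : ℕ} {g : Type*} [LieRing g] [LieAlgebra ℂ g] {l : LieSubalgebra ℂ g}
  (b : Module.Basis (Fin n) ℂ l)

open TensorProduct TensorProduct.LieModule

/-- The differential `∑ᵢ xᵢ ∧ ∂ᵢχ` of a function `χ : D → g`. -/
def dOne (χ : FormalMap n g) : FormalMap n (g ⊗[ℂ] g) := mapVal (alt2 g) (gradBar b χ)

/-- The differential `Alt(dr)` of a function `r : D → g ⊗ g`. -/
def dTwo (r : FormalMap n (g ⊗[ℂ] g)) : FormalMap n (g ⊗[ℂ] (g ⊗[ℂ] g)) :=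
  mapVal (alt g) (gradBar b r)

/-- Skew-symmetry of a function `D → g ⊗ g`. -/
def IsSkew2 (r : FormalMap n (g ⊗[ℂ] g)) : Prop := ∀ d, flip21 g (r d) = -r d

theorem IsSkew2.smul {r : FormalMap n (g ⊗[ℂ] g)} (hr : IsSkew2 r) (c : ℂ) :
    IsSkew2 (c • r) := fun d => by simp only [Pi.smul_apply, map_smul, hr d, smul_neg]

theorem IsSkew2.sub {r s : FormalMap n (g ⊗[ℂ] g)} (hr : IsSkew2 r) (hs : IsSkew2 s) :
    IsSkew2 (r - s) := fun d => by simp only [Pi.sub_apply, map_sub, hr d, hs d]; abel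

theorem isSkew2_iff {r : FormalMap n (g ⊗[ℂ] g)} : IsSkew2 r ↔ mapVal (flip21 g) r = -r :=
  funext_iff.symm

theorem isSkew2_dOne (χ : FormalMap n g) : IsSkew2 (dOne b χ) := fun _ => flip21_alt2 _

theorem IsSkew2.actL {r : FormalMap n (g ⊗[ℂ] g)} (hr : IsSkew2 r) (χ : FormalMap n g) :
    IsSkew2 (actL χ r) := by
  rw [isSkew2_iff] at *
  rw [← actL_mapVal lie_flip21, hr, map_neg]

theorem IsSkew2.pderiv {r : FormalMap n (g ⊗[ℂ] g)} (hr : IsSkew2 r) (i : Fin n) :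
    IsSkew2 (pderiv i r) := fun d => by simp only [DynRMat.pderiv, map_smul, hr _, smul_neg]

theorem dOne_sub (χ ψ : FormalMap n g) : dOne b (χ - ψ) = dOne b χ - dOne b ψ := by
  rw [dOne, gradBar_sub, mapVal_sub]; rfl

theorem dTwo_add (r s : FormalMap n (g ⊗[ℂ] g)) : dTwo b (r + s) = dTwo b r + dTwo b s := by
  rw [dTwo, gradBar_add, mapVal_add]; rfl

theorem dTwo_sub (r s : FormalMap n (g ⊗[ℂ] g)) : dTwo b (r - s) = dTwo b r - dTwo b s := by
  rw [dTwo, gradBar_sub, mapVal_sub]; rfl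

theorem dTwo_constMap (v : g ⊗[ℂ] g) : dTwo b (constMap n v) = 0 := by
  rw [dTwo, gradBar_constMap, mapVal_zero]

theorem dTwo_smul (c : ℂ) (r : FormalMap n (g ⊗[ℂ] g)) : dTwo b (c • r) = c • dTwo b r := by
  rw [dTwo, show gradBar b (c • r) = c • gradBar b r from map_smul (gradBarL b) c r, mapVal_smul]
  rfl

theorem dTwo_sum {ι : Type*} (s : Finset ι) (r : ι → FormalMap n (g ⊗[ℂ] g)) :
    dTwo b (∑ i ∈ s, r i) = ∑ i ∈ s, dTwo b (r i) := by
  rw [dTwo, show gradBar b (∑ i ∈ s, r i) = ∑ i ∈ s, gradBar b (r i) from map_sum (gradBarL b) r s,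
    mapVal_sum]
  rfl

theorem OrdGE.dOne {p : ℕ} {χ : FormalMap n g} (h : OrdGE (p + 1) χ) : OrdGE p (dOne b χ) :=
  (h.gradBar b).mapVal _

theorem OrdGE.dTwo {p : ℕ} {r : FormalMap n (g ⊗[ℂ] g)} (h : OrdGE (p + 1) r) :
    OrdGE p (dTwo b r) := (h.gradBar b).mapVal _

variable {b}

theorem IsEquivariant.dOne {χ : FormalMap n g} (h : IsEquivariant b χ) :
    IsEquivariant b (dOne b χ) := h.gradBar.mapVal fun _ _ => lie_alt2 _ _

theorem IsEquivariant.dTwo {r : FormalMap n (g ⊗[ℂ] g)} (h : IsEquivariant b r) :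
    IsEquivariant b (dTwo b r) := h.gradBar.mapVal fun _ _ => lie_alt _ _

variable (b)

/-- Second derivatives are symmetric and the wedge of `xᵢ` with `xⱼ` is antisymmetric, so the double
sum equals its negative. -/
theorem dTwo_dOne (χ : FormalMap n g) : dTwo b (dOne b χ) = 0 := by
  have h : dTwo b (dOne b χ) = ∑ i, ∑ j,
      mapVal (alt g ∘ₗ TensorProduct.mk ℂ g _ (b i : g) ∘ₗ alt2 g ∘ₗ
        TensorProduct.mk ℂ g _ (b j : g)) (pderiv i (pderiv j χ)) := by
    simp only [dTwo, dOne, gradBar_eq, mapVal_sum, pderiv_sum, ← mapVal_pderiv, mapVal_mapVal]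
  have h' : dTwo b (dOne b χ) = -dTwo b (dOne b χ) := by
    conv_lhs => rw [h, Finset.sum_comm]
    rw [h]
    simp only [← Finset.sum_neg_distrib]
    refine Finset.sum_congr rfl fun i _ => Finset.sum_congr rfl fun j _ => ?_
    rw [pderiv_comm]
    funext d
    exact alt_alt2_swap (b j : g) (b i : g) _
  have h2 : (2 : ℂ) • dTwo b (dOne b χ) = 0 := by
    rw [two_smul]
    exact eq_neg_iff_add_eq_zero.1 h'
  exact (smul_eq_zero.1 h2).resolve_left two_ne_zero

/-- The derivation rule `d[χ, r] = [χ, dr] + [dχ, r]`. It depends on equivariance, since `ad χ` also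
moves the constants `xᵢ` hidden in `d`. -/
theorem dTwo_actL {χ : FormalMap n g} (hχ : IsEquivariant b χ) {r : FormalMap n (g ⊗[ℂ] g)}
    (hr : IsEquivariant b r) (hs : IsSkew2 r) :
    dTwo b (actL χ r) = actL χ (dTwo b r) + bilin (cybBilin g) (dOne b χ) r +
      bilin (cybBilin g) r (dOne b χ) := by
  have key : gradBar b (actL χ r) - actL χ (gradBar b r) =
      ∑ i, (bilin ((LieModule.toEnd ℂ g (g ⊗[ℂ] g) : g →ₗ[ℂ] _).compr₂
          (TensorProduct.mk ℂ g (g ⊗[ℂ] g) (b i : g))) (pderiv i χ) r -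
        bilin ((TensorProduct.mk ℂ g (g ⊗[ℂ] g)).compl₂ (LieModule.toEnd ℂ g (g ⊗[ℂ] g) (b i : g)))
          (pderiv i χ) r) := by
    have h1 : gradBar b (actL χ r) =
        ∑ i, (bilin ((LieModule.toEnd ℂ g (g ⊗[ℂ] g) : g →ₗ[ℂ] _).compr₂
          (TensorProduct.mk ℂ g (g ⊗[ℂ] g) (b i : g))) (pderiv i χ) r +
          mapVal (TensorProduct.mk ℂ g (g ⊗[ℂ] g) (b i : g)) (actL χ (pderiv i r))) := by
      simp only [gradBar_eq, pderiv_actL, mapVal_add]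
      refine Finset.sum_congr rfl fun i _ => ?_
      rw [← actBy_eq, actBy, mapVal_bilin]
    have h2 : actL χ (gradBar b r) =
        ∑ i, (bilin (TensorProduct.mk ℂ g (g ⊗[ℂ] g)) (coadDer b (b i) χ) (pderiv i r) +
          mapVal (TensorProduct.mk ℂ g (g ⊗[ℂ] g) (b i : g)) (actL χ (pderiv i r))) := by
      rw [gradBar_eq, map_sum]
      refine Finset.sum_congr rfl fun i _ => ?_
      rw [← bilin_constMap_left, ← bilin_constMap_left,
        actL_bilin (fun y v w => lie_tmul_right y v w), actL_basis hχ]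
      simp only [coadDer, smulSeries_linForm]
    -- The terms in which `ad χ` hits `xᵢ` carry the coefficients `λ([xᵢ, xⱼ])`. Antisymmetry in `i,
    -- j` moves these onto `r`, where equivariance of `r` turns them into the action of `xⱼ`.
    have h3 : ∑ i, bilin (TensorProduct.mk ℂ g (g ⊗[ℂ] g)) (coadDer b (b i) χ) (pderiv i r) =
        ∑ i, bilin ((TensorProduct.mk ℂ g (g ⊗[ℂ] g)).compl₂
          (LieModule.toEnd ℂ g (g ⊗[ℂ] g) (b i : g))) (pderiv i χ) r := by
      have : ∀ j, bilin ((TensorProduct.mk ℂ g (g ⊗[ℂ] g)).compl₂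
          (LieModule.toEnd ℂ g (g ⊗[ℂ] g) (b j : g))) (pderiv j χ) r =
          -bilin (TensorProduct.mk ℂ g (g ⊗[ℂ] g)) (pderiv j χ) (coadDer b (b j) r) := fun j => by
        rw [hr.coadDer, bilin_neg_right, neg_neg, bilin_mapVal_right]
      simp only [this, coadDer, bilin_sum_left, bilin_sum_right, bilin_smul_left, bilin_smul_right,
        bilin_mulX_left, bilin_mulX_right, ← Finset.sum_neg_distrib, ← neg_smul]
      rw [Finset.sum_comm]
      refine Finset.sum_congr rfl fun j _ => Finset.sum_congr rfl fun i _ =>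
        Finset.sum_congr rfl fun k _ => ?_
      rw [← lie_skew (b i) (b j), map_neg, Finsupp.neg_apply]
    rw [h1, h2, Finset.sum_add_distrib, Finset.sum_add_distrib, h3, Finset.sum_sub_distrib]
    abel
  have e : dTwo b (actL χ r) - actL χ (dTwo b r) = mapVal (alt g)
      (gradBar b (actL χ r) - actL χ (gradBar b r)) := by
    rw [dTwo, dTwo, actL_mapVal lie_alt, mapVal_sub]
  rw [add_assoc, ← sub_eq_iff_eq_add', e, key, bilin_swap _ r, dOne, gradBar_eq, mapVal_sum,
    mapVal_sum, bilin_sum_left, bilin_sum_left, ← Finset.sum_add_distrib]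
  refine Finset.sum_congr rfl fun i _ => ?_
  funext d
  simp only [mapVal_mapVal, bilin_mapVal_left, mapVal_sub, mapVal_bilin]
  simp only [bilin, Pi.add_apply, Pi.sub_apply, ← Finset.sum_add_distrib, ← Finset.sum_sub_distrib]
  refine Finset.sum_congr rfl fun p _ => ?_
  have := cybBilin_symm_alt2 (b i : g) (pderiv i χ p.1) (hs p.2)
  rw [map_sub] at this
  exact this.symm

/-! #### The gauge action as the exponential of an affine action -/

/-- The coefficients of `(1 - exp(-t)) / t`. -/
def etaCoeff (k : ℕ) : ℂ := (-1) ^ k / ((k + 1).factorial : ℂ)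

theorem etaCoeff_zero : etaCoeff 0 = 1 := by simp [etaCoeff]

theorem etaCoeff_succ (k : ℕ) : ((k : ℂ) + 2) * etaCoeff (k + 1) = -etaCoeff k := by
  have h1 : ((k + 1).factorial : ℂ) ≠ 0 := by exact_mod_cast Nat.factorial_ne_zero _
  have h2 : (k : ℂ) + 2 ≠ 0 := by exact_mod_cast (by omega : k + 2 ≠ 0)
  rw [etaCoeff, etaCoeff, Nat.factorial_succ (k + 1)]
  push_cast
  have h3 : (k : ℂ) + 1 + 1 ≠ 0 := by rw [add_assoc, one_add_one_eq_two]; exact h2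
  field_simp
  ring

/-- The series `(ad χ)ᵏ (∂ᵢχ)`. -/
def adPow (χ : FormalMap n g) (k : ℕ) (i : Fin n) : FormalMap n g := (actL χ ^ k) (pderiv i χ)

theorem actL_adPow (χ : FormalMap n g) (k : ℕ) (i : Fin n) :
    actL χ (adPow χ k i) = adPow χ (k + 1) i := by
  rw [adPow, adPow, pow_succ', Module.End.mul_apply]

/-- The contribution of `(ad χ)ᵖ` and `(ad χ)^q` to `τ`. -/
def tauTerm (χ : FormalMap n g) (p q : ℕ) : FormalMap n (g ⊗[ℂ] g) :=
  ∑ i, ∑ j, smulSeries (linForm b ⁅b i, b j⁆)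
    (bilin (TensorProduct.mk ℂ g g) (adPow χ p i) (adPow χ q j))

theorem actL_tmul {W : Type*} [AddCommGroup W] [Module ℂ W] [LieRingModule g W] [LieModule ℂ g W]
    (χ f : FormalMap n g) (h : FormalMap n W) :
    actL χ (bilin (TensorProduct.mk ℂ g W) f h) =
      bilin (TensorProduct.mk ℂ g W) (actL χ f) h + bilin (TensorProduct.mk ℂ g W) f (actL χ h) :=
  actL_bilin (fun y v w => lie_tmul_right y v w) χ f h

theorem actL_tauTerm (χ : FormalMap n g) (p q : ℕ) :
    actL χ (tauTerm b χ p q) = tauTerm b χ (p + 1) q + tauTerm b χ p (q + 1) := by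
  simp only [tauTerm, map_sum, actL_smulSeries, ← Finset.sum_add_distrib]
  refine Finset.sum_congr rfl fun i _ => Finset.sum_congr rfl fun j _ => ?_
  rw [actL_tmul, actL_adPow, actL_adPow, smulSeries,
    bilin_add_right]
  rfl

/-- The contribution of `(ad χ)ᵏ` to `η - η²¹`. -/
def etaTerm (χ : FormalMap n g) (k : ℕ) : FormalMap n (g ⊗[ℂ] g) :=
  mapVal (alt2 g) (formBar b (adPow χ k))

theorem smulSeries_linForm_lie_swap {V : Type*} [AddCommGroup V] [Module ℂ V] (i j : Fin n)
    (f : FormalMap n V) : smulSeries (linForm b ⁅b j, b i⁆) f =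
      -smulSeries (linForm b ⁅b i, b j⁆) f := by
  rw [smulSeries_linForm, smulSeries_linForm, ← lie_skew, map_neg, ← Finset.sum_neg_distrib]
  simp

/-- On the leg `(ad χ)ᵏ(∂ᵢχ)` the operator `ad χ` raises the power; on the leg `xᵢ` it produces, by
`actL_basis`, terms of the shape of `τ`. -/
theorem actL_etaTerm {χ : FormalMap n g} (hχ : IsEquivariant b χ) (k : ℕ) :
    actL χ (etaTerm b χ k) = etaTerm b χ (k + 1) - (tauTerm b χ 0 k + tauTerm b χ k 0) := by
  have h : actL χ (formBar b (adPow χ k)) = formBar b (adPow χ (k + 1)) - tauTerm b χ 0 k := by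
    simp only [formBar_eq, ← bilin_constMap_left, map_sum, tauTerm, actL_tmul, actL_basis hχ, actL_adPow, Finset.sum_add_distrib]
    rw [add_comm, sub_eq_add_neg]
    congr 1
    simp only [bilin_sum_left, ← Finset.sum_neg_distrib]
    rw [Finset.sum_comm]
    refine Finset.sum_congr rfl fun i _ => Finset.sum_congr rfl fun j _ => ?_
    rw [smulSeries_linForm_lie_swap]
    simp only [smulSeries_linForm, bilin_sum_left, bilin_smul_left, bilin_mulX_left, adPow,
      pow_zero, Module.End.one_apply, bilin_neg_left]
  have h2 : mapVal (flip21 g) (tauTerm b χ 0 k) = -tauTerm b χ k 0 := by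
    simp only [tauTerm, mapVal_sum, ← Finset.sum_neg_distrib]
    rw [Finset.sum_comm]
    refine Finset.sum_congr rfl fun i _ => Finset.sum_congr rfl fun j _ => ?_
    rw [smulSeries_linForm_lie_swap, mapVal_neg]
    simp only [smulSeries_linForm, mapVal_sum, mapVal_smul, mapVal_mulX, mapVal_bilin]
    rw [bilin_swap]
    rfl
  have h3 : mapVal (alt2 g) (tauTerm b χ 0 k) = tauTerm b χ 0 k + tauTerm b χ k 0 := by
    rw [← sub_neg_eq_add, ← h2]
    rfl
  rw [etaTerm, actL_mapVal lie_alt2, h, mapVal_sub, h3]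
  rfl

theorem etaTerm_zero (χ : FormalMap n g) : etaTerm b χ 0 = dOne b χ := rfl

/-- The part of `τ` of degree `k + 1` in `χ`, up to the factors `∂ᵢχ`. -/
def tauSum (χ : FormalMap n g) : ℕ → FormalMap n (g ⊗[ℂ] g)
  | 0 => 0
  | k + 1 => ∑ x ∈ Finset.HasAntidiagonal.antidiagonal k,
      (etaCoeff x.1 * etaCoeff x.2) • tauTerm b χ x.1 x.2

/-- Over `p + q = k` the weight is split as `(p + 1) + (q + 1)`. The recursion for `etaCoeff` lowers
one index of each half, giving `-ad χ` of the previous sum, and the terms `p = 0` and `q = 0` are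
left over. -/
theorem succ_smul_tauSum {χ : FormalMap n g} (k : ℕ) :
    ((k : ℂ) + 2) • tauSum b χ (k + 1) =
      etaCoeff k • (tauTerm b χ 0 k + tauTerm b χ k 0) - actL χ (tauSum b χ k) := by
  have h : ((k : ℂ) + 2) • tauSum b χ (k + 1) =
      ∑ x ∈ Finset.HasAntidiagonal.antidiagonal k,
        (((x.1 : ℂ) + 1) * etaCoeff x.1 * etaCoeff x.2) • tauTerm b χ x.1 x.2 +
      ∑ x ∈ Finset.HasAntidiagonal.antidiagonal k,
        (((x.2 : ℂ) + 1) * etaCoeff x.1 * etaCoeff x.2) • tauTerm b χ x.1 x.2 := by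
    rw [tauSum, Finset.smul_sum, ← Finset.sum_add_distrib]
    refine Finset.sum_congr rfl fun x hx => ?_
    rw [smul_smul, ← add_smul, ← Finset.HasAntidiagonal.mem_antidiagonal.1 hx]
    congr 1
    push_cast
    ring
  rw [h]
  cases k with
  | zero => simp [tauSum, etaCoeff_zero]
  | succ k =>
    rw [Finset.Nat.sum_antidiagonal_succ, Finset.Nat.sum_antidiagonal_succ' (n := k)]
    simp only [Nat.cast_zero, zero_add, one_mul, etaCoeff_zero, mul_one, tauSum, map_sum, map_smul,
      actL_tauTerm, smul_add, Finset.sum_add_distrib, Nat.cast_add, Nat.cast_one]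
    have e1 : ∀ x : ℕ × ℕ, ((x.1 : ℂ) + 1 + 1) * etaCoeff (x.1 + 1) * etaCoeff x.2 =
        -(etaCoeff x.1 * etaCoeff x.2) := fun x => by
      rw [add_assoc, one_add_one_eq_two, etaCoeff_succ]; ring
    have e2 : ∀ x : ℕ × ℕ, ((x.2 : ℂ) + 1 + 1) * etaCoeff x.1 * etaCoeff (x.2 + 1) =
        -(etaCoeff x.1 * etaCoeff x.2) := fun x => by
      rw [add_assoc, one_add_one_eq_two, mul_right_comm, etaCoeff_succ]; ring
    simp only [e1, e2, neg_smul, Finset.sum_neg_distrib]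
    abel

/-- The degree `k` part of `η - η²¹ + τ = ((1 - exp(-ad χ)) / ad χ)(dχ)`. In the induction the
boundary terms of `τ` cancel those that `ad χ` creates from `η - η²¹`. -/
theorem etaTerm_add_tauSum {χ : FormalMap n g} (hχ : IsEquivariant b χ) (k : ℕ) :
    etaCoeff k • etaTerm b χ k + tauSum b χ k = etaCoeff k • (actL χ ^ k) (dOne b χ) := by
  induction k with
  | zero => simp [etaTerm_zero, tauSum]
  | succ k ih =>
    have h2 : (k : ℂ) + 2 ≠ 0 := by exact_mod_cast (by omega : k + 2 ≠ 0)
    have ih' := congrArg (actL χ) ih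
    rw [map_add, map_smul, map_smul, actL_etaTerm b hχ, ← Module.End.mul_apply, ← pow_succ'] at ih'
    refine smul_right_injective _ h2 ?_
    simp only [smul_add, smul_smul, etaCoeff_succ, succ_smul_tauSum]
    rw [neg_smul, neg_smul, ← ih', smul_sub, smul_add]
    abel

theorem formBar_eta_add_tau {χ : FormalMap n g} (h1 : OrdGE 1 χ) (hχ : IsEquivariant b χ) :
    formBar b (eta χ) - mapVal (flip21 g) (formBar b (eta χ)) + tau b χ =
      seriesAct etaCoeff χ (dOne b χ) := by
  apply eq_of_forall_ordGE
  intro N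
  set et : Fin n → FormalMap n g := fun i => ∑ k ∈ Finset.range N, etaCoeff k • adPow χ k i
    with het
  have hη : ∀ i, OrdGE N (eta χ i - et i) := fun i => ordGE_seriesAct_sub _ h1 _ N
  have a1 : OrdGE N (mapVal (alt2 g) (formBar b (eta χ)) -
      ∑ k ∈ Finset.range N, etaCoeff k • etaTerm b χ k) := by
    have : ∑ k ∈ Finset.range N, etaCoeff k • etaTerm b χ k = mapVal (alt2 g) (formBar b et) := by
      simp only [etaTerm, formBar_eq, mapVal_sum, het, mapVal_smul, Finset.smul_sum]
      rw [Finset.sum_comm]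
    rw [this, ← mapVal_sub, formBar_eq, formBar_eq, ← Finset.sum_sub_distrib]
    simp only [← mapVal_sub]
    exact (OrdGE.sum fun i _ => (hη i).mapVal _).mapVal _
  have hs : ∀ (y : l) {p : ℕ} {f : FormalMap n (g ⊗[ℂ] g)}, OrdGE p f →
      OrdGE (p + 1) (smulSeries (linForm b y) f) := fun y p f hf => by
    rw [smulSeries_linForm]
    exact OrdGE.sum fun i _ => (hf.mulX i).smul _
  have a2 : OrdGE N (tau b χ - ∑ p ∈ Finset.range N, ∑ q ∈ Finset.range N,
      (etaCoeff p * etaCoeff q) • tauTerm b χ p q) := by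
    have : ∑ p ∈ Finset.range N, ∑ q ∈ Finset.range N,
        (etaCoeff p * etaCoeff q) • tauTerm b χ p q =
        ∑ i, ∑ j, smulSeries (linForm b ⁅b i, b j⁆)
          (bilin (TensorProduct.mk ℂ g g) (et i) (et j)) := by
      have hij : ∀ i j, smulSeries (linForm b ⁅b i, b j⁆)
          (bilin (TensorProduct.mk ℂ g g) (et i) (et j)) =
          ∑ p ∈ Finset.range N, ∑ q ∈ Finset.range N, (etaCoeff p * etaCoeff q) •
            smulSeries (linForm b ⁅b i, b j⁆)
              (bilin (TensorProduct.mk ℂ g g) (adPow χ p i) (adPow χ q j)) := fun i j => by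
        simp only [het, smulSeries, bilin_sum_left, bilin_sum_right (s := Finset.range N),
          bilin_smul_left, bilin_smul_right, Finset.smul_sum, smul_smul]
        rw [Finset.sum_comm]
        simp only [mul_comm]
      simp only [hij, tauTerm, Finset.smul_sum]
      rw [Finset.sum_congr rfl fun p _ => Finset.sum_comm, Finset.sum_comm]
      refine Finset.sum_congr rfl fun i _ => ?_
      rw [Finset.sum_congr rfl fun p _ => Finset.sum_comm, Finset.sum_comm]
    rw [this, tau, ← Finset.sum_sub_distrib]
    refine OrdGE.sum fun i _ => ?_
    rw [← Finset.sum_sub_distrib]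
    refine OrdGE.sum fun j _ => ?_
    rw [smulSeries, smulSeries, ← bilin_sub_right]
    refine (hs _ (p := N) ?_).mono (Nat.le_succ _)
    have : bilin (TensorProduct.mk ℂ g g) (eta χ i) (eta χ j) -
        bilin (TensorProduct.mk ℂ g g) (et i) (et j) =
        bilin (TensorProduct.mk ℂ g g) (eta χ i - et i) (eta χ j) +
        bilin (TensorProduct.mk ℂ g g) (et i) (eta χ j - et j) := by
      rw [bilin_sub_left, bilin_sub_right]; abel
    rw [this]
    exact ((hη i).bilin (ordGE_zero _) _).add (((ordGE_zero _).bilin (hη j) _).mono (by omega))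
  have a3 := ordGE_sum_sub_antidiagonal
    (fun p q => (etaCoeff p * etaCoeff q) • tauTerm b χ p q) N N fun p q h => by
      refine OrdGE.smul (OrdGE.sum fun i _ => OrdGE.sum fun j _ => ?_) _
      refine OrdGE.mono (hs _ (p := p + q) ?_) (by omega)
      exact (h1.actL_pow (ordGE_zero _) p).bilin (h1.actL_pow (ordGE_zero _) q) _
  have e3 : ∑ k ∈ Finset.range N, ∑ x ∈ Finset.HasAntidiagonal.antidiagonal k,
      (etaCoeff x.1 * etaCoeff x.2) • tauTerm b χ x.1 x.2 =
      ∑ k ∈ Finset.range N, tauSum b χ (k + 1) := rfl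
  -- The index shift costs only `tauSum` at `N`: its factors `ad χ` give order `N - 1`, and the
  -- linear coefficient `λ([xᵢ, xⱼ])` supplies the missing one.
  have a4 : OrdGE N (∑ k ∈ Finset.range N, tauSum b χ (k + 1) -
      ∑ k ∈ Finset.range N, tauSum b χ k) := by
    have : ∑ k ∈ Finset.range N, tauSum b χ (k + 1) - ∑ k ∈ Finset.range N, tauSum b χ k =
        tauSum b χ N := by
      rw [← Finset.sum_sub_distrib, Finset.sum_range_sub]; simp [tauSum]
    rw [this]
    cases N with
    | zero => exact ordGE_zero _
    | succ N =>
      refine OrdGE.sum fun x hx => OrdGE.smul (OrdGE.sum fun i _ => OrdGE.sum fun j _ => ?_) _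
      rw [← Finset.HasAntidiagonal.mem_antidiagonal.1 hx]
      exact hs _ ((h1.actL_pow (ordGE_zero _) _).bilin (h1.actL_pow (ordGE_zero _) _) _)
  have a5 := ordGE_seriesAct_sub etaCoeff h1 (dOne b χ) N
  simp only [← etaTerm_add_tauSum b hχ, Finset.sum_add_distrib] at a5
  rw [e3] at a3
  convert (((a1.add a2).add a3).add a4).sub a5 using 1
  rw [show mapVal (alt2 g) (formBar b (eta χ)) =
    formBar b (eta χ) - mapVal (flip21 g) (formBar b (eta χ)) from rfl]
  abel

/-- The standard gauge action of a Maurer-Cartan theory: multiplying by `exp(ad χ)` turns `(1 -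
e⁻ᵗ)/t` into `(eᵗ - 1)/t`. -/
theorem gauge_eq {χ : FormalMap n g} (hχ : χ ∈ GaugeMaps b) (r : FormalMap n (g ⊗[ℂ] g)) :
    gauge b χ r = expAct χ r - seriesAct (fun k => 1 / ((k + 1).factorial : ℂ)) χ (dOne b χ) := by
  have h1 : OrdGE 1 χ := ordGE_one_iff.2 hχ.1
  have e : r - formBar b (eta χ) + mapVal (flip21 g) (formBar b (eta χ)) - tau b χ =
      r - (formBar b (eta χ) - mapVal (flip21 g) (formBar b (eta χ)) + tau b χ) := by abel
  rw [gauge, e, formBar_eta_add_tau b h1 hχ.2, expAct, seriesAct_sub, seriesAct_seriesAct _ _ h1]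
  congr 2
  funext k
  exact sum_antidiagonal_inv_factorial k

end GaugeMC


/-! ### Gauge transformations preserve dynamical r-matrices -/

section GaugeDynr

variable {n : ℕ} {g : Type*} [LieRing g] [LieAlgebra ℂ g] {l : LieSubalgebra ℂ g}
  (b : Module.Basis (Fin n) ℂ l)

open TensorProduct TensorProduct.LieModule

/-- The left side of the dynamical Yang-Baxter equation. -/
def dynCYB (r : FormalMap n (g ⊗[ℂ] g)) : FormalMap n (g ⊗[ℂ] (g ⊗[ℂ] g)) :=
  dTwo b r + bilin (cybBilin g) r r

/-- The `k`-th term, of degree `k` in `χ`, of the gauge transform of `ρ` by `exp χ`. -/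
def gaugeTerm (χ : FormalMap n g) (ρ : FormalMap n (g ⊗[ℂ] g)) : ℕ → FormalMap n (g ⊗[ℂ] g)
  | 0 => ρ
  | k + 1 => (1 / ((k + 1).factorial : ℂ)) • ((actL χ ^ (k + 1)) ρ - (actL χ ^ k) (dOne b χ))

/-- The terms are the Taylor coefficients of the flow of the affine vector field `ρ ↦ [χ, ρ] - dχ`;
the inhomogeneous part enters only at `k = 0`. -/
theorem actL_gaugeTerm (χ : FormalMap n g) (ρ : FormalMap n (g ⊗[ℂ] g)) (k : ℕ) :
    actL χ (gaugeTerm b χ ρ k) =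
      ((k : ℂ) + 1) • gaugeTerm b χ ρ (k + 1) + if k = 0 then dOne b χ else 0 := by
  cases k with
  | zero => simp [gaugeTerm]
  | succ k =>
    have h : ((k : ℂ) + 1 + 1) * (1 / (((k + 1) + 1).factorial : ℂ)) =
        1 / ((k + 1).factorial : ℂ) := by
      have h1 : ((k + 1).factorial : ℂ) ≠ 0 := by exact_mod_cast Nat.factorial_ne_zero _
      have h2 : (k : ℂ) + 1 + 1 ≠ 0 := by exact_mod_cast (by omega : k + 1 + 1 ≠ 0)
      rw [Nat.factorial_succ (k + 1)]
      push_cast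
      field_simp
    simp only [gaugeTerm, map_smul, map_sub, ← Module.End.mul_apply, ← pow_succ', smul_smul,
      Nat.cast_add, Nat.cast_one, h]
    simp

/-- The order is `k - 1` and not `k` because `dχ` may have a constant term; for `k = 0` the
truncated subtraction gives the trivial bound. -/
theorem ordGE_gaugeTerm {χ : FormalMap n g} (h1 : OrdGE 1 χ) (ρ : FormalMap n (g ⊗[ℂ] g)) (k : ℕ) :
    OrdGE (k - 1) (gaugeTerm b χ ρ k) := by
  cases k with
  | zero => exact ordGE_zero _
  | succ k =>
    exact (((h1.actL_pow (ordGE_zero _) _).mono (by omega)).sub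
      ((h1.actL_pow (ordGE_zero _) _).mono (by omega))).smul _

variable {b}

theorem isSkew2_gaugeTerm {χ : FormalMap n g} {ρ : FormalMap n (g ⊗[ℂ] g)} (hs : IsSkew2 ρ)
    (k : ℕ) : IsSkew2 (gaugeTerm b χ ρ k) := by
  have H : ∀ {r : FormalMap n (g ⊗[ℂ] g)}, IsSkew2 r → ∀ k : ℕ, IsSkew2 ((actL χ ^ k) r) :=
    fun hr k => by
      induction k with
      | zero => simpa using hr
      | succ k ih => rw [pow_succ', Module.End.mul_apply]; exact ih.actL χ
  cases k with
  | zero => exact hs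
  | succ k => exact ((H hs _).sub (H (isSkew2_dOne b χ) _)).smul _

theorem isEquivariant_gaugeTerm {χ : FormalMap n g} (hχ : IsEquivariant b χ)
    {ρ : FormalMap n (g ⊗[ℂ] g)} (hρ : IsEquivariant b ρ) (k : ℕ) :
    IsEquivariant b (gaugeTerm b χ ρ k) := by
  cases k with
  | zero => exact hρ
  | succ k => exact ((hχ.actL_pow hρ _).sub (hχ.actL_pow hχ.dOne _)).smul _

variable (b) in
/-- The gauge transform of the skew part. -/
def gaugeSkew (χ : FormalMap n g) (ρ : FormalMap n (g ⊗[ℂ] g)) : FormalMap n (g ⊗[ℂ] g) :=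
  expAct χ ρ - seriesAct (fun k => 1 / ((k + 1).factorial : ℂ)) χ (dOne b χ)

theorem ordGE_gaugeSkew_sub {χ : FormalMap n g} (h1 : OrdGE 1 χ) (ρ : FormalMap n (g ⊗[ℂ] g))
    (N : ℕ) : OrdGE N (gaugeSkew b χ ρ - ∑ k ∈ Finset.range (N + 1), gaugeTerm b χ ρ k) := by
  have e : ∑ k ∈ Finset.range (N + 1), gaugeTerm b χ ρ k =
      ∑ k ∈ Finset.range (N + 1), (1 / (k.factorial : ℂ)) • (actL χ ^ k) ρ -
      ∑ k ∈ Finset.range N, (1 / ((k + 1).factorial : ℂ)) • (actL χ ^ k) (dOne b χ) := by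
    rw [Finset.sum_range_succ', Finset.sum_range_succ' (fun k => (1 / (k.factorial : ℂ)) • _)]
    simp only [gaugeTerm, smul_sub, Finset.sum_sub_distrib]
    simp
    abel
  have h2 := (ordGE_seriesAct_sub (fun k => 1 / (k.factorial : ℂ)) h1 ρ (N + 1)).mono
    (Nat.le_succ N)
  have h3 := ordGE_seriesAct_sub (fun k => 1 / ((k + 1).factorial : ℂ)) h1 (dOne b χ) N
  convert h2.sub h3 using 1
  rw [e, gaugeSkew, expAct]
  abel

variable (b) in
/-- The part of degree `k` in `χ` of the dynamical Yang-Baxter operator on a gauge transform. -/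
def cybTerm (χ : FormalMap n g) (ρ : FormalMap n (g ⊗[ℂ] g)) (k : ℕ) :
    FormalMap n (g ⊗[ℂ] (g ⊗[ℂ] g)) :=
  dTwo b (gaugeTerm b χ ρ k) + ∑ x ∈ Finset.HasAntidiagonal.antidiagonal k,
    bilin (cybBilin g) (gaugeTerm b χ ρ x.1) (gaugeTerm b χ ρ x.2)

/-- The curvature transforms linearly, by `exp(ad χ)`: the terms with `dχ` produced by the
derivation rule cancel those from the inhomogeneous part of the affine flow. -/
theorem actL_cybTerm {χ : FormalMap n g} (hχ : IsEquivariant b χ)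
    {ρ : FormalMap n (g ⊗[ℂ] g)} (hρ : IsEquivariant b ρ) (hs : IsSkew2 ρ) (k : ℕ) :
    actL χ (cybTerm b χ ρ k) = ((k : ℂ) + 1) • cybTerm b χ ρ (k + 1) := by
  have h1 : actL χ (dTwo b (gaugeTerm b χ ρ k)) =
      ((k : ℂ) + 1) • dTwo b (gaugeTerm b χ ρ (k + 1)) -
        (bilin (cybBilin g) (dOne b χ) (gaugeTerm b χ ρ k) +
          bilin (cybBilin g) (gaugeTerm b χ ρ k) (dOne b χ)) := by
    have := dTwo_actL b hχ (isEquivariant_gaugeTerm hχ hρ k) (isSkew2_gaugeTerm hs k)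
    rw [actL_gaugeTerm, dTwo_add, dTwo_smul] at this
    have h0 : dTwo b (if k = 0 then dOne b χ else 0) = 0 := by
      split_ifs
      · exact dTwo_dOne b χ
      · simpa using dTwo_smul b (0 : ℂ) (0 : FormalMap n (g ⊗[ℂ] g))
    rw [h0, add_zero] at this
    rw [this]
    abel
  have h2 : ((k : ℂ) + 1) • ∑ x ∈ Finset.HasAntidiagonal.antidiagonal (k + 1),
      bilin (cybBilin g) (gaugeTerm b χ ρ x.1) (gaugeTerm b χ ρ x.2) =
      ∑ x ∈ Finset.HasAntidiagonal.antidiagonal k,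
        bilin (cybBilin g) (((x.1 : ℂ) + 1) • gaugeTerm b χ ρ (x.1 + 1)) (gaugeTerm b χ ρ x.2) +
      ∑ x ∈ Finset.HasAntidiagonal.antidiagonal k,
        bilin (cybBilin g) (gaugeTerm b χ ρ x.1) (((x.2 : ℂ) + 1) • gaugeTerm b χ ρ (x.2 + 1)) := by
    have : ((k : ℂ) + 1) • ∑ x ∈ Finset.HasAntidiagonal.antidiagonal (k + 1),
        bilin (cybBilin g) (gaugeTerm b χ ρ x.1) (gaugeTerm b χ ρ x.2) =
        ∑ x ∈ Finset.HasAntidiagonal.antidiagonal (k + 1),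
          (x.1 : ℂ) • bilin (cybBilin g) (gaugeTerm b χ ρ x.1) (gaugeTerm b χ ρ x.2) +
        ∑ x ∈ Finset.HasAntidiagonal.antidiagonal (k + 1),
          (x.2 : ℂ) • bilin (cybBilin g) (gaugeTerm b χ ρ x.1) (gaugeTerm b χ ρ x.2) := by
      rw [Finset.smul_sum, ← Finset.sum_add_distrib]
      refine Finset.sum_congr rfl fun x hx => ?_
      rw [← add_smul]
      congr 1
      exact_mod_cast (Finset.HasAntidiagonal.mem_antidiagonal.1 hx).symm
    rw [this, Finset.Nat.sum_antidiagonal_succ, Finset.Nat.sum_antidiagonal_succ']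
    simp only [Nat.cast_zero, zero_smul, zero_add, Nat.cast_add, Nat.cast_one,
      bilin_smul_left, bilin_smul_right]
  have h3 : ∑ x ∈ Finset.HasAntidiagonal.antidiagonal k,
      bilin (cybBilin g) (if x.1 = 0 then dOne b χ else 0) (gaugeTerm b χ ρ x.2) =
      bilin (cybBilin g) (dOne b χ) (gaugeTerm b χ ρ k) := by
    rw [Finset.sum_eq_single (0, k)]
    · simp
    · rintro ⟨p, q⟩ hx hne
      have : p ≠ 0 := by
        rintro rfl
        simp at hx
        exact hne (by rw [hx])
      simp [this, bilin_zero_left]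
    · simp
  have h4 : ∑ x ∈ Finset.HasAntidiagonal.antidiagonal k,
      bilin (cybBilin g) (gaugeTerm b χ ρ x.1) (if x.2 = 0 then dOne b χ else 0) =
      bilin (cybBilin g) (gaugeTerm b χ ρ k) (dOne b χ) := by
    rw [Finset.sum_eq_single (k, 0)]
    · simp
    · rintro ⟨p, q⟩ hx hne
      have : q ≠ 0 := by
        rintro rfl
        simp at hx
        exact hne (by rw [hx])
      simp [this, bilin_zero_right]
    · simp
  rw [cybTerm, map_add, h1, map_sum, cybTerm, smul_add, h2, ← h3, ← h4]
  simp only [actL_bilin (lie_cybBilin (g := g)), actL_gaugeTerm, bilin_add_left, bilin_add_right,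
    Finset.sum_add_distrib]
  abel

theorem dynCYB_gaugeSkew {χ : FormalMap n g} (h1 : OrdGE 1 χ) (hχ : IsEquivariant b χ)
    {ρ : FormalMap n (g ⊗[ℂ] g)} (hρ : IsEquivariant b ρ) (hs : IsSkew2 ρ)
    {φ : g ⊗[ℂ] (g ⊗[ℂ] g)} (hφ : ∀ y : g, ⁅y, φ⁆ = 0) (h : dynCYB b ρ = constMap n φ) :
    dynCYB b (gaugeSkew b χ ρ) = constMap n φ := by
  have h0 : cybTerm b χ ρ 0 = constMap n φ := by
    rw [← h, cybTerm, dynCYB]; simp [gaugeTerm]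
  -- The degree zero term is the invariant constant `φ`, annihilated by `ad χ`; the recursion then
  -- kills all higher terms.
  have hk : ∀ k, cybTerm b χ ρ (k + 1) = 0 := fun k => by
    have key : ((k : ℂ) + 1) • cybTerm b χ ρ (k + 1) = 0 := by
      rw [← actL_cybTerm hχ hρ hs]
      induction k with
      | zero => rw [h0, actL_constMap hφ]
      | succ k ih =>
        rw [(smul_eq_zero.1 ((actL_cybTerm hχ hρ hs k).symm.trans ih)).resolve_left
          (by exact_mod_cast Nat.succ_ne_zero k), map_zero]
    exact (smul_eq_zero.1 key).resolve_left (by exact_mod_cast Nat.succ_ne_zero k)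
  apply eq_of_forall_ordGE
  intro N
  set u := gaugeTerm b χ ρ
  set S := ∑ k ∈ Finset.range (N + 2), u k
  have hG : OrdGE (N + 1) (gaugeSkew b χ ρ - S) := ordGE_gaugeSkew_sub h1 ρ (N + 1)
  have a1 : OrdGE N (dTwo b (gaugeSkew b χ ρ - S)) := hG.dTwo b
  have a2 : OrdGE N (bilin (cybBilin g) (gaugeSkew b χ ρ) (gaugeSkew b χ ρ) -
      bilin (cybBilin g) S S) := by
    have : bilin (cybBilin g) (gaugeSkew b χ ρ) (gaugeSkew b χ ρ) - bilin (cybBilin g) S S =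
        bilin (cybBilin g) (gaugeSkew b χ ρ - S) (gaugeSkew b χ ρ) +
        bilin (cybBilin g) S (gaugeSkew b χ ρ - S) := by
      rw [bilin_sub_left, bilin_sub_right]; abel
    rw [this]
    exact ((hG.bilin (ordGE_zero _) _).mono (by omega)).add
      (((ordGE_zero _).bilin hG _).mono (by omega))
  -- The product of the terms `p` and `q` has order at least `(p - 1) + (q - 1)`, hence the cutoff
  -- `N + 2`.
  have a3 := ordGE_sum_sub_antidiagonal (fun p q => bilin (cybBilin g) (u p) (u q)) (N + 2) N
    fun p q hpq => ((ordGE_gaugeTerm b h1 ρ p).bilin (ordGE_gaugeTerm b h1 ρ q) _).mono (by omega)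
  have e3 : ∑ p ∈ Finset.range (N + 2), ∑ q ∈ Finset.range (N + 2),
      bilin (cybBilin g) (u p) (u q) = bilin (cybBilin g) S S := by
    simp only [S, bilin_sum_left, bilin_sum_right (s := Finset.range (N + 2))]
    rw [Finset.sum_comm]
  have e4 : constMap n φ = ∑ k ∈ Finset.range (N + 2), cybTerm b χ ρ k := by
    rw [Finset.sum_range_succ', h0, Finset.sum_eq_zero fun k _ => hk k, zero_add]
  rw [e3] at a3
  rw [e4]
  convert (a1.add a2).add a3 using 1
  simp only [cybTerm, Finset.sum_add_distrib, dynCYB, dTwo_sub, ← dTwo_sum]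
  abel

/-! #### The skew part of a dynamical r-matrix -/

theorem constMap_add {V : Type*} [AddCommGroup V] (v w : V) :
    constMap n (v + w) = constMap n v + constMap n w := funext fun d => by
  simp only [constMap, Pi.add_apply]; split_ifs <;> simp

theorem dynCYB_constMap_add {Ω : g ⊗[ℂ] g} (hinv : ∀ y : g, ⁅y, Ω⁆ = 0)
    {ρ : FormalMap n (g ⊗[ℂ] g)} (hs : IsSkew2 ρ) :
    dynCYB b (constMap n Ω + ρ) = constMap n (CYB Ω) + dynCYB b ρ := by
  have h : bilin (cybBilin g) (constMap n Ω) ρ + bilin (cybBilin g) ρ (constMap n Ω) = 0 := by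
    rw [bilin_constMap_left, bilin_constMap_right]
    exact funext fun d => cybBilin_invariant hinv (hs d)
  have h2 : bilin (cybBilin g) (constMap n Ω) (constMap n Ω) = constMap n (CYB Ω) := by
    rw [bilin_constMap_left, mapVal_constMap]; rfl
  simp only [dynCYB, dTwo_add, dTwo_constMap, bilin_add_left, bilin_add_right, h2]
  linear_combination (norm := abel) h

theorem mem_Dynr_iff {Ω : g ⊗[ℂ] g} (hsymm : flip21 g Ω = Ω) (hinv : ∀ y : g, ⁅y, Ω⁆ = 0)
    {ρ : FormalMap n (g ⊗[ℂ] g)} :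
    constMap n ((1 / 2 : ℂ) • Ω) + ρ ∈ Dynr b Ω ↔
      IsEquivariant b ρ ∧ IsSkew2 ρ ∧ dynCYB b ρ = constMap n (-CYB ((1 / 2 : ℂ) • Ω)) := by
  have hinv' : ∀ y : g, ⁅y, (1 / 2 : ℂ) • Ω⁆ = 0 := fun y => by rw [lie_smul, hinv, smul_zero]
  have hsymm' : flip21 g ((1 / 2 : ℂ) • Ω) = (1 / 2 : ℂ) • Ω := by rw [map_smul, hsymm]
  have hc : IsEquivariant b (constMap n ((1 / 2 : ℂ) • Ω)) :=
    isEquivariant_constMap fun y => hinv' y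
  have e1 : IsEquivariant b (constMap n ((1 / 2 : ℂ) • Ω) + ρ) ↔ IsEquivariant b ρ :=
    ⟨fun h => by simpa using h.sub hc, fun h => hc.add h⟩
  have hΩ : constMap n Ω = constMap n ((1 / 2 : ℂ) • Ω) + constMap n ((1 / 2 : ℂ) • Ω) := by
    rw [← constMap_add, ← add_smul]; norm_num
  have e2 : constMap n ((1 / 2 : ℂ) • Ω) + ρ + mapVal (flip21 g) (constMap n ((1 / 2 : ℂ) • Ω) + ρ)
      = constMap n Ω ↔ IsSkew2 ρ := by
    rw [isSkew2_iff, mapVal_add, mapVal_constMap, hsymm', add_add_add_comm, hΩ, add_eq_left,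
      add_comm, eq_neg_iff_add_eq_zero]
  have e3 : IsSkew2 ρ → (dynCYB b (constMap n ((1 / 2 : ℂ) • Ω) + ρ) = 0 ↔
      dynCYB b ρ = constMap n (-CYB ((1 / 2 : ℂ) • Ω))) := fun hs => by
    rw [dynCYB_constMap_add hinv' hs, add_comm, ← eq_neg_iff_add_eq_zero,
      show -constMap n (CYB ((1 / 2 : ℂ) • Ω)) = constMap n (-CYB ((1 / 2 : ℂ) • Ω)) from
        funext fun d => by simp only [constMap, Pi.neg_apply]; split_ifs <;> simp]
  constructor
  · rintro ⟨h1, h2, h3⟩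
    exact ⟨e1.1 h1, e2.1 h3, (e3 (e2.1 h3)).1 h2⟩
  · rintro ⟨h1, h2, h3⟩
    exact ⟨e1.2 h1, (e3 h2).2 h3, e2.2 h2⟩

theorem gauge_constMap_add {Ω : g ⊗[ℂ] g} (hinv : ∀ y : g, ⁅y, Ω⁆ = 0) {χ : FormalMap n g}
    (hχ : χ ∈ GaugeMaps b) (ρ : FormalMap n (g ⊗[ℂ] g)) :
    gauge b χ (constMap n Ω + ρ) = constMap n Ω + gaugeSkew b χ ρ := by
  rw [gauge_eq b hχ, gaugeSkew, expAct, seriesAct_add, ← expAct, ← expAct, expAct_constMap hinv]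
  abel

theorem isSkew2_gaugeSkew {χ : FormalMap n g} (h1 : OrdGE 1 χ) {ρ : FormalMap n (g ⊗[ℂ] g)}
    (hs : IsSkew2 ρ) : IsSkew2 (gaugeSkew b χ ρ) := by
  intro d
  have h : gaugeSkew b χ ρ d = (∑ k ∈ Finset.range (d.degree + 1 + 1), gaugeTerm b χ ρ k) d := by
    simpa [sub_eq_zero] using ordGE_gaugeSkew_sub (b := b) h1 ρ (d.degree + 1) d (Nat.lt_succ_self _)
  rw [h]
  simp only [Finset.sum_apply, map_sum, ← Finset.sum_neg_distrib]
  exact Finset.sum_congr rfl fun k _ => isSkew2_gaugeTerm hs k d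

theorem isEquivariant_gaugeSkew {χ : FormalMap n g} (h1 : OrdGE 1 χ) (hχ : IsEquivariant b χ)
    {ρ : FormalMap n (g ⊗[ℂ] g)} (hρ : IsEquivariant b ρ) :
    IsEquivariant b (gaugeSkew b χ ρ) :=
  (hχ.seriesAct _ h1 hρ).sub (hχ.seriesAct _ h1 hχ.dOne)

theorem gauge_mem_Dynr {Ω : g ⊗[ℂ] g} (hsymm : flip21 g Ω = Ω) (hinv : ∀ y : g, ⁅y, Ω⁆ = 0)
    {χ : FormalMap n g} (hχ : χ ∈ GaugeMaps b) {r : FormalMap n (g ⊗[ℂ] g)} (hr : r ∈ Dynr b Ω) :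
    gauge b χ r ∈ Dynr b Ω := by
  have hinv' : ∀ y : g, ⁅y, (1 / 2 : ℂ) • Ω⁆ = 0 := fun y => by rw [lie_smul, hinv, smul_zero]
  have h1 : OrdGE 1 χ := ordGE_one_iff.2 hχ.1
  obtain ⟨ρ, rfl⟩ : ∃ ρ, r = constMap n ((1 / 2 : ℂ) • Ω) + ρ := ⟨_, (add_sub_cancel _ _).symm⟩
  rw [mem_Dynr_iff hsymm hinv] at hr
  rw [gauge_constMap_add hinv' hχ, mem_Dynr_iff hsymm hinv]
  refine ⟨isEquivariant_gaugeSkew h1 hχ.2 hr.1, isSkew2_gaugeSkew h1 hr.2.1,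
    dynCYB_gaugeSkew h1 hχ.2 hr.1 hr.2.1 (fun y => ?_) hr.2.2⟩
  rw [lie_neg, lie_CYB_invariant hinv', neg_zero]

end GaugeDynr


/-! ### The Koszul homotopy -/

section Koszul

open TensorProduct TensorProduct.LieModule

variable {n : ℕ} {g : Type*} [LieRing g] [LieAlgebra ℂ g] {l : LieSubalgebra ℂ g}
  (b : Module.Basis (Fin n) ℂ l) (pr : g →ₗ[ℂ] l)
  {W : Type*} [AddCommGroup W] [Module ℂ W]

/-- The projection `g → 𝔩`, regarded as an endomorphism of `g`. -/
def projL (pr : g →ₗ[ℂ] l) : Module.End ℂ g := l.toSubmodule.subtype ∘ₗ pr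

/-- The complementary projection. -/
def projM (pr : g →ₗ[ℂ] l) : Module.End ℂ g := LinearMap.id - projL pr

theorem projL_coe (hpr : ∀ y : l, pr y = y) (y : l) : projL pr y = y :=
  congrArg Subtype.val (hpr y)

theorem projL_projL (hpr : ∀ y : l, pr y = y) (x : g) : projL pr (projL pr x) = projL pr x :=
  projL_coe pr hpr _

theorem projM_coe (hpr : ∀ y : l, pr y = y) (y : l) : projM pr y = 0 := by
  rw [projM, LinearMap.sub_apply, projL_coe pr hpr, LinearMap.id_apply, sub_self]

/-- The extension as a derivation of an endomorphism `N` of `W` and of the projection to `𝔩`. -/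
def derExt (N : Module.End ℂ W) : Module.End ℂ (g ⊗[ℂ] W) :=
  (projL pr).rTensor W + N.lTensor g

theorem derExt_tmul (N : Module.End ℂ W) (x : g) (w : W) :
    derExt pr N (x ⊗ₜ w) = projL pr x ⊗ₜ w + x ⊗ₜ N w := rfl

/-- Contraction of the first tensor factor with the `i`-th coordinate on `𝔩`. -/
def contr (i : Fin n) : g ⊗[ℂ] W →ₗ[ℂ] W :=
  (TensorProduct.lid ℂ W).toLinearMap ∘ₗ (b.coord i ∘ₗ pr).rTensor W

theorem contr_tmul (i : Fin n) (x : g) (w : W) :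
    contr b pr i (x ⊗ₜ w) = b.repr (pr x) i • w := rfl

/-- The contraction of a series with the Euler vector field. -/
def koszulH (Z : FormalMap n (g ⊗[ℂ] W)) : FormalMap n W :=
  ∑ i, mulX i (mapVal (contr b pr i) Z)

theorem sum_tmul_contr (Z : g ⊗[ℂ] W) :
    ∑ i, (b i : g) ⊗ₜ contr b pr i Z = (projL pr).rTensor W Z := by
  induction Z with
  | zero => simp
  | add Z Z' h h' => simp only [map_add, tmul_add, Finset.sum_add_distrib, h, h']
  | tmul x w =>
    simp only [contr_tmul, tmul_smul, smul_tmul', ← sum_tmul, sum_repr_smul_coe]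
    rfl

/-- The Clifford relation between contraction and exterior multiplication by a basis element of `𝔩`.
-/
theorem contr_altStep (hpr : ∀ y : l, pr y = y) (A : Module.End ℂ (g ⊗[ℂ] W)) (i k : Fin n)
    (Z : g ⊗[ℂ] W) : contr b pr i (altStep A ((b k : g) ⊗ₜ Z)) =
      (if i = k then Z else 0) - A ((b k : g) ⊗ₜ contr b pr i Z) := by
  induction Z with
  | zero => simp
  | add Z Z' h h' =>
    simp only [map_add, tmul_add, h, h']
    split_ifs <;> abel
  | tmul x w =>
    rw [altStep_tmul, map_sub, contr_tmul, contr_tmul, contr_tmul, hpr, tmul_smul, map_smul,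
      b.repr_self]
    congr 1
    by_cases h : i = k
    · subst h; simp
    · simp [h]

/-- The Koszul homotopy formula. -/
theorem koszulH_add (hpr : ∀ y : l, pr y = y) (A : Module.End ℂ (g ⊗[ℂ] W))
    (Z : FormalMap n (g ⊗[ℂ] W)) (d : Fin n →₀ ℕ) :
    koszulH b pr (mapVal (altStep A) (gradBar b Z)) d +
      mapVal A (gradBar b (koszulH b pr Z)) d =
      (d.degree : ℂ) • Z d + A ((projL pr).rTensor W (Z d)) := by
  have h1 : koszulH b pr (mapVal (altStep A) (gradBar b Z)) =
      ∑ i, mulX i (pderiv i Z) - ∑ i, ∑ k, mulX i (mapVal (A ∘ₗ TensorProduct.mk ℂ g W (b k : g) ∘ₗ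
        contr b pr i) (pderiv k Z)) := by
    rw [koszulH, ← Finset.sum_sub_distrib]
    refine Finset.sum_congr rfl fun i _ => ?_
    rw [← mulX_sum, ← mulX_sub]
    congr 1
    funext d
    simp only [gradBar_eq, mapVal, Finset.sum_apply, map_sum, mk_apply, contr_altStep b pr hpr,
      Finset.sum_sub_distrib, Finset.sum_ite_eq, Finset.mem_univ, if_true, Pi.sub_apply,
      LinearMap.comp_apply]
  have h2 : mapVal A (gradBar b (koszulH b pr Z)) =
      mapVal (A ∘ₗ (projL pr).rTensor W) Z + ∑ i, ∑ k, mulX i (mapVal (A ∘ₗ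
        TensorProduct.mk ℂ g W (b k : g) ∘ₗ contr b pr i) (pderiv k Z)) := by
    have e : mapVal (A ∘ₗ (projL pr).rTensor W) Z =
        ∑ k, mapVal (A ∘ₗ TensorProduct.mk ℂ g W (b k : g) ∘ₗ contr b pr k) Z := by
      funext d
      simp only [mapVal, Finset.sum_apply, LinearMap.comp_apply, mk_apply, ← map_sum,
        sum_tmul_contr]
    rw [e, gradBar_eq, koszulH, mapVal_sum, Finset.sum_comm (s := Finset.univ (α := Fin n)),
      ← Finset.sum_add_distrib]
    refine Finset.sum_congr rfl fun k _ => ?_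
    simp only [pderiv_sum, pderiv_mulX, mapVal_sum, Finset.sum_add_distrib, mapVal_add,
      mapVal_mulX, ← mapVal_pderiv, mapVal_mapVal, apply_ite (mapVal _), mapVal_zero]
    simp
  rw [← Pi.add_apply, h1, h2]
  -- The mixed terms with `xᵢ∂ₖ` cancel between the two halves. There remain the Euler operator,
  -- which counts the degree, and the term with the projection to `𝔩`.
  have h3 : (∑ i, mulX i (pderiv i Z)) d = (d.degree : ℂ) • Z d := by
    simp only [Finset.sum_apply, mulX_pderiv_self, ← Finset.sum_smul]
    congr 1
    rw [Finsupp.degree_eq_sum]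
    push_cast
    rfl
  rw [← h3]
  simp only [Pi.add_apply, Pi.sub_apply, mapVal, LinearMap.comp_apply]
  abel

/-- An inverse of `c + N`, if this endomorphism is injective. -/
def shiftInv [FiniteDimensional ℂ W] (N : Module.End ℂ W) (c : ℕ) : Module.End ℂ W :=
  open Classical in
  if h : Function.Injective ((c : ℂ) • LinearMap.id + N : W →ₗ[ℂ] W) then
    (LinearEquiv.ofInjectiveEndo _ h).symm.toLinearMap else 0

theorem shift_shiftInv [FiniteDimensional ℂ W] {N : Module.End ℂ W} {c : ℕ}
    (h : Function.Injective ((c : ℂ) • LinearMap.id + N : W →ₗ[ℂ] W)) (w : W) :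
    (c : ℂ) • shiftInv N c w + N (shiftInv N c w) = w := by
  rw [shiftInv, dif_pos h]
  exact LinearEquiv.apply_symm_apply (LinearEquiv.ofInjectiveEndo _ h) w

theorem shiftInv_comm [FiniteDimensional ℂ W] {N : Module.End ℂ W} {c : ℕ}
    (h : Function.Injective ((c : ℂ) • LinearMap.id + N : W →ₗ[ℂ] W)) {T : Module.End ℂ W}
    (hT : ∀ w, N (T w) = T (N w)) (w : W) : shiftInv N c (T w) = T (shiftInv N c w) := by
  apply h
  simp only [LinearMap.add_apply, LinearMap.smul_apply, LinearMap.id_apply]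
  rw [shift_shiftInv h, hT, ← map_smul, ← map_add, shift_shiftInv h]

/-- The endomorphism `c + N` is injective for all `c ≥ 1`. -/
def ShiftInjective (N : Module.End ℂ W) : Prop :=
  ∀ c : ℕ, 1 ≤ c → Function.Injective ((c : ℂ) • LinearMap.id + N : W →ₗ[ℂ] W)

/-- A projection has eigenvalues in `{0, 1}`, so adding `c ≥ 1` keeps it invertible. -/
theorem shiftInjective_projL (hpr : ∀ y : l, pr y = y) : ShiftInjective (projL pr) := by
  intro c hc
  rw [injective_iff_map_eq_zero]
  intro x hx
  simp only [LinearMap.add_apply, LinearMap.smul_apply, LinearMap.id_apply] at hx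
  have h2 := congrArg (projL pr) hx
  rw [map_add, map_smul, projL_projL pr hpr, map_zero, show ∀ v : g, (c : ℂ) • v + v = ((c : ℂ) + 1) • v from fun v => by rw [add_smul, one_smul]] at h2
  have h3 : projL pr x = 0 :=
    (smul_eq_zero.1 h2).resolve_left (by exact_mod_cast Nat.succ_ne_zero c)
  rw [h3, add_zero] at hx
  exact (smul_eq_zero.1 hx).resolve_left (by exact_mod_cast (by omega : c ≠ 0))

theorem lTensor_shift (N : Module.End ℂ W) (c : ℕ) (u : g ⊗[ℂ] W) :
    ((c : ℂ) • LinearMap.id + N : W →ₗ[ℂ] W).lTensor g u = (c : ℂ) • u + N.lTensor g u := by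
  rw [LinearMap.lTensor_add, LinearMap.lTensor_smul, LinearMap.lTensor_id]
  rfl

/-- On tensors with first factor in `𝔩` the operator is `(c + 1) + 1 ⊗ N`, which is injective even
for `c = 0`. Hence a kernel element has no `𝔩`-component in its first factor. -/
theorem rTensor_projL_eq_zero (hpr : ∀ y : l, pr y = y) {N : Module.End ℂ W}
    (hN : ShiftInjective N) {c : ℕ} {u : g ⊗[ℂ] W} (hu : (c : ℂ) • u + derExt pr N u = 0) :
    (projL pr).rTensor W u = 0 := by
  have h1 : (projL pr).rTensor W ((projL pr).rTensor W u) = (projL pr).rTensor W u := by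
    rw [← LinearMap.comp_apply, ← LinearMap.rTensor_comp]
    congr 2
    exact LinearMap.ext fun x => projL_projL pr hpr x
  have h2 : (projL pr).rTensor W (N.lTensor g u) = N.lTensor g ((projL pr).rTensor W u) := by
    rw [← LinearMap.comp_apply, ← LinearMap.comp_apply, LinearMap.rTensor_comp_lTensor,
      LinearMap.lTensor_comp_rTensor]
  have h3 := congrArg ((projL pr).rTensor W) hu
  rw [derExt, LinearMap.add_apply, map_add, map_add, map_smul, h1, h2, map_zero, ← add_assoc,
    show ∀ v : g ⊗[ℂ] W, (c : ℂ) • v + v = ((c : ℂ) + 1) • v from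
      fun v => by rw [add_smul, one_smul]] at h3
  apply Module.Flat.lTensor_preserves_injective_linearMap (M := g) _ (hN (c + 1) (by omega))
  rw [lTensor_shift, map_zero]
  push_cast
  exact h3

theorem ShiftInjective.derExt (hpr : ∀ y : l, pr y = y) {N : Module.End ℂ W}
    (hN : ShiftInjective N) : ShiftInjective (derExt pr N) := by
  intro c hc
  rw [injective_iff_map_eq_zero]
  intro u hu
  simp only [LinearMap.add_apply, LinearMap.smul_apply, LinearMap.id_apply] at hu
  have h1 := rTensor_projL_eq_zero pr hpr hN hu
  rw [DynRMat.derExt, LinearMap.add_apply, h1, zero_add, ← lTensor_shift] at hu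
  exact (injective_iff_map_eq_zero _).1
    (Module.Flat.lTensor_preserves_injective_linearMap (M := g) _ (hN c hc)) u hu

/-- Tensors with no factor in `𝔩` lie in tensor powers of `𝔪`. The relation `M ∘ N = 1 - S` encodes,
without eigenspaces, that `S` is the identity on the kernel of `N`. -/
theorem map_projM_eq_self (hpr : ∀ y : l, pr y = y) {N M S : Module.End ℂ W}
    (hN : ShiftInjective N) (hM : M ∘ₗ N = LinearMap.id - S) {u : g ⊗[ℂ] W}
    (hu : derExt pr N u = 0) : TensorProduct.map (projM pr) S u = u := by
  have h1 : (projL pr).rTensor W u = 0 :=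
    rTensor_projL_eq_zero pr hpr hN (c := 0) (by simpa using hu)
  rw [derExt, LinearMap.add_apply, h1, zero_add] at hu
  have h2 : S.lTensor g u = u := by
    have := congrArg (M.lTensor g) hu
    rw [← LinearMap.comp_apply, ← LinearMap.lTensor_comp, hM, LinearMap.lTensor_sub,
      LinearMap.lTensor_id, map_zero] at this
    exact (sub_eq_zero.1 this).symm
  have h3 : (projM pr).rTensor W u = u := by
    rw [projM, LinearMap.rTensor_sub, LinearMap.rTensor_id, LinearMap.sub_apply, h1, sub_zero]
    rfl
  rw [← LinearMap.rTensor_comp_lTensor, LinearMap.comp_apply, h2, h3]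

/-- The homotopy operator of the Koszul complex. -/
def koszulK [FiniteDimensional ℂ W] (N : Module.End ℂ W) (Z : FormalMap n (g ⊗[ℂ] W)) :
    FormalMap n W :=
  fun d => shiftInv N d.degree (koszulH b pr Z d)

/-- The operator `koszulK` is `koszulH` divided by the total degree. If `dZ` has high enough order,
the homotopy formula says that total degree annihilates the remainder `d(KZ) - Z` at `d`. -/
theorem shift_koszulK [FiniteDimensional ℂ W] (hpr : ∀ y : l, pr y = y) {N : Module.End ℂ W}
    (hN : ShiftInjective N) {A : Module.End ℂ (g ⊗[ℂ] W)}
    (hA : ∀ u, A (derExt pr N u) = derExt pr N (A u)) {Z : FormalMap n (g ⊗[ℂ] W)}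
    (hZ : ∀ d, A ((projL pr).rTensor W (Z d)) = derExt pr N (Z d)) {d : Fin n →₀ ℕ}
    (hd : OrdGE d.degree (mapVal (altStep A) (gradBar b Z))) :
    (d.degree : ℂ) • (mapVal A (gradBar b (koszulK b pr N Z)) d - Z d) +
      derExt pr N (mapVal A (gradBar b (koszulK b pr N Z)) d - Z d) = 0 := by
  have h1 : koszulH b pr (mapVal (altStep A) (gradBar b Z)) d = 0 := by
    have : OrdGE (d.degree + 1) (koszulH b pr (mapVal (altStep A) (gradBar b Z))) :=
      OrdGE.sum fun i _ => (hd.mapVal _).mulX i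
    exact this d (Nat.lt_succ_self _)
  have h2 : (d.degree : ℂ) • mapVal A (gradBar b (koszulK b pr N Z)) d +
      derExt pr N (mapVal A (gradBar b (koszulK b pr N Z)) d) =
      mapVal A (gradBar b (koszulH b pr Z)) d := by
    simp only [mapVal]
    rw [← hA, ← map_smul, ← map_add]
    congr 1
    simp only [gradBar_eq, Finset.sum_apply, Finset.smul_sum, map_sum, mapVal, mk_apply,
      ← Finset.sum_add_distrib, derExt_tmul, projL_coe pr hpr, ← tmul_smul, ← tmul_add]
    refine Finset.sum_congr rfl fun i _ => ?_
    -- A derivative at `d` uses the coefficient of degree `|d| + 1`; the extra `1` is matched by the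
    -- factor `xᵢ ∈ 𝔩` that the differential puts in front.
    have h3 := shift_shiftInv (hN (d.degree + 1) (by omega))
      (koszulH b pr Z (d + Finsupp.single i 1))
    have h4 : (d + Finsupp.single i 1).degree = d.degree + 1 := by simp
    congr 1
    simp only [pderiv, koszulK, h4, map_smul]
    conv_rhs => rw [← h3]
    push_cast
    simp only [smul_add, smul_smul, add_smul, one_smul, mul_comm]
    module
  have h5 := koszulH_add b pr hpr A Z d
  rw [h1, zero_add, hZ] at h5
  rw [smul_sub, map_sub, sub_add_sub_comm, h2, h5, sub_self]

theorem OrdGE.koszulK [FiniteDimensional ℂ W] {N : Module.End ℂ W} {p : ℕ}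
    {Z : FormalMap n (g ⊗[ℂ] W)} (h : OrdGE p Z) : OrdGE (p + 1) (koszulK b pr N Z) := fun d hd => by
  have : OrdGE (p + 1) (koszulH b pr Z) := OrdGE.sum fun i _ => (h.mapVal _).mulX i
  rw [DynRMat.koszulK, this d hd, map_zero]

/-! #### Equivariance of the homotopy -/

section Equivariance

variable {b pr} [LieRingModule g W] [LieModule ℂ g W]

theorem contr_lie (hpre : ∀ (y : l) (z : g), pr ⁅(y : g), z⁆ = ⁅y, pr z⁆) (y : l) (j : Fin n)
    (Z : g ⊗[ℂ] W) : contr b pr j ⁅(y : g), Z⁆ =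
      ⁅(y : g), contr b pr j Z⁆ + ∑ i, b.repr ⁅y, b i⁆ j • contr b pr i Z := by
  induction Z with
  | zero => simp
  | add Z Z' h h' =>
    simp only [lie_add, map_add, h, h', smul_add, Finset.sum_add_distrib]
    abel
  | tmul x w =>
    rw [lie_tmul_right, map_add, contr_tmul, contr_tmul, contr_tmul, hpre, lie_smul, add_comm]
    congr 1
    simp only [contr_tmul, smul_smul, ← Finset.sum_smul]
    congr 1
    conv_lhs => rw [← b.sum_repr (pr x)]
    simp only [lie_sum, lie_smul, map_sum, map_smul, Finsupp.coe_finsetSum, Finset.sum_apply,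
      Finsupp.smul_apply, smul_eq_mul, mul_comm]

theorem IsEquivariant.koszulH (hpre : ∀ (y : l) (z : g), pr ⁅(y : g), z⁆ = ⁅y, pr z⁆)
    {Z : FormalMap n (g ⊗[ℂ] W)} (hZ : IsEquivariant b Z) : IsEquivariant b (koszulH b pr Z) := by
  rw [isEquivariant_iff]
  intro y
  have h1 : DynRMat.coadDer b y (DynRMat.koszulH b pr Z) =
      ∑ i, DynRMat.coadDer b y (DynRMat.mulX i (DynRMat.mapVal (contr b pr i) Z)) := by
    rw [DynRMat.koszulH, coadDer_sum]
  rw [lieDer, h1]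
  simp only [coadDer_mulX, coadDer_mapVal, hZ.coadDer, mapVal_neg, mulX_neg, Finset.sum_add_distrib,
    Finset.sum_neg_distrib]
  have h2 : ∀ j, DynRMat.mapVal (contr b pr j)
      (DynRMat.mapVal (LieModule.toEnd ℂ g (g ⊗[ℂ] W) (y : g)) Z) =
      DynRMat.mapVal (LieModule.toEnd ℂ g W (y : g)) (DynRMat.mapVal (contr b pr j) Z) +
        ∑ i, b.repr ⁅y, b i⁆ j • DynRMat.mapVal (contr b pr i) Z := fun j => by
    funext d
    simp only [DynRMat.mapVal, LieModule.toEnd_apply_apply, contr_lie hpre, Pi.add_apply,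
      Finset.sum_apply, Pi.smul_apply]
  simp only [h2, DynRMat.koszulH, mapVal_sum, mapVal_mulX, mulX_add, mulX_sum, mulX_smul,
    Finset.sum_add_distrib]
  rw [Finset.sum_comm (f := fun i j => b.repr ⁅y, b i⁆ j • DynRMat.mulX j _)]
  abel

/-- Coadjoint fields preserve the polynomial degree, so a different intertwiner may be used in each
degree. Degree zero, where `shiftInv` need not be an inverse, is excluded by `f 0 = 0`. -/
theorem isEquivariant_degreewise {f : FormalMap n W} (hf : IsEquivariant b f)
    {T : ℕ → Module.End ℂ W} (hT : ∀ c, 1 ≤ c → ∀ (y : l) (w : W), T c ⁅(y : g), w⁆ = ⁅(y : g), T c w⁆)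
    (h0 : f 0 = 0) :
    IsEquivariant b (fun d => T d.degree (f d)) := by
  rw [isEquivariant_iff] at *
  intro y
  have h1 : ∀ i j, mulX j (pderiv i (fun d => T d.degree (f d))) =
      fun d => T d.degree (mulX j (pderiv i f) d) := fun i j => by
    funext d
    rcases eq_zero_or_eq_add_single j d with h | ⟨d, rfl⟩
    · simp [mulX_of_eq_zero _ h]
    · simp only [mulX_add_single, pderiv, map_smul]
      simp
  funext d
  by_cases hd : d = 0
  · subst hd
    simp [lieDer, coadDer, mapVal, mulX, h0]
  have hd' : 1 ≤ d.degree := by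
    rw [Nat.one_le_iff_ne_zero, Ne, Finsupp.degree_eq_zero_iff]; exact hd
  have h2 := congrArg (T d.degree) (congrFun (hf y) d)
  simp only [lieDer, coadDer, Pi.add_apply, Finset.sum_apply, Pi.smul_apply, mapVal, h1, map_add,
    map_sum, map_smul, LieModule.toEnd_apply_apply, hT _ hd', Pi.zero_apply, map_zero] at h2 ⊢
  exact h2

theorem IsEquivariant.koszulK [FiniteDimensional ℂ W]
    (hpre : ∀ (y : l) (z : g), pr ⁅(y : g), z⁆ = ⁅y, pr z⁆) {N : Module.End ℂ W}
    (hN : ShiftInjective N) (hNe : ∀ (y : l) (w : W), N ⁅(y : g), w⁆ = ⁅(y : g), N w⁆)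
    {Z : FormalMap n (g ⊗[ℂ] W)} (hZ : IsEquivariant b Z) : IsEquivariant b (koszulK b pr N Z) := by
  refine isEquivariant_degreewise (hZ.koszulH hpre) (fun c hc y w => ?_) ?_
  · exact shiftInv_comm (hN c hc) (T := LieModule.toEnd ℂ g W (y : g)) (hNe y) w
  · simp [DynRMat.koszulH, DynRMat.mulX]

theorem derExt_lie (hpre : ∀ (y : l) (z : g), pr ⁅(y : g), z⁆ = ⁅y, pr z⁆) {N : Module.End ℂ W}
    (hNe : ∀ (y : l) (w : W), N ⁅(y : g), w⁆ = ⁅(y : g), N w⁆) (y : l) (u : g ⊗[ℂ] W) :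
    derExt pr N ⁅(y : g), u⁆ = ⁅(y : g), derExt pr N u⁆ := by
  induction u with
  | zero => simp
  | add u v hu hv => simp only [lie_add, map_add, hu, hv]
  | tmul x w =>
    have : projL pr ⁅(y : g), x⁆ = ⁅(y : g), projL pr x⁆ := congrArg Subtype.val (hpre y x)
    simp only [lie_tmul_right, map_add, derExt_tmul, lie_add, this, hNe]
    abel

end Equivariance

end Koszul


/-! ### Exactness of the Koszul complex and the classification up to gauge equivalence -/

section Classification

open TensorProduct TensorProduct.LieModule

variable {n : ℕ} {g : Type*} [LieRing g] [LieAlgebra ℂ g] {l : LieSubalgebra ℂ g}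
  (b : Module.Basis (Fin n) ℂ l) (pr : g →ₗ[ℂ] l)

/-- The number of factors in `𝔩`, as an operator on `g ⊗ g`. -/
def derTwo : Module.End ℂ (g ⊗[ℂ] g) := derExt pr (projL pr)

theorem derTwo_tmul (x y : g) :
    derTwo pr (x ⊗ₜ y) = projL pr x ⊗ₜ y + x ⊗ₜ projL pr y := rfl

theorem alt2_derTwo (u : g ⊗[ℂ] g) : alt2 g (derTwo pr u) = derTwo pr (alt2 g u) := by
  induction u with
  | zero => simp
  | add u v hu hv => simp only [map_add, hu, hv]
  | tmul x y => simp only [derTwo_tmul, alt2_tmul, map_add, map_sub]; abel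

theorem flip21_derTwo (u : g ⊗[ℂ] g) : flip21 g (derTwo pr u) = derTwo pr (flip21 g u) := by
  have := alt2_derTwo pr u
  rw [alt2, LinearMap.sub_apply, LinearMap.sub_apply, map_sub] at this
  exact sub_right_injective this

theorem alt_derExt (u : g ⊗[ℂ] (g ⊗[ℂ] g)) :
    alt g (derExt pr (derTwo pr) u) = derExt pr (derTwo pr) (alt g u) := by
  refine tensor3_induction u (fun u v hu hv => ?_) fun x y z => ?_
  · simp only [map_add, hu, hv]
  · simp only [derExt_tmul, derTwo_tmul, tmul_add, alt_tmul, map_add, map_sub]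
    abel

theorem alt2_rTensor_projL {u : g ⊗[ℂ] g} (hu : flip21 g u = -u) :
    alt2 g ((projL pr).rTensor g u) = derTwo pr u := by
  refine skew_induction hu (fun u v h h' => ?_) fun x y => ?_
  · simp only [map_add, h, h']
  · simp only [alt2_tmul, map_sub, derTwo_tmul, LinearMap.rTensor_tmul]
    abel

theorem perm213_rTensor (T : Module.End ℂ g) (Z : g ⊗[ℂ] (g ⊗[ℂ] g)) :
    perm213 g (T.rTensor _ Z) = (T.rTensor g).lTensor g (perm213 g Z) := by
  refine tensor3_induction Z (fun u v hu hv => ?_) fun x y z => rfl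
  simp only [map_add, hu, hv]

theorem perm312_rTensor (T : Module.End ℂ g) (Z : g ⊗[ℂ] (g ⊗[ℂ] g)) :
    perm312 g (T.rTensor _ Z) = (T.lTensor g).lTensor g (perm312 g Z) := by
  refine tensor3_induction Z (fun u v hu hv => ?_) fun x y z => rfl
  simp only [map_add, hu, hv]

/-- On a skew tensor the permutations in `alt` move the projection successively through the three
places, which counts the factors in `𝔩`. -/
theorem alt_rTensor_projL {Z : g ⊗[ℂ] (g ⊗[ℂ] g)} (hZ : IsSkew3 Z) :
    alt g ((projL pr).rTensor _ Z) = derExt pr (derTwo pr) Z := by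
  rw [alt, LinearMap.add_apply, LinearMap.sub_apply, perm213_rTensor, perm312_rTensor, hZ.1, hZ.2,
    derExt, derTwo, derExt, LinearMap.add_apply, LinearMap.lTensor_add, LinearMap.add_apply,
    map_neg, sub_neg_eq_add, LinearMap.id_apply, add_assoc]

theorem perm132_of_isSkew3 {Z : g ⊗[ℂ] (g ⊗[ℂ] g)} (hZ : IsSkew3 Z) :
    (flip21 g).lTensor g Z = -Z := by
  have h : ∀ Z : g ⊗[ℂ] (g ⊗[ℂ] g), (flip21 g).lTensor g Z = perm312 g (perm213 g Z) := fun Z => by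
    refine tensor3_induction Z (fun u v hu hv => ?_) fun x y z => rfl
    simp only [map_add, hu, hv]
  rw [h, hZ.1, map_neg, hZ.2]

theorem projM_comp_projL : LinearMap.id ∘ₗ projL pr = LinearMap.id - projM pr := by
  rw [projM, sub_sub_cancel, LinearMap.id_comp]

/-- The counting operator has eigenvalues `0, 1, 2`, and `t(3 - t)/2` takes the values `0, 1, 1`
there. -/
theorem derTwo_left_inverse (hpr : ∀ y : l, pr y = y) :
    ((1 / 2 : ℂ) • ((3 : ℂ) • LinearMap.id - derTwo pr)) ∘ₗ derTwo pr =
      LinearMap.id - TensorProduct.map (projM pr) (projM pr) := by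
  ext x y
  change (1 / 2 : ℂ) • ((3 : ℂ) • derTwo pr (x ⊗ₜ y) - derTwo pr (derTwo pr (x ⊗ₜ y))) =
    x ⊗ₜ y - projM pr x ⊗ₜ projM pr y
  simp only [derTwo_tmul, map_add, projL_projL pr hpr, projM, LinearMap.sub_apply,
    LinearMap.id_apply, tmul_sub, sub_tmul]
  module

theorem shiftInjective_derTwo (hpr : ∀ y : l, pr y = y) : ShiftInjective (derTwo pr) :=
  (shiftInjective_projL pr hpr).derExt pr hpr

variable {pr} in
theorem derTwo_lie (hpre : ∀ (y : l) (z : g), pr ⁅(y : g), z⁆ = ⁅y, pr z⁆) (y : l)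
    (u : g ⊗[ℂ] g) : derTwo pr ⁅(y : g), u⁆ = ⁅(y : g), derTwo pr u⁆ :=
  derExt_lie hpre (fun y x => congrArg Subtype.val (hpre y x)) y u

theorem map_projM_dOne (hpr : ∀ y : l, pr y = y) (χ : FormalMap n g) (d : Fin n →₀ ℕ) :
    TensorProduct.map (projM pr) (projM pr) (dOne b χ d) = 0 := by
  simp [dOne, gradBar_eq, mapVal, alt2_tmul, projM_coe pr hpr]

theorem map_projM_dTwo (hpr : ∀ y : l, pr y = y) (r : FormalMap n (g ⊗[ℂ] g)) (d : Fin n →₀ ℕ) :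
    TensorProduct.map (projM pr) (TensorProduct.map (projM pr) (projM pr)) (dTwo b r d) = 0 := by
  simp only [dTwo, gradBar_eq, mapVal, Finset.sum_apply, map_sum, mk_apply]
  refine Finset.sum_eq_zero fun i _ => ?_
  induction pderiv i r d with
  | zero => simp
  | add u v hu hv => simp only [tmul_add, map_add, hu, hv, add_zero]
  | tmul x y => simp [alt_tmul, projM_coe pr hpr]

/-- The differential on functions `D → Λ³g`. -/
def dThree (Z : FormalMap n (g ⊗[ℂ] (g ⊗[ℂ] g))) : FormalMap n (g ⊗[ℂ] (g ⊗[ℂ] (g ⊗[ℂ] g))) :=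
  mapVal (alt4 g) (gradBar b Z)

/-! ### Exactness outside `Λ𝔪`, and the homotopy on skew tensors -/

variable [FiniteDimensional ℂ g]

/-- Exactness of the Koszul complex at functions `D → Λ²g`. -/
theorem ordGE_sub_dOne_koszulK (hpr : ∀ y : l, pr y = y) {Z : FormalMap n (g ⊗[ℂ] g)}
    (hs : IsSkew2 Z) {p : ℕ} (hZ : OrdGE p Z) (hd : OrdGE p (dTwo b Z))
    (h0 : p = 0 → TensorProduct.map (projM pr) (projM pr) (Z 0) = 0) :
    OrdGE (p + 1) (Z - dOne b (koszulK b pr (projL pr) Z)) := by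
  intro d hlt
  have hK : OrdGE p (dOne b (koszulK b pr (projL pr) Z)) := (hZ.koszulK b pr).dOne b
  rcases Nat.lt_succ_iff_lt_or_eq.1 hlt with hlt | rfl
  · rw [Pi.sub_apply, hZ d hlt, hK d hlt, sub_zero]
  have key := shift_koszulK b pr hpr (shiftInjective_projL pr hpr) (A := alt2 g)
    (alt2_derTwo pr) (fun d => alt2_rTensor_projL pr (hs d)) (Z := Z) (d := d)
    (by rw [← alt_eq_altStep]; exact hd)
  change (d.degree : ℂ) • (dOne b (koszulK b pr (projL pr) Z) d - Z d) +
    derExt pr (projL pr) (dOne b (koszulK b pr (projL pr) Z) d - Z d) = 0 at key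
  rw [Pi.sub_apply, ← neg_sub, neg_eq_zero]
  -- In positive degree the total degree operator is injective. In degree zero its kernel lies in `𝔪
  -- ⊗ 𝔪`, where the remainder vanishes by the hypothesis on `Z 0`.
  by_cases hd0 : d.degree = 0
  · rw [hd0, Nat.cast_zero, zero_smul, zero_add] at key
    rw [← map_projM_eq_self pr hpr (shiftInjective_projL pr hpr) (projM_comp_projL pr) key,
      map_sub, map_projM_dOne b pr hpr, (Finsupp.degree_eq_zero_iff d).1 hd0, h0 hd0, sub_zero]
  · exact (injective_iff_map_eq_zero _).1
      ((shiftInjective_projL pr hpr).derExt pr hpr d.degree (Nat.one_le_iff_ne_zero.2 hd0)) _ key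

/-- Exactness of the Koszul complex at functions `D → Λ³g`. -/
theorem ordGE_sub_dTwo_koszulK (hpr : ∀ y : l, pr y = y)
    {Z : FormalMap n (g ⊗[ℂ] (g ⊗[ℂ] g))} (hs : ∀ d, IsSkew3 (Z d)) {p : ℕ} (hZ : OrdGE p Z)
    (hd : OrdGE p (dThree b Z)) (h0 : p = 0 →
      TensorProduct.map (projM pr) (TensorProduct.map (projM pr) (projM pr)) (Z 0) = 0) :
    OrdGE (p + 1) (Z - dTwo b (koszulK b pr (derTwo pr) Z)) := by
  intro d hlt
  have hK : OrdGE p (dTwo b (koszulK b pr (derTwo pr) Z)) := (hZ.koszulK b pr).dTwo b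
  rcases Nat.lt_succ_iff_lt_or_eq.1 hlt with hlt | rfl
  · rw [Pi.sub_apply, hZ d hlt, hK d hlt, sub_zero]
  have key := shift_koszulK b pr hpr (shiftInjective_derTwo pr hpr) (A := alt g)
    (alt_derExt pr) (fun d => alt_rTensor_projL pr (hs d)) (Z := Z) (d := d) hd
  change (d.degree : ℂ) • (dTwo b (koszulK b pr (derTwo pr) Z) d - Z d) +
    derExt pr (derTwo pr) (dTwo b (koszulK b pr (derTwo pr) Z) d - Z d) = 0 at key
  rw [Pi.sub_apply, ← neg_sub, neg_eq_zero]
  by_cases hd0 : d.degree = 0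
  · rw [hd0, Nat.cast_zero, zero_smul, zero_add] at key
    rw [← map_projM_eq_self pr hpr (shiftInjective_derTwo pr hpr) (derTwo_left_inverse pr hpr) key,
      map_sub, map_projM_dTwo b pr hpr, (Finsupp.degree_eq_zero_iff d).1 hd0, h0 hd0, sub_zero]
  · exact (injective_iff_map_eq_zero _).1
      ((shiftInjective_derTwo pr hpr).derExt pr hpr d.degree (Nat.one_le_iff_ne_zero.2 hd0)) _ key

theorem flip21_contr (i : Fin n) {Z : g ⊗[ℂ] (g ⊗[ℂ] g)} (hZ : IsSkew3 Z) :
    flip21 g (contr b pr i Z) = -contr b pr i Z := by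
  have h : ∀ Z : g ⊗[ℂ] (g ⊗[ℂ] g), flip21 g (contr b pr i Z) =
      contr b pr i ((flip21 g).lTensor g Z) := fun Z => by
    refine tensor3_induction Z (fun u v hu hv => ?_) fun x y z => ?_
    · simp only [map_add, hu, hv]
    · rw [LinearMap.lTensor_tmul, contr_tmul, contr_tmul, map_smul]
  rw [h, perm132_of_isSkew3 hZ, map_neg]

theorem isSkew2_koszulK (hpr : ∀ y : l, pr y = y) {Z : FormalMap n (g ⊗[ℂ] (g ⊗[ℂ] g))}
    (hs : ∀ d, IsSkew3 (Z d)) : IsSkew2 (koszulK b pr (derTwo pr) Z) := by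
  intro d
  have h : flip21 g (koszulH b pr Z d) = -koszulH b pr Z d := by
    simp only [koszulH, Finset.sum_apply, map_sum, ← Finset.sum_neg_distrib]
    refine Finset.sum_congr rfl fun i _ => ?_
    rcases eq_zero_or_eq_add_single i d with h | ⟨d, rfl⟩
    · simp [mulX_of_eq_zero _ h]
    · simp only [mulX_add_single, mapVal, flip21_contr b pr i (hs d)]
  by_cases hd0 : d.degree = 0
  · have : koszulH b pr Z d = 0 := by
      rw [(Finsupp.degree_eq_zero_iff d).1 hd0]; simp [koszulH, mulX]
    rw [koszulK, this, map_zero, map_zero, neg_zero]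
  · rw [koszulK, ← shiftInv_comm (shiftInjective_derTwo pr hpr _ (Nat.one_le_iff_ne_zero.2 hd0))
      (T := flip21 g) (fun w => (flip21_derTwo pr w).symm), h, map_neg]

/-! #### Dynamical r-matrices with the same value at zero modulo `𝔩` -/

theorem ordGE_actL_pow_sub {V : Type*} [AddCommGroup V] [Module ℂ V] [LieRingModule g V]
    [LieModule ℂ g V] {χ χ' : FormalMap n g} (h' : OrdGE 1 χ') {p : ℕ}
    (h : OrdGE p (χ' - χ)) (f : FormalMap n V) (k : ℕ) :
    OrdGE p ((actL χ' ^ k) f - (actL χ ^ k) f) := by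
  induction k with
  | zero => simp only [pow_zero, sub_self]; exact fun _ _ => rfl
  | succ k ih =>
    have e : (actL χ' ^ (k + 1)) f - (actL χ ^ (k + 1)) f =
        actL χ' ((actL χ' ^ k) f - (actL χ ^ k) f) + actL (χ' - χ) ((actL χ ^ k) f) := by
      rw [show actL (V := V) (χ' - χ) = actL χ' - actL χ from map_sub _ _ _, LinearMap.sub_apply,
        map_sub, pow_succ', pow_succ', Module.End.mul_apply, Module.End.mul_apply]
      abel
    rw [e]
    exact ((h'.actL ih).mono (by omega)).add ((h.actL (ordGE_zero _)).mono (by omega))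

/-- To leading order a change of `χ` acts through `-d`; every other contribution contains `χ' - χ`
undifferentiated or an additional factor `χ` or `χ'`. -/
theorem ordGE_gaugeSkew_add_dOne {χ χ' : FormalMap n g} (h1 : OrdGE 1 χ) (h1' : OrdGE 1 χ') {p : ℕ}
    (h : OrdGE (p + 1) (χ' - χ)) (ρ : FormalMap n (g ⊗[ℂ] g)) :
    OrdGE (p + 1) (gaugeSkew b χ' ρ - gaugeSkew b χ ρ + dOne b (χ' - χ)) := by
  have a1 := ordGE_gaugeSkew_sub (b := b) h1 ρ (p + 1)
  have a2 := ordGE_gaugeSkew_sub (b := b) h1' ρ (p + 1)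
  have a3 : ∀ k, OrdGE (p + 1) (gaugeTerm b χ' ρ (k + 2) - gaugeTerm b χ ρ (k + 2)) := fun k => by
    rw [gaugeTerm, gaugeTerm, ← smul_sub, sub_sub_sub_comm]
    refine ((ordGE_actL_pow_sub h1' h _ _).sub ?_).smul _
    have e : (actL χ' ^ (k + 1)) (dOne b χ') - (actL χ ^ (k + 1)) (dOne b χ) =
        (actL χ' ^ (k + 1)) (dOne b (χ' - χ)) +
          ((actL χ' ^ (k + 1)) (dOne b χ) - (actL χ ^ (k + 1)) (dOne b χ)) := by
      rw [dOne_sub, map_sub]; abel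
    rw [e]
    exact ((h1'.actL_pow (h.dOne b) (k + 1)).mono (by omega)).add (ordGE_actL_pow_sub h1' h _ _)
  have a4 : OrdGE (p + 1) (gaugeTerm b χ' ρ 1 - gaugeTerm b χ ρ 1 + dOne b (χ' - χ)) := by
    have e : gaugeTerm b χ' ρ 1 - gaugeTerm b χ ρ 1 + dOne b (χ' - χ) =
        (actL χ' ^ 1) ρ - (actL χ ^ 1) ρ := by
      simp only [gaugeTerm, dOne_sub]
      simp
      abel
    rw [e]
    exact ordGE_actL_pow_sub h1' h _ _
  have a5 : OrdGE (p + 1) (∑ k ∈ Finset.range p,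
      (gaugeTerm b χ' ρ (k + 2) - gaugeTerm b χ ρ (k + 2))) := OrdGE.sum fun k _ => a3 k
  convert ((a2.sub a1).add a5).add a4 using 1
  rw [Finset.sum_range_succ', Finset.sum_range_succ', Finset.sum_range_succ' (gaugeTerm b χ ρ),
    Finset.sum_range_succ', Finset.sum_sub_distrib]
  simp only [gaugeTerm]
  abel

/-- At the origin the transform only subtracts `dχ(0)`, each term of which has a factor `xᵢ ∈ 𝔩`. -/
theorem map_projM_gaugeSkew (hpr : ∀ y : l, pr y = y) {χ : FormalMap n g} (h1 : OrdGE 1 χ)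
    (ρ : FormalMap n (g ⊗[ℂ] g)) : TensorProduct.map (projM pr) (projM pr) (gaugeSkew b χ ρ 0) =
      TensorProduct.map (projM pr) (projM pr) (ρ 0) := by
  have h := ordGE_gaugeSkew_sub (b := b) h1 ρ 1 0 (by simp)
  have h2 : actL χ ρ 0 = 0 := (h1.actL (ordGE_zero ρ)) 0 (by simp)
  rw [Pi.sub_apply, sub_eq_zero] at h
  rw [h]
  simp [Finset.sum_range_succ, gaugeTerm, h2, map_projM_dOne b pr hpr]

theorem zero_mem_gaugeMaps : (0 : FormalMap n g) ∈ GaugeMaps b := ⟨rfl, isEquivariant_zero⟩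

/-- Successive approximation of `χ`: the leading part of the discrepancy is closed, hence exact, and
a primitive of it is added to `χ`. The hypothesis on the values at zero removes the only
cohomological obstruction. -/
theorem exists_gaugeSkew_eq (hpr : ∀ y : l, pr y = y)
    (hpre : ∀ (y : l) (z : g), pr ⁅(y : g), z⁆ = ⁅y, pr z⁆)
    {ρ σ : FormalMap n (g ⊗[ℂ] g)} (hρ : IsEquivariant b ρ) (hρs : IsSkew2 ρ)
    (hσ : IsEquivariant b σ) (hσs : IsSkew2 σ) {φ : g ⊗[ℂ] (g ⊗[ℂ] g)}
    (hφ : ∀ y : g, ⁅y, φ⁆ = 0) (hρc : dynCYB b ρ = constMap n φ) (hσc : dynCYB b σ = constMap n φ)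
    (h0 : TensorProduct.map (projM pr) (projM pr) (ρ 0) =
      TensorProduct.map (projM pr) (projM pr) (σ 0)) :
    ∃ χ ∈ GaugeMaps b, gaugeSkew b χ ρ = σ := by
  let step : FormalMap n g → FormalMap n g := fun χ =>
    -- The sign is positive because the gauge transform responds to a change of `χ` by minus its
    -- differential.
    χ + koszulK b pr (projL pr) (gaugeSkew b χ ρ - σ)
  let u : ℕ → FormalMap n g := fun p => step^[p] 0
  have hu : ∀ p, u (p + 1) = step (u p) := fun p => Function.iterate_succ_apply' step p 0
  have main : ∀ p, u p ∈ GaugeMaps b ∧ OrdGE p (gaugeSkew b (u p) ρ - σ) := fun p => by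
    induction p with
    | zero => exact ⟨zero_mem_gaugeMaps b, ordGE_zero _⟩
    | succ p ih =>
      obtain ⟨hχ, ho⟩ := ih
      have h1 : OrdGE 1 (u p) := ordGE_one_iff.2 hχ.1
      have he := (isEquivariant_gaugeSkew h1 hχ.2 hρ).sub hσ
      have hK : OrdGE (p + 1) (koszulK b pr (projL pr) (gaugeSkew b (u p) ρ - σ)) :=
        ho.koszulK b pr
      have hd : OrdGE p (dTwo b (gaugeSkew b (u p) ρ - σ)) := by
        have c1 := dynCYB_gaugeSkew h1 hχ.2 hρ hρs hφ hρc
        rw [← hσc] at c1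
        -- Subtracting the two equations expresses the differential of the discrepancy by brackets
        -- containing the discrepancy, so it vanishes below order `p`.
        have e : dTwo b (gaugeSkew b (u p) ρ - σ) =
            -(bilin (cybBilin g) (gaugeSkew b (u p) ρ - σ) (gaugeSkew b (u p) ρ) +
              bilin (cybBilin g) σ (gaugeSkew b (u p) ρ - σ)) := by
          rw [dTwo_sub, bilin_sub_left, bilin_sub_right]
          rw [dynCYB, dynCYB] at c1
          linear_combination (norm := abel) c1
        rw [e]
        exact (((ho.bilin (ordGE_zero _) _).mono (by omega)).add
          (((ordGE_zero _).bilin ho _).mono (by omega))).neg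
      have hex := ordGE_sub_dOne_koszulK b pr hpr ((isSkew2_gaugeSkew h1 hρs).sub hσs) ho hd
        fun _ => by rw [Pi.sub_apply, map_sub, map_projM_gaugeSkew b pr hpr h1, h0, sub_self]
      have hχ' : step (u p) ∈ GaugeMaps b := by
        refine ⟨?_, hχ.2.add (he.koszulK hpre (shiftInjective_projL pr hpr)
          fun y x => congrArg Subtype.val (hpre y x))⟩
        exact ordGE_one_iff.1 (h1.add (hK.mono (by omega)))
      rw [hu]
      refine ⟨hχ', ?_⟩
      have e : step (u p) - u p = koszulK b pr (projL pr) (gaugeSkew b (u p) ρ - σ) :=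
        add_sub_cancel_left _ _
      have h2 := ordGE_gaugeSkew_add_dOne b h1 (ordGE_one_iff.2 hχ'.1) (e ▸ hK) ρ
      rw [e] at h2
      convert h2.add hex using 1
      abel
  have hlim := ordGE_limSeries_sub (u := u) fun p => by
    rw [hu]
    have e : step (u p) - u p = koszulK b pr (projL pr) (gaugeSkew b (u p) ρ - σ) :=
      add_sub_cancel_left _ _
    rw [e]
    exact (main p).2.koszulK b pr
  have h1 : OrdGE 1 (limSeries u) := by
    have := (hlim 0).add (ordGE_one_iff.2 (main 0).1.1)
    rwa [sub_add_cancel] at this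
  refine ⟨limSeries u, ⟨ordGE_one_iff.1 h1, isEquivariant_of_degree fun p =>
    ⟨u p, (main p).1.2, (hlim p).mono (Nat.le_succ p)⟩⟩, eq_of_forall_ordGE fun p => ?_⟩
  have h2 := ordGE_gaugeSkew_add_dOne b (ordGE_one_iff.2 (main p).1.1) h1 (hlim p) ρ
  convert ((h2.mono (Nat.le_succ p)).add (main p).2).sub ((hlim p).dOne b) using 1
  abel

end Classification


/-! ### Existence of dynamical r-matrices -/

section Existence

open TensorProduct TensorProduct.LieModule

variable {n : ℕ} {g : Type*} [LieRing g] [LieAlgebra ℂ g] {l : LieSubalgebra ℂ g}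
  (b : Module.Basis (Fin n) ℂ l)

/-! ### The Bianchi identity -/

theorem sum_sum_eq_zero_of_antisymm {ι M : Type*} [Fintype ι] [AddCommGroup M] [Module ℂ M]
    {F : ι → ι → M} (h : ∀ i k, F i k = -F k i) : ∑ i, ∑ k, F i k = 0 := by
  have e : ∑ i, ∑ k, F i k = -∑ i, ∑ k, F i k := by
    conv_lhs => rw [Finset.sum_comm]
    simp only [← Finset.sum_neg_distrib]
    exact Finset.sum_congr rfl fun i _ => Finset.sum_congr rfl fun k _ => h k i
  have e2 : (2 : ℂ) • ∑ i, ∑ k, F i k = 0 := by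
    rw [two_smul]; exact eq_neg_iff_add_eq_zero.1 e
  exact (smul_eq_zero.1 e2).resolve_left two_ne_zero

theorem dThree_eq (Z : FormalMap n (g ⊗[ℂ] (g ⊗[ℂ] g))) :
    dThree b Z = ∑ i, mapVal (alt4 g ∘ₗ TensorProduct.mk ℂ g _ (b i : g)) (pderiv i Z) := by
  rw [dThree, gradBar_eq, mapVal_sum]; rfl

theorem dTwo_eq (r : FormalMap n (g ⊗[ℂ] g)) :
    dTwo b r = ∑ i, mapVal (alt g ∘ₗ TensorProduct.mk ℂ g _ (b i : g)) (pderiv i r) := by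
  rw [dTwo, gradBar_eq, mapVal_sum]; rfl

theorem dThree_add (Z Z' : FormalMap n (g ⊗[ℂ] (g ⊗[ℂ] g))) :
    dThree b (Z + Z') = dThree b Z + dThree b Z' := by
  rw [dThree, gradBar_add, mapVal_add]; rfl

theorem dThree_sub (Z Z' : FormalMap n (g ⊗[ℂ] (g ⊗[ℂ] g))) :
    dThree b (Z - Z') = dThree b Z - dThree b Z' := by
  rw [dThree, gradBar_sub, mapVal_sub]; rfl

theorem dThree_constMap (φ : g ⊗[ℂ] (g ⊗[ℂ] g)) : dThree b (constMap n φ) = 0 := by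
  rw [dThree, gradBar_constMap, mapVal_zero]

theorem wedgeTwoTwo_tmul_swap (x y : g) {s : g ⊗[ℂ] g} (hs : flip21 g s = -s) :
    wedgeTwoTwo g (x ⊗ₜ y) s = -wedgeTwoTwo g (y ⊗ₜ x) s := by
  refine skew_induction hs (fun r r' h h' => ?_) fun u v => ?_
  · rw [map_add, map_add, h, h', neg_add]
  · rw [wedgeTwoTwo_tmul, wedgeTwoTwo_tmul, ← wedge4_eq, ← wedge4_eq, wedge4_swap₁ y x]

theorem dThree_dTwo {ρ : FormalMap n (g ⊗[ℂ] g)} (hs : IsSkew2 ρ) : dThree b (dTwo b ρ) = 0 := by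
  have h : dThree b (dTwo b ρ) =
      ∑ i, ∑ k, mapVal (wedgeTwoTwo g ((b i : g) ⊗ₜ (b k : g))) (pderiv i (pderiv k ρ)) := by
    simp only [dThree_eq, dTwo_eq, pderiv_sum, mapVal_sum, ← mapVal_pderiv]
    rfl
  rw [h]
  refine sum_sum_eq_zero_of_antisymm fun i k => ?_
  rw [pderiv_comm k i]
  exact funext fun d => wedgeTwoTwo_tmul_swap _ _ ((hs.pderiv k).pderiv i d)

/-- Equivariance replaces `⁅xᵢ, ρ⁆` by derivatives with coefficients antisymmetric in `i, k`, while
`∂ₖρ ∧ ∂ᵢρ` is symmetric because bivectors commute. -/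
theorem sum_wedgeTwoTwo_lie {ρ : FormalMap n (g ⊗[ℂ] g)} (he : IsEquivariant b ρ)
    (hs : IsSkew2 ρ) : ∑ i, bilin (wedgeTwoTwo g)
      (mapVal (LieModule.toEnd ℂ g (g ⊗[ℂ] g) (b i : g)) ρ) (pderiv i ρ) = 0 := by
  have h1 : ∀ i, mapVal (LieModule.toEnd ℂ g (g ⊗[ℂ] g) (b i : g)) ρ = -coadDer b (b i) ρ :=
    fun i => by rw [he.coadDer, neg_neg]
  simp only [h1, coadDer, bilin_neg_left, bilin_sum_left, bilin_smul_left, bilin_mulX_left,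
    Finset.sum_neg_distrib, neg_eq_zero]
  refine sum_sum_eq_zero_of_antisymm fun i k => ?_
  rw [← Finset.sum_neg_distrib]
  refine Finset.sum_congr rfl fun j _ => ?_
  have h2 : bilin (wedgeTwoTwo g) (pderiv k ρ) (pderiv i ρ) =
      bilin (wedgeTwoTwo g) (pderiv i ρ) (pderiv k ρ) := by
    rw [bilin_swap]
    refine bilin_congr_of fun p q => ?_
    rw [LinearMap.flip_apply]
    exact wedgeTwoTwo_comm (hs.pderiv k q) (hs.pderiv i p)
  rw [h2, ← lie_skew (b i) (b k), map_neg, Finsupp.neg_apply, neg_smul]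

theorem brTwoThree_dTwo {ρ : FormalMap n (g ⊗[ℂ] g)} (he : IsEquivariant b ρ) (hs : IsSkew2 ρ) :
    bilin (brTwoThree g) ρ (dTwo b ρ) + dThree b (bilin (cybBilin g) ρ ρ) = 0 := by
  have h : ∀ i, bilin (brTwoThree g) ρ
      (mapVal (alt g ∘ₗ TensorProduct.mk ℂ g _ (b i : g)) (pderiv i ρ)) +
      mapVal (alt4 g ∘ₗ TensorProduct.mk ℂ g _ (b i : g))
        (pderiv i (bilin (cybBilin g) ρ ρ)) + (1 / 2 : ℂ) • bilin (wedgeTwoTwo g)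
      (mapVal (LieModule.toEnd ℂ g (g ⊗[ℂ] g) (b i : g)) ρ) (pderiv i ρ) = 0 := fun i => by
    rw [pderiv_bilin, bilin_swap _ (pderiv i ρ) ρ]
    funext d
    simp only [bilin, mapVal, Pi.add_apply, Pi.smul_apply, map_add, map_sum, Finset.smul_sum,
      ← Finset.sum_add_distrib, Pi.zero_apply]
    refine Finset.sum_eq_zero fun p _ => ?_
    rw [← brTwoThree_alt (b i : g) (hs p.1) (hs.pderiv i p.2), tmul_add, map_add]
    simp only [LinearMap.comp_apply, TensorProduct.mk_apply, LinearMap.flip_apply,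
      LieModule.toEnd_apply_apply]
    abel
  have := Finset.sum_congr (rfl : (Finset.univ : Finset (Fin n)) = _) fun i _ => h i
  simpa only [Finset.sum_add_distrib, ← Finset.smul_sum, sum_wedgeTwoTwo_lie b he hs, smul_zero,
    add_zero, Finset.sum_const_zero, ← bilin_sum_right, ← dTwo_eq, ← dThree_eq] using this

/-- The identity `[ρ, [ρ, ρ]] = 0`. All six permutations of the triple product agree when the three
series coincide, and their sum vanishes by Jacobi; hence the division by `6`. -/
theorem bilin_brTwoThree_cybBilin {ρ : FormalMap n (g ⊗[ℂ] g)} (hs : IsSkew2 ρ) :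
    bilin (brTwoThree g) ρ (bilin (cybBilin g) ρ ρ) = 0 := by
  rw [bilin_bilin_right]
  set T : g ⊗[ℂ] g → g ⊗[ℂ] g → g ⊗[ℂ] g → _ := fun x y z => brTwoThree g x (cybBilin g y z)
  have e1 : trilin (fun x y z => T x z y) ρ ρ ρ = trilin T ρ ρ ρ := (trilin_swap_right T ρ ρ ρ).symm
  have e2 : trilin (fun x y z => T y x z) ρ ρ ρ = trilin T ρ ρ ρ := (trilin_swap_left T ρ ρ ρ).symm
  have e3 : trilin (fun x y z => T y z x) ρ ρ ρ = trilin T ρ ρ ρ :=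
    (trilin_swap_left (fun x y z => T x z y) ρ ρ ρ).symm.trans e1
  have e4 : trilin (fun x y z => T z x y) ρ ρ ρ = trilin T ρ ρ ρ :=
    (trilin_swap_right (fun x y z => T y x z) ρ ρ ρ).symm.trans e2
  have e5 : trilin (fun x y z => T z y x) ρ ρ ρ = trilin T ρ ρ ρ :=
    (trilin_swap_right (fun x y z => T y z x) ρ ρ ρ).symm.trans e3
  have e : trilin (fun x y z => T x y z + T x z y + (T y z x + T y x z) + (T z x y + T z y x)) ρ ρ ρ
      = 0 := by
    refine (trilin_congr (T' := fun _ _ _ => 0) fun p q s => ?_).trans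
      (funext fun d => by simp [trilin])
    have := brTwoThree_jacobi (hs p) (hs q) (hs s)
    simpa only [map_add] using this
  simp only [← trilin_add, e1, e2, e3, e4, e5] at e
  have e6 : (6 : ℂ) • trilin T ρ ρ ρ = 0 := by rw [← e]; module
  exact (smul_eq_zero.1 e6).resolve_left (by norm_num)

/-- The Bianchi identity for the dynamical Yang-Baxter operator. -/
theorem dThree_dynCYB_sub {ρ : FormalMap n (g ⊗[ℂ] g)} (he : IsEquivariant b ρ) (hs : IsSkew2 ρ)
    {φ : g ⊗[ℂ] (g ⊗[ℂ] g)} (hφ : ∀ y : g, ⁅y, φ⁆ = 0) :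
    dThree b (dynCYB b ρ - constMap n φ) =
      -bilin (brTwoThree g) ρ (dynCYB b ρ - constMap n φ) := by
  have h1 : bilin (brTwoThree g) ρ (constMap n φ) = 0 := by
    rw [bilin_constMap_right]
    exact funext fun d => brTwoThree_invariant _ hφ
  rw [bilin_sub_right, h1, sub_zero, dThree_sub, dThree_constMap, sub_zero, dynCYB, dThree_add,
    dThree_dTwo b hs, zero_add, bilin_add_right, bilin_brTwoThree_cybBilin hs, add_zero,
    eq_neg_iff_add_eq_zero, add_comm]
  exact brTwoThree_dTwo b he hs

theorem isSkew3_dTwo {ρ : FormalMap n (g ⊗[ℂ] g)} (hs : IsSkew2 ρ) (d : Fin n →₀ ℕ) :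
    IsSkew3 (dTwo b ρ d) := by
  rw [dTwo_eq, Finset.sum_apply]
  exact Finset.sum_induction _ IsSkew3 (fun _ _ => IsSkew3.add) isSkew3_zero
    fun i _ => isSkew3_alt_tmul _ (hs.pderiv i d)

/-- Only the polarized operator has skew values, so the Cauchy product is first averaged with its
reversal. -/
theorem isSkew3_bilin_cybBilin {ρ : FormalMap n (g ⊗[ℂ] g)} (hs : IsSkew2 ρ) (d : Fin n →₀ ℕ) :
    IsSkew3 (bilin (cybBilin g) ρ ρ d) := by
  have h : bilin (cybBilin g) ρ ρ d = (1 / 2 : ℂ) •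
      ∑ p ∈ Finset.HasAntidiagonal.antidiagonal d,
        (cybBilin g (ρ p.1) (ρ p.2) + cybBilin g (ρ p.2) (ρ p.1)) := by
    have h2 := congrFun (bilin_swap (cybBilin g) ρ ρ) d
    rw [Finset.sum_add_distrib]
    change _ = (1 / 2 : ℂ) • (bilin (cybBilin g) ρ ρ d + bilin (cybBilin g).flip ρ ρ d)
    rw [← h2]
    module
  rw [h]
  exact (Finset.sum_induction _ IsSkew3 (fun _ _ => IsSkew3.add) isSkew3_zero
    fun p _ => isSkew3_cybBilin (hs _) (hs _)).smul _

theorem isEquivariant_dynCYB {ρ : FormalMap n (g ⊗[ℂ] g)} (he : IsEquivariant b ρ) :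
    IsEquivariant b (dynCYB b ρ) :=
  he.dTwo.add (he.bilin (fun y r s => lie_cybBilin (y : g) r s) he)

theorem isSkew3_constMap {φ : g ⊗[ℂ] (g ⊗[ℂ] g)} (hφ : IsSkew3 φ) (d : Fin n →₀ ℕ) :
    IsSkew3 (constMap n φ d) := by
  rw [constMap]
  split_ifs
  · exact hφ
  · exact isSkew3_zero

theorem IsSkew3.sub {Z Z' : g ⊗[ℂ] (g ⊗[ℂ] g)} (h : IsSkew3 Z) (h' : IsSkew3 Z') :
    IsSkew3 (Z - Z') := by
  rw [sub_eq_add_neg, ← neg_one_smul ℂ Z']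
  exact h.add (h'.smul _)

theorem isSkew3_dynCYB {ρ : FormalMap n (g ⊗[ℂ] g)} (hs : IsSkew2 ρ) (d : Fin n →₀ ℕ) :
    IsSkew3 (dynCYB b ρ d) := (isSkew3_dTwo b hs d).add (isSkew3_bilin_cybBilin hs d)

theorem dynCYB_apply_zero (ρ : FormalMap n (g ⊗[ℂ] g)) :
    dynCYB b ρ 0 = dTwo b ρ 0 + CYB (ρ 0) := by
  simp [dynCYB, bilin, CYB]

/-- The linearization of the equation is `d`: the quadratic terms do not lose an order, whereas `d`
does. -/
theorem ordGE_dynCYB_sub {ρ ρ' : FormalMap n (g ⊗[ℂ] g)} {p : ℕ} (h : OrdGE (p + 1) (ρ' - ρ)) :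
    OrdGE (p + 1) (dynCYB b ρ' - dynCYB b ρ - dTwo b (ρ' - ρ)) := by
  have e : dynCYB b ρ' - dynCYB b ρ - dTwo b (ρ' - ρ) =
      bilin (cybBilin g) (ρ' - ρ) ρ' + bilin (cybBilin g) ρ (ρ' - ρ) := by
    rw [dynCYB, dynCYB, dTwo_sub, bilin_sub_left, bilin_sub_right]; abel
  rw [e]
  exact ((h.bilin (ordGE_zero _) _).mono (by omega)).add
    (((ordGE_zero _).bilin h _).mono (by omega))

/-! ### Construction of a solution by successive approximation -/

variable [FiniteDimensional ℂ g] (pr : g →ₗ[ℂ] l)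

/-- One step of the construction of a solution of the dynamical Yang-Baxter equation. -/
def improve (φ : g ⊗[ℂ] (g ⊗[ℂ] g)) (ρ : FormalMap n (g ⊗[ℂ] g)) : FormalMap n (g ⊗[ℂ] g) :=
  ρ - koszulK b pr (derTwo pr) (dynCYB b ρ - constMap n φ)

/-- The solution of the dynamical Yang-Baxter equation with value `u` at zero. -/
def solution (φ : g ⊗[ℂ] (g ⊗[ℂ] g)) (u : g ⊗[ℂ] g) : FormalMap n (g ⊗[ℂ] g) :=
  limSeries fun p => (improve b pr φ)^[p] (constMap n u)

/-- The leading part of the error is closed by the Bianchi identity, hence is the differential of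
its image under the homotopy, which is subtracted. Corrections have positive order, so the value at
zero is kept. -/
theorem solution_spec (hpr : ∀ y : l, pr y = y)
    (hpre : ∀ (y : l) (z : g), pr ⁅(y : g), z⁆ = ⁅y, pr z⁆)
    {φ : g ⊗[ℂ] (g ⊗[ℂ] g)} (hφ : ∀ y : g, ⁅y, φ⁆ = 0) (hφs : IsSkew3 φ)
    {u : g ⊗[ℂ] g} (hu : ∀ y : l, ⁅(y : g), u⁆ = 0) (hus : flip21 g u = -u)
    (h0 : TensorProduct.map (projM pr) (TensorProduct.map (projM pr) (projM pr)) (CYB u - φ) = 0) :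
    IsEquivariant b (solution b pr φ u) ∧ IsSkew2 (solution b pr φ u) ∧
      dynCYB b (solution b pr φ u) = constMap n φ ∧ solution b pr φ u 0 = u := by
  set v : ℕ → FormalMap n (g ⊗[ℂ] g) := fun p => (improve b pr φ)^[p] (constMap n u) with hv_def
  have hv : ∀ p, v (p + 1) = improve b pr φ (v p) := fun p => Function.iterate_succ_apply' _ p _
  have e : ∀ p, v (p + 1) - v p = -koszulK b pr (derTwo pr) (dynCYB b (v p) - constMap n φ) :=
    fun p => by rw [hv, improve]; abel
  have main : ∀ p, IsEquivariant b (v p) ∧ IsSkew2 (v p) ∧ v p 0 = u ∧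
      OrdGE p (dynCYB b (v p) - constMap n φ) := fun p => by
    induction p with
    | zero =>
      refine ⟨isEquivariant_constMap hu, fun d => ?_, constMap_zero_apply u, ordGE_zero _⟩
      change flip21 g (constMap n u d) = -constMap n u d
      simp only [constMap]
      split_ifs
      · exact hus
      · simp
    | succ p ih =>
      obtain ⟨h1, h2, h3, h4⟩ := ih
      have hZs : ∀ d, IsSkew3 ((dynCYB b (v p) - constMap n φ) d) := fun d =>
        (isSkew3_dynCYB b h2 d).sub (isSkew3_constMap hφs d)
      have hK : OrdGE (p + 1) (koszulK b pr (derTwo pr) (dynCYB b (v p) - constMap n φ)) :=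
        h4.koszulK b pr
      have hd : OrdGE p (dThree b (dynCYB b (v p) - constMap n φ)) := by
        rw [dThree_dynCYB_sub b h1 h2 hφ]
        exact (((ordGE_zero _).bilin h4 _).mono (by omega)).neg
      -- The obstruction occurs only for `p = 0`: modulo `𝔩` the differential disappears, and `CYB u
      -- - φ` is left.
      have hex := ordGE_sub_dTwo_koszulK b pr hpr hZs h4 hd fun _ => by
        rw [Pi.sub_apply, dynCYB_apply_zero, constMap_zero_apply, h3, add_sub_assoc, map_add,
          map_projM_dTwo b pr hpr, h0, add_zero]
      refine ⟨?_, ?_, ?_, ?_⟩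
      · rw [hv, improve]
        exact h1.sub (((isEquivariant_dynCYB b h1).sub
          (isEquivariant_constMap fun y => hφ y)).koszulK hpre (shiftInjective_derTwo pr hpr)
            (derTwo_lie hpre))
      · rw [hv, improve]
        exact h2.sub (isSkew2_koszulK b pr hpr hZs)
      · rw [hv, improve, Pi.sub_apply, hK 0 (by simp), sub_zero, h3]
      · have h5 := ordGE_dynCYB_sub b (ρ := v p) (ρ' := v (p + 1)) (e p ▸ hK.neg)
        have e2 : dTwo b (v (p + 1) - v p) =
            -dTwo b (koszulK b pr (derTwo pr) (dynCYB b (v p) - constMap n φ)) := by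
          rw [e, ← neg_one_smul ℂ, dTwo_smul, neg_one_smul]
        rw [e2] at h5
        convert h5.add hex using 1
        abel
  have hlim : ∀ p, OrdGE (p + 1) (solution b pr φ u - v p) := ordGE_limSeries_sub (u := v)
    fun p => by rw [e]; exact ((main p).2.2.2.koszulK b pr).neg
  refine ⟨isEquivariant_of_degree fun p => ⟨v p, (main p).1, (hlim p).mono (Nat.le_succ p)⟩,
    -- By definition of the limit, its coefficient at `d` is that of the approximation with index
    -- `|d|`.
    fun d => (main d.degree).2.1 d, eq_of_forall_ordGE fun p => ?_, ?_⟩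
  · have h5 := ordGE_dynCYB_sub b (hlim p)
    convert ((h5.mono (Nat.le_succ p)).add ((hlim p).dTwo b)).add (main p).2.2.2 using 1
    abel
  · have := hlim 0 0 (by simp)
    rw [Pi.sub_apply, sub_eq_zero] at this
    rw [this, (main 0).2.2.1]

end Existence


/-! ### Regular dependence on parameters -/

section RegularDependence

variable {n : ℕ} {S T V W U : Type*} [AddCommGroup V] [Module ℂ V] [AddCommGroup W] [Module ℂ W]
  [AddCommGroup U] [Module ℂ U] {A : Subalgebra ℂ (S → ℂ)}

theorem comp_mem_of_mem_adjoin {G : Set (T → ℂ)} {t : S → T} (h : ∀ f ∈ G, f ∘ t ∈ A)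
    {f : T → ℂ} (hf : f ∈ Algebra.adjoin ℂ G) : f ∘ t ∈ A := by
  induction hf using Algebra.adjoin_induction with
  | mem f hf => exact h f hf
  | algebraMap c => exact A.algebraMap_mem c
  | add f k _ _ hf hk => exact A.add_mem hf hk
  | mul f k _ _ hf hk => exact A.mul_mem hf hk

/-- The coordinates of the vector valued function `F` belong to `A`. -/
def RegIn (A : Subalgebra ℂ (S → ℂ)) (F : S → V) : Prop :=
  ∀ ψ : Module.Dual ℂ V, (fun s => ψ (F s)) ∈ A

theorem RegIn.add {F H : S → V} (hF : RegIn A F) (hH : RegIn A H) :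
    RegIn A (fun s => F s + H s) := fun ψ => by
  simp only [map_add]
  exact A.add_mem (hF ψ) (hH ψ)

theorem RegIn.sub {F H : S → V} (hF : RegIn A F) (hH : RegIn A H) :
    RegIn A (fun s => F s - H s) := fun ψ => by
  simp only [map_sub]
  exact A.sub_mem (hF ψ) (hH ψ)

theorem regIn_const (v : V) : RegIn A (fun _ => v) := fun ψ => A.algebraMap_mem (ψ v)

theorem RegIn.map {F : S → V} (hF : RegIn A F) (L : V →ₗ[ℂ] W) : RegIn A (fun s => L (F s)) :=
  fun ψ => hF (ψ ∘ₗ L)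

theorem RegIn.sum {ι : Type*} {I : Finset ι} {F : ι → S → V} (hF : ∀ i ∈ I, RegIn A (F i)) :
    RegIn A (fun s => ∑ i ∈ I, F i s) := fun ψ => by
  have := A.sum_mem fun i hi => hF i hi ψ
  convert this using 1
  funext s
  rw [map_sum, Finset.sum_apply]

theorem RegIn.bilin [FiniteDimensional ℂ V] [FiniteDimensional ℂ W] {F : S → V} {H : S → W}
    (hF : RegIn A F) (hH : RegIn A H) (B : V →ₗ[ℂ] W →ₗ[ℂ] U) :
    RegIn A (fun s => B (F s) (H s)) := fun ψ => by
  let e := Module.finBasis ℂ V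
  let f := Module.finBasis ℂ W
  have h := A.sum_mem (t := Finset.univ) fun i _ => A.sum_mem (t := Finset.univ) fun j _ =>
    A.mul_mem (A.mul_mem (hF (e.coord i)) (hH (f.coord j))) (A.algebraMap_mem (ψ (B (e i) (f j))))
  convert h using 1
  funext s
  change ψ (B (F s) (H s)) = _
  conv_lhs => rw [← e.sum_repr (F s), ← f.sum_repr (H s)]
  simp only [map_sum, map_smul, LinearMap.sum_apply, LinearMap.smul_apply, smul_eq_mul,
    Finset.sum_apply, Finset.mul_sum, Pi.mul_apply, Module.Basis.coord_apply]
  rw [Finset.sum_comm]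
  refine Finset.sum_congr rfl fun i _ => ?_
  refine Finset.sum_congr rfl fun j _ => ?_
  rw [Pi.algebraMap_apply, Algebra.algebraMap_self_apply]
  ring

/-- The coefficients of the family `F` of series belong to `A`. -/
def RegSeries (A : Subalgebra ℂ (S → ℂ)) (F : S → FormalMap n V) : Prop :=
  ∀ d, RegIn A (fun s => F s d)

theorem RegSeries.add {F H : S → FormalMap n V} (hF : RegSeries A F) (hH : RegSeries A H) :
    RegSeries A (fun s => F s + H s) := fun d => (hF d).add (hH d)

theorem RegSeries.sub {F H : S → FormalMap n V} (hF : RegSeries A F) (hH : RegSeries A H) :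
    RegSeries A (fun s => F s - H s) := fun d => (hF d).sub (hH d)

theorem RegSeries.mapVal {F : S → FormalMap n V} (hF : RegSeries A F) (L : V →ₗ[ℂ] W) :
    RegSeries A (fun s => mapVal L (F s)) := fun d => (hF d).map L

theorem RegSeries.bilin [FiniteDimensional ℂ V] [FiniteDimensional ℂ W] {F : S → FormalMap n V}
    {H : S → FormalMap n W} (hF : RegSeries A F) (hH : RegSeries A H) (B : V →ₗ[ℂ] W →ₗ[ℂ] U) :
    RegSeries A (fun s => bilin B (F s) (H s)) := fun _ =>
  RegIn.sum fun p _ => (hF p.1).bilin (hH p.2) B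

theorem RegSeries.pderiv {F : S → FormalMap n V} (hF : RegSeries A F) (i : Fin n) :
    RegSeries A (fun s => pderiv i (F s)) := fun d =>
  (hF (d + Finsupp.single i 1)).map (((d i + 1 : ℕ) : ℂ) • LinearMap.id)

theorem RegSeries.mulX {F : S → FormalMap n V} (hF : RegSeries A F) (i : Fin n) :
    RegSeries A (fun s => mulX i (F s)) := fun d => by
  rcases eq_zero_or_eq_add_single i d with hd | ⟨d, rfl⟩
  · simp only [mulX_of_eq_zero _ hd]
    exact regIn_const 0
  · simpa only [mulX_add_single] using hF d

theorem RegSeries.sum {ι : Type*} {I : Finset ι} {F : ι → S → FormalMap n V}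
    (hF : ∀ i ∈ I, RegSeries A (F i)) : RegSeries A (fun s => ∑ i ∈ I, F i s) := fun d => by
  simp only [Finset.sum_apply]
  exact RegIn.sum fun i hi => hF i hi d

theorem regSeries_constMap {F : S → V} (hF : RegIn A F) :
    RegSeries A (fun s => constMap n (F s)) := fun d => by
  simp only [constMap]
  split_ifs
  · exact hF
  · exact regIn_const 0

variable {g : Type*} [LieRing g] [LieAlgebra ℂ g] {l : LieSubalgebra ℂ g} [FiniteDimensional ℂ g]
  (b : Module.Basis (Fin n) ℂ l) (pr : g →ₗ[ℂ] l)

theorem RegSeries.koszulK [FiniteDimensional ℂ W] (N : Module.End ℂ W)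
    {Z : S → FormalMap n (g ⊗[ℂ] W)} (hZ : RegSeries A Z) :
    RegSeries A (fun s => koszulK b pr N (Z s)) := fun d =>
  (RegSeries.sum (fun i _ => (hZ.mapVal (contr b pr i)).mulX i) d).map (shiftInv N d.degree)

theorem RegSeries.dynCYB {F : S → FormalMap n (g ⊗[ℂ] g)} (hF : RegSeries A F) :
    RegSeries A (fun s => dynCYB b (F s)) := by
  simp only [DynRMat.dynCYB, dTwo_eq]
  exact (RegSeries.sum fun i _ => (hF.pderiv i).mapVal _).add (hF.bilin hF _)

/-- The coefficient at `d` needs only `|d|` iterations, each of which is polynomial in finitely many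
coefficients. -/
theorem RegIn.solution (φ : g ⊗[ℂ] (g ⊗[ℂ] g)) {u : S → g ⊗[ℂ] g} (hu : RegIn A u) :
    RegSeries A (fun s => solution b pr φ (u s)) := by
  have h : ∀ p, RegSeries A (fun s => (improve b pr φ)^[p] (constMap n (u s))) := fun p => by
    induction p with
    | zero => exact regSeries_constMap hu
    | succ p ih =>
      simp only [Function.iterate_succ_apply', improve]
      exact ih.sub (((ih.dynCYB b).sub (regSeries_constMap (regIn_const φ))).koszulK b pr _)
  exact fun d => h d.degree d

end RegularDependence

/-! ### The moduli space -/

section ModuliSpace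

open TensorProduct TensorProduct.LieModule

variable {n : ℕ} {g : Type*} [LieRing g] [LieAlgebra ℂ g] {l : LieSubalgebra ℂ g}
  (b : Module.Basis (Fin n) ℂ l) (pr : g →ₗ[ℂ] l)

theorem flip21_map (T : Module.End ℂ g) (u : g ⊗[ℂ] g) :
    flip21 g (TensorProduct.map T T u) = TensorProduct.map T T (flip21 g u) := by
  induction u with
  | zero => simp
  | add u v hu hv => simp only [map_add, hu, hv]
  | tmul x y => rfl

theorem mem_wedgeSquare_iff {m : Submodule ℂ g} (hm : ∀ x, projM pr x ∈ m)
    (hm' : ∀ x ∈ m, projM pr x = x) {u : g ⊗[ℂ] g} : u ∈ wedgeSquare m ↔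
      TensorProduct.map (projM pr) (projM pr) u = u ∧ flip21 g u = -u := by
  rw [wedgeSquare, Submodule.mem_inf, LinearMap.mem_ker, LinearMap.add_apply, LinearMap.id_apply,
    ← eq_neg_iff_add_eq_zero]
  refine and_congr_left fun _ => ⟨?_, fun h => ?_⟩
  · rintro ⟨w, rfl⟩
    rw [← LinearMap.comp_apply, ← TensorProduct.map_comp]
    have : projM pr ∘ₗ m.subtype = m.subtype := LinearMap.ext fun x => hm' x x.2
    rw [this]
  · refine ⟨TensorProduct.map ((projM pr).codRestrict m hm) ((projM pr).codRestrict m hm) u, ?_⟩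
    rw [← LinearMap.comp_apply, ← TensorProduct.map_comp, LinearMap.subtype_comp_codRestrict, h]

/-- The quotient map and the projection to `𝔪` have the same kernel, so each factors through the
other. -/
theorem toQuot3_eq_zero_iff (hpr : ∀ y : l, pr y = y) (Z : g ⊗[ℂ] (g ⊗[ℂ] g)) :
    toQuot3 l Z = 0 ↔
      TensorProduct.map (projM pr) (TensorProduct.map (projM pr) (projM pr)) Z = 0 := by
  have hker : l.toSubmodule ≤ LinearMap.ker (projM pr) := fun y hy => projM_coe pr hpr ⟨y, hy⟩
  have e1 : l.toSubmodule.liftQ (projM pr) hker ∘ₗ l.toSubmodule.mkQ = projM pr :=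
    Submodule.liftQ_mkQ _ _ _
  have e2 : l.toSubmodule.mkQ ∘ₗ projM pr = l.toSubmodule.mkQ := LinearMap.ext fun x => by
    rw [LinearMap.comp_apply, Submodule.mkQ_apply, Submodule.mkQ_apply, Submodule.Quotient.eq]
    have : projM pr x - x = -(pr x : g) := by
      rw [projM, LinearMap.sub_apply, LinearMap.id_apply, sub_sub_cancel_left]; rfl
    rw [this]
    exact l.toSubmodule.neg_mem (pr x).2
  constructor
  · intro h
    have := congrArg (TensorProduct.map (l.toSubmodule.liftQ (projM pr) hker) (TensorProduct.map
      (l.toSubmodule.liftQ (projM pr) hker) (l.toSubmodule.liftQ (projM pr) hker))) h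
    rwa [toQuot3, ← LinearMap.comp_apply, ← TensorProduct.map_comp, ← TensorProduct.map_comp, e1,
      map_zero] at this
  · intro h
    have := congrArg (toQuot3 l) h
    rwa [toQuot3, ← LinearMap.comp_apply, ← TensorProduct.map_comp, ← TensorProduct.map_comp, e2,
      map_zero] at this

variable {pr} in
theorem map_projM_lie (hpre : ∀ (y : l) (z : g), pr ⁅(y : g), z⁆ = ⁅y, pr z⁆) (y : l)
    (u : g ⊗[ℂ] g) : TensorProduct.map (projM pr) (projM pr) ⁅(y : g), u⁆ =
      ⁅(y : g), TensorProduct.map (projM pr) (projM pr) u⁆ := by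
  have h : ∀ x : g, projM pr ⁅(y : g), x⁆ = ⁅(y : g), projM pr x⁆ := fun x => by
    have : projL pr ⁅(y : g), x⁆ = ⁅(y : g), projL pr x⁆ := congrArg Subtype.val (hpre y x)
    simp only [projM, LinearMap.sub_apply, LinearMap.id_apply, lie_sub, this]
  induction u with
  | zero => simp
  | add u v hu hv => simp only [lie_add, map_add, hu, hv]
  | tmul x z => simp only [lie_tmul_right, map_add, TensorProduct.map_tmul, h]

/-- Every term of `Alt(dr)` contains some `xᵢ ∈ 𝔩`, so the dynamical equation at the origin becomes,
modulo `𝔩`, the classical one. -/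
theorem toQuot3_CYB_of_mem_Dynr (hpr : ∀ y : l, pr y = y) {Ω : g ⊗[ℂ] g}
    {r : FormalMap n (g ⊗[ℂ] g)} (hr : r ∈ Dynr b Ω) : toQuot3 l (CYB (r 0)) = 0 := by
  have h : dynCYB b r 0 = 0 := congrFun hr.2.1 0
  rw [dynCYB_apply_zero] at h
  have := congrArg (TensorProduct.map (projM pr) (TensorProduct.map (projM pr) (projM pr))) h
  rwa [map_add, map_projM_dTwo b pr hpr, zero_add, map_zero, ← toQuot3_eq_zero_iff pr hpr] at this

variable [FiniteDimensional ℂ g]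

/-- The difference between `ρ(0)` and its `𝔪`-part has no component in `𝔪 ⊗ 𝔪`, hence equals `dχ(0)`
for some equivariant `χ`. Only order zero matters, so nothing needs to be closed. -/
theorem exists_gaugeSkew_apply_zero (hpr : ∀ y : l, pr y = y)
    (hpre : ∀ (y : l) (z : g), pr ⁅(y : g), z⁆ = ⁅y, pr z⁆) {ρ : FormalMap n (g ⊗[ℂ] g)}
    (he : IsEquivariant b ρ) (hs : IsSkew2 ρ) : ∃ χ ∈ GaugeMaps b,
      gaugeSkew b χ ρ 0 = TensorProduct.map (projM pr) (projM pr) (ρ 0) := by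
  have hidem : projM pr ∘ₗ projM pr = projM pr := LinearMap.ext fun x => by
    simp only [LinearMap.comp_apply, projM, LinearMap.sub_apply, LinearMap.id_apply, map_sub,
      projL_projL pr hpr, sub_self, sub_zero]
  set Z := ρ - constMap n (TensorProduct.map (projM pr) (projM pr) (ρ 0)) with hZ_def
  have hZ : IsEquivariant b Z := he.sub (isEquivariant_constMap fun y => by
    rw [← map_projM_lie hpre, lie_eq_zero_of_isEquivariant he, map_zero])
  have hZs : IsSkew2 Z := hs.sub fun d => by
    simp only [constMap]
    split_ifs
    · rw [flip21_map, hs 0, map_neg]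
    · simp
  have h1 : OrdGE 1 (koszulK b pr (projL pr) Z) := (ordGE_zero Z).koszulK b pr
  refine ⟨koszulK b pr (projL pr) Z, ⟨ordGE_one_iff.1 h1, hZ.koszulK hpre
    (shiftInjective_projL pr hpr) fun y x => congrArg Subtype.val (hpre y x)⟩, ?_⟩
  have hex := ordGE_sub_dOne_koszulK b pr hpr hZs (ordGE_zero Z) (ordGE_zero _) (fun _ => by
    rw [hZ_def, Pi.sub_apply, constMap_zero_apply, map_sub, ← LinearMap.comp_apply,
      ← TensorProduct.map_comp, hidem, sub_self]) 0 (by simp)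
  have h := ordGE_gaugeSkew_sub (b := b) h1 ρ 1 0 (by simp)
  have h2 : actL (koszulK b pr (projL pr) Z) ρ 0 = 0 := (h1.actL (ordGE_zero ρ)) 0 (by simp)
  rw [Pi.sub_apply, sub_eq_zero] at h hex
  rw [h]
  simp only [Finset.sum_range_succ, Finset.range_zero, Finset.sum_empty, gaugeTerm, zero_add,
    Pi.add_apply, Pi.smul_apply, Pi.sub_apply, pow_one, pow_zero, Module.End.one_apply, h2, ← hex]
  rw [hZ_def, Pi.sub_apply, constMap_zero_apply]
  simp

variable {Ω : g ⊗[ℂ] g}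

theorem exists_skew_part {b : Module.Basis (Fin n) ℂ l} (hsymm : flip21 g Ω = Ω)
    (hinv : ∀ y : g, ⁅y, Ω⁆ = 0) {r : FormalMap n (g ⊗[ℂ] g)} (hr : r ∈ Dynr b Ω) :
    ∃ ρ, r = constMap n ((1 / 2 : ℂ) • Ω) + ρ ∧ IsEquivariant b ρ ∧ IsSkew2 ρ ∧
      dynCYB b ρ = constMap n (-CYB ((1 / 2 : ℂ) • Ω)) := by
  obtain ⟨ρ, rfl⟩ : ∃ ρ, r = constMap n ((1 / 2 : ℂ) • Ω) + ρ := ⟨_, (add_sub_cancel _ _).symm⟩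
  exact ⟨ρ, rfl, (mem_Dynr_iff hsymm hinv).1 hr⟩

theorem lie_half (hinv : ∀ y : g, ⁅y, Ω⁆ = 0) (y : g) : ⁅y, (1 / 2 : ℂ) • Ω⁆ = 0 := by
  rw [lie_smul, hinv, smul_zero]

theorem flip21_half (hsymm : flip21 g Ω = Ω) : flip21 g ((1 / 2 : ℂ) • Ω) = (1 / 2 : ℂ) • Ω := by
  rw [map_smul, hsymm]

/-- The `𝔪`-part of the value at zero is a complete invariant. That gauge equivalence is an
equivalence relation follows from this, without composing exponentials. -/
theorem gaugeEquiv_iff (hpr : ∀ y : l, pr y = y)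
    (hpre : ∀ (y : l) (z : g), pr ⁅(y : g), z⁆ = ⁅y, pr z⁆) (hsymm : flip21 g Ω = Ω)
    (hinv : ∀ y : g, ⁅y, Ω⁆ = 0) (r s : Dynr b Ω) : GaugeEquiv b Ω r s ↔
      TensorProduct.map (projM pr) (projM pr) (r.1 0) =
        TensorProduct.map (projM pr) (projM pr) (s.1 0) := by
  obtain ⟨r, hr⟩ := r
  obtain ⟨s, hs⟩ := s
  obtain ⟨ρ, rfl, h1, h2, h3⟩ := exists_skew_part hsymm hinv hr
  obtain ⟨σ, rfl, k1, k2, k3⟩ := exists_skew_part hsymm hinv hs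
  constructor
  · rintro ⟨χ, hχ, h⟩
    change constMap n ((1 / 2 : ℂ) • Ω) + σ = gauge b χ _ at h
    rw [gauge_constMap_add (lie_half hinv) hχ, add_right_inj] at h
    change TensorProduct.map _ _ (_ + ρ 0) = TensorProduct.map _ _ (_ + σ 0)
    rw [map_add, map_add, h, map_projM_gaugeSkew b pr hpr (ordGE_one_iff.2 hχ.1)]
  · intro h
    change TensorProduct.map _ _ (_ + ρ 0) = TensorProduct.map _ _ (_ + σ 0) at h
    rw [map_add, map_add, add_right_inj] at h
    obtain ⟨χ, hχ, e⟩ := exists_gaugeSkew_eq b pr hpr hpre h1 h2 k1 k2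
      (fun y => by rw [lie_neg, lie_CYB_invariant (lie_half hinv), neg_zero]) h3 k3 h
    refine ⟨χ, hχ, ?_⟩
    change constMap n ((1 / 2 : ℂ) • Ω) + σ = gauge b χ _
    rw [gauge_constMap_add (lie_half hinv) hχ, e]

/-- The value at zero of a dynamical r-matrix in the gauge where it lies in `Ω/2 + Λ²𝔪`. -/
def normalValue (Ω : g ⊗[ℂ] g) (r : FormalMap n (g ⊗[ℂ] g)) : g ⊗[ℂ] g :=
  (1 / 2 : ℂ) • Ω + TensorProduct.map (projM pr) (projM pr) (r 0 - (1 / 2 : ℂ) • Ω)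

theorem exists_gauge_apply_zero (hpr : ∀ y : l, pr y = y)
    (hpre : ∀ (y : l) (z : g), pr ⁅(y : g), z⁆ = ⁅y, pr z⁆) (hsymm : flip21 g Ω = Ω)
    (hinv : ∀ y : g, ⁅y, Ω⁆ = 0) {r : FormalMap n (g ⊗[ℂ] g)} (hr : r ∈ Dynr b Ω) :
    ∃ χ ∈ GaugeMaps b, gauge b χ r 0 = normalValue pr Ω r := by
  obtain ⟨ρ, rfl, h1, h2, h3⟩ := exists_skew_part hsymm hinv hr
  obtain ⟨χ, hχ, h⟩ := exists_gaugeSkew_apply_zero b pr hpr hpre h1 h2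
  refine ⟨χ, hχ, ?_⟩
  rw [gauge_constMap_add (lie_half hinv) hχ, Pi.add_apply, h, constMap_zero_apply, normalValue,
    Pi.add_apply, constMap_zero_apply, add_sub_cancel_left]

theorem normalValue_mem_varietyM {m : Submodule ℂ g} (hm : ∀ x, projM pr x ∈ m)
    (hm' : ∀ x ∈ m, projM pr x = x) (hpr : ∀ y : l, pr y = y)
    (hpre : ∀ (y : l) (z : g), pr ⁅(y : g), z⁆ = ⁅y, pr z⁆) (hsymm : flip21 g Ω = Ω)
    (hinv : ∀ y : g, ⁅y, Ω⁆ = 0) {r : FormalMap n (g ⊗[ℂ] g)} (hr : r ∈ Dynr b Ω) :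
    normalValue pr Ω r ∈ varietyM l m Ω := by
  have hidem : projM pr ∘ₗ projM pr = projM pr := LinearMap.ext fun x => hm' _ (hm x)
  obtain ⟨χ, hχ, h⟩ := exists_gauge_apply_zero b pr hpr hpre hsymm hinv hr
  obtain ⟨ρ, rfl, h1, h2, h3⟩ := exists_skew_part hsymm hinv hr
  have e : normalValue pr Ω (constMap n ((1 / 2 : ℂ) • Ω) + ρ) - (1 / 2 : ℂ) • Ω =
      TensorProduct.map (projM pr) (projM pr) (ρ 0) := by
    rw [normalValue, add_sub_cancel_left, Pi.add_apply, constMap_zero_apply, add_sub_cancel_left]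
  refine ⟨?_, fun y => ?_, ?_⟩
  · rw [e, mem_wedgeSquare_iff pr hm hm', ← LinearMap.comp_apply, ← TensorProduct.map_comp, hidem,
      flip21_map, h2 0, map_neg]
    exact ⟨rfl, rfl⟩
  · rw [e, ← map_projM_lie hpre, lie_eq_zero_of_isEquivariant h1, map_zero]
  -- The normal value is the value at zero of a gauge transform, itself a dynamical r-matrix, so it
  -- inherits the Yang-Baxter condition modulo `𝔩`.
  · rw [← h]
    exact toQuot3_CYB_of_mem_Dynr b pr hpr (gauge_mem_Dynr hsymm hinv hχ hr)

/-- A dynamical r-matrix with a given value at zero. -/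
def rMatrixOf (Ω x : g ⊗[ℂ] g) : FormalMap n (g ⊗[ℂ] g) :=
  constMap n ((1 / 2 : ℂ) • Ω) +
    solution b pr (-CYB ((1 / 2 : ℂ) • Ω)) (x - (1 / 2 : ℂ) • Ω)

theorem rMatrixOf_spec {m : Submodule ℂ g} (hm : ∀ x, projM pr x ∈ m)
    (hm' : ∀ x ∈ m, projM pr x = x) (hpr : ∀ y : l, pr y = y)
    (hpre : ∀ (y : l) (z : g), pr ⁅(y : g), z⁆ = ⁅y, pr z⁆) (hsymm : flip21 g Ω = Ω)
    (hinv : ∀ y : g, ⁅y, Ω⁆ = 0) {x : g ⊗[ℂ] g} (hx : x ∈ varietyM l m Ω) :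
    rMatrixOf b pr Ω x ∈ Dynr b Ω ∧ rMatrixOf b pr Ω x 0 = x := by
  obtain ⟨hw, hl, hq⟩ := hx
  have hus := ((mem_wedgeSquare_iff pr hm hm').1 hw).2
  obtain ⟨h1, h2, h3, h4⟩ := solution_spec b pr hpr hpre (φ := -CYB ((1 / 2 : ℂ) • Ω))
    (u := x - (1 / 2 : ℂ) • Ω)
    (fun y => by rw [lie_neg, lie_CYB_invariant (lie_half hinv), neg_zero])
    (by rw [← neg_one_smul ℂ]
        exact (isSkew3_CYB_invariant (lie_half hinv) (flip21_half hsymm)).smul _) hl hus (by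
      -- With `φ = -CYB(Ω/2)` the obstruction `CYB(u) - φ` is `CYB(Ω/2 + u) = CYB(x)`, which
      -- vanishes modulo `𝔩` on the variety.
      rw [sub_neg_eq_add, add_comm, ← CYB_invariant_add (lie_half hinv) hus, add_sub_cancel,
        ← toQuot3_eq_zero_iff pr hpr, hq])
  refine ⟨(mem_Dynr_iff hsymm hinv).2 ⟨h1, h2, h3⟩, ?_⟩
  rw [rMatrixOf, Pi.add_apply, constMap_zero_apply, h4, add_sub_cancel]

theorem normalValue_eq_of_mem {m : Submodule ℂ g} (hm : ∀ x, projM pr x ∈ m)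
    (hm' : ∀ x ∈ m, projM pr x = x) {r : FormalMap n (g ⊗[ℂ] g)}
    (hr : r 0 - (1 / 2 : ℂ) • Ω ∈ wedgeSquare m) : normalValue pr Ω r = r 0 := by
  rw [normalValue, ((mem_wedgeSquare_iff pr hm hm').1 hr).1, add_sub_cancel]

theorem normalValue_eq_iff {r s : FormalMap n (g ⊗[ℂ] g)} :
    normalValue pr Ω r = normalValue pr Ω s ↔ TensorProduct.map (projM pr) (projM pr) (r 0) =
      TensorProduct.map (projM pr) (projM pr) (s 0) := by
  rw [normalValue, normalValue, add_right_inj, map_sub, map_sub, sub_left_inj]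

/-- The projection to `𝔩` along an invariant complement. -/
theorem exists_equivariant_projection (l : LieSubalgebra ℂ g) {m : Submodule ℂ g}
    (hlm : IsCompl l.toSubmodule m) (hm : ∀ y ∈ l, ∀ z ∈ m, ⁅y, z⁆ ∈ m) :
    ∃ pr : g →ₗ[ℂ] l, (∀ y : l, pr y = y) ∧ (∀ (y : l) (z : g), pr ⁅(y : g), z⁆ = ⁅y, pr z⁆) ∧
      (∀ x, projM pr x ∈ m) ∧ ∀ x ∈ m, projM pr x = x := by
  let pr : g →ₗ[ℂ] l := l.toSubmodule.projectionOnto m hlm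
  have h1 : ∀ y : l, pr y = y := fun y => Submodule.projectionOnto_apply_left hlm y
  have h2 : ∀ x ∈ m, pr x = 0 := fun x hx =>
    (Submodule.projectionOnto_apply_eq_zero_iff hlm).2 hx
  have h3 : ∀ x, projM pr x ∈ m := fun x => by
    rw [← Submodule.projectionOnto_apply_eq_zero_iff hlm]
    change pr (x - (pr x : g)) = 0
    rw [map_sub, h1, sub_self]
  refine ⟨pr, h1, fun y z => ?_, h3, fun x hx => ?_⟩
  · have e : ⁅(y : g), z⁆ = ((⁅y, pr z⁆ : l) : g) + ⁅(y : g), projM pr z⁆ := by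
      rw [LieSubalgebra.coe_bracket, ← lie_add]
      change _ = ⁅(y : g), (pr z : g) + (z - (pr z : g))⁆
      rw [add_sub_cancel]
    rw [e, map_add, h1, h2 _ (hm _ y.2 _ (h3 z)), add_zero]
  · change x - (pr x : g) = x
    rw [h2 x hx, ZeroMemClass.coe_zero, sub_zero]

end ModuliSpace

end DynRMat

end

/-! ### The moduli space as an affine variety -/

open DynRMat in
theorem corollary3p3 {g : Type*} [LieRing g] [LieAlgebra ℂ g] [FiniteDimensional ℂ g]
    (l : LieSubalgebra ℂ g) {n : ℕ} (b : Module.Basis (Fin n) ℂ l)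
    (m : Submodule ℂ g) (hlm : IsCompl l.toSubmodule m)
    (hm : ∀ y ∈ l, ∀ z ∈ m, ⁅y, z⁆ ∈ m)
    (Ω : g ⊗[ℂ] g) (hsymm : flip21 g Ω = Ω) (hinv : ∀ y : g, ⁅y, Ω⁆ = 0)
    (hΩ : Ω ∈ tensorSquare l.toSubmodule ⊔ tensorSquare m) :
    (∀ χ ∈ GaugeMaps b, ∀ r ∈ Dynr b Ω, gauge b χ r ∈ Dynr b Ω) ∧
    Equivalence (GaugeEquiv b Ω) ∧
    (∀ C : Moduli b Ω, ∃ r : Dynr b Ω, Moduli.mk b Ω r = C ∧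
      r.1 0 - (1 / 2 : ℂ) • Ω ∈ wedgeSquare m) ∧
    ∃ Φ : Moduli b Ω → varietyM l m Ω,
      (∀ r : Dynr b Ω, r.1 0 - (1 / 2 : ℂ) • Ω ∈ wedgeSquare m →
        (Φ (Moduli.mk b Ω r) : g ⊗[ℂ] g) = r.1 0) ∧
      Function.Bijective Φ ∧
      ∀ f : varietyM l m Ω → ℂ,
        IsRegularOn f ↔ IsRegularModuli b Ω (fun C => f (Φ C)) := by
  obtain ⟨pr, hpr, hpre, hm1, hm2⟩ := exists_equivariant_projection l hlm hm
  have hgauge := gaugeEquiv_iff b pr hpr hpre hsymm hinv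
  have hequiv : Equivalence (GaugeEquiv b Ω) := by
    refine ⟨fun r => (hgauge r r).2 rfl, fun {r s} h => ?_, fun {r s t} h h' => ?_⟩
    · exact (hgauge s r).2 ((hgauge r s).1 h).symm
    · exact (hgauge r t).2 (((hgauge r s).1 h).trans ((hgauge s t).1 h'))
  refine ⟨fun χ hχ r hr => gauge_mem_Dynr hsymm hinv hχ hr, hequiv, fun C => ?_, ?_⟩
  · obtain ⟨r, rfl⟩ := Quot.exists_rep C
    obtain ⟨χ, hχ, h⟩ := exists_gauge_apply_zero b pr hpr hpre hsymm hinv r.2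
    refine ⟨⟨gauge b χ r.1, gauge_mem_Dynr hsymm hinv hχ r.2⟩,
      Quot.sound (hequiv.symm ⟨χ, hχ, rfl⟩), ?_⟩
    change gauge b χ r.1 0 - _ ∈ _
    rw [h]
    exact (normalValue_mem_varietyM b pr hm1 hm2 hpr hpre hsymm hinv r.2).1
  -- The normal value is defined for every representative, so no choice of a normalized one is
  -- needed.
  let Φ : Moduli b Ω → varietyM l m Ω := Quot.lift
    (fun r => ⟨normalValue pr Ω r.1,
      normalValue_mem_varietyM b pr hm1 hm2 hpr hpre hsymm hinv r.2⟩)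
    fun r s h => Subtype.ext ((normalValue_eq_iff pr).2 ((hgauge r s).1 h))
  have hΦ : ∀ r : Dynr b Ω, (Φ (Moduli.mk b Ω r) : g ⊗[ℂ] g) = normalValue pr Ω r.1 :=
    fun r => rfl
  have hspec := fun x : varietyM l m Ω =>
    rMatrixOf_spec b pr hm1 hm2 hpr hpre hsymm hinv x.2
  let sec : varietyM l m Ω → Dynr b Ω := fun x => ⟨rMatrixOf b pr Ω x, (hspec x).1⟩
  have hΦr : ∀ r : Dynr b Ω, r.1 0 - (1 / 2 : ℂ) • Ω ∈ wedgeSquare m →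
      (Φ (Moduli.mk b Ω r) : g ⊗[ℂ] g) = r.1 0 := fun r hr =>
    normalValue_eq_of_mem pr hm1 hm2 hr
  have hsec : ∀ x, Φ (Moduli.mk b Ω (sec x)) = x := fun x => Subtype.ext <| by
    have h : (sec x).1 0 = x := (hspec x).2
    rw [hΦr, h]
    rw [h]
    exact x.2.1
  refine ⟨Φ, hΦr, ⟨fun C C' h => ?_, fun x => ⟨Moduli.mk b Ω (sec x), hsec x⟩⟩,
    fun f => ⟨fun hf => ?_, fun hf => ?_⟩⟩
  · obtain ⟨r, rfl⟩ := Quot.exists_rep C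
    obtain ⟨s, rfl⟩ := Quot.exists_rep C'
    exact Quot.sound ((hgauge r s).2 ((normalValue_eq_iff pr).1 (congrArg Subtype.val h)))
  · refine comp_mem_of_mem_adjoin (t := fun r : Dynr b Ω => Φ (Moduli.mk b Ω r)) ?_ hf
    rintro k ⟨ψ, hk⟩
    have h0 : RegIn (Algebra.adjoin ℂ {h : Dynr b Ω → ℂ | ∃ (d : Fin n →₀ ℕ)
        (ψ : Module.Dual ℂ (g ⊗[ℂ] g)), ∀ r : Dynr b Ω,
          h r = ψ ((r : FormalMap n (g ⊗[ℂ] g)) d)}) (fun r : Dynr b Ω => r.1 0) := fun ψ =>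
      Algebra.subset_adjoin ⟨0, ψ, fun _ => rfl⟩
    -- The normal value is affine in `r(0)`, so coordinates of the coefficient at `0` suffice.
    have h1 := ((regIn_const ((1 / 2 : ℂ) • Ω)).add ((h0.sub (regIn_const ((1 / 2 : ℂ) • Ω))).map
      (TensorProduct.map (projM pr) (projM pr)))) ψ
    exact (funext fun r => hk _ : k ∘ (fun r : Dynr b Ω => Φ (Moduli.mk b Ω r)) = _) ▸ h1
  · have h0 : RegIn (Algebra.adjoin ℂ {h : varietyM l m Ω → ℂ | ∃ ψ : Module.Dual ℂ (g ⊗[ℂ] g),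
        ∀ x : varietyM l m Ω, h x = ψ x}) (fun x : varietyM l m Ω => (x : g ⊗[ℂ] g)) := fun ψ =>
      Algebra.subset_adjoin ⟨ψ, fun _ => rfl⟩
    have h1 := (regSeries_constMap (n := n) (regIn_const ((1 / 2 : ℂ) • Ω))).add
      ((h0.sub (regIn_const ((1 / 2 : ℂ) • Ω))).solution b pr (-CYB ((1 / 2 : ℂ) • Ω)))
    -- Pullback along the section `x ↦ r` recovers `f`, and the Taylor coefficients along it are
    -- polynomial in `x`.
    have h2 := comp_mem_of_mem_adjoin (t := sec) (A := Algebra.adjoin ℂ {h : varietyM l m Ω → ℂ |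
      ∃ ψ : Module.Dual ℂ (g ⊗[ℂ] g), ∀ x : varietyM l m Ω, h x = ψ x}) (by
        rintro k ⟨d, ψ, hk⟩
        exact (funext fun x => hk _ : k ∘ sec = _) ▸ h1 d ψ) hf
    have e : (fun r : Dynr b Ω => f (Φ (Moduli.mk b Ω r))) ∘ sec = f :=
      funext fun x => congrArg f (hsec x)
    rw [e] at h2
    exact h2
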